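/- Let $R$ be a regular domain (a Noetherian integral domain all of whose localizations at prime ideals are regular local rings) with field of fractions $K$. Elements $x_1,\dots,x_d\in R$ form a generalized regular system of parameters if $x_1,\dots,x_d$ is a regular sequence in $R$ in every order and, for every subset $\{i_1,\dots,i_s\}\subseteq\{1,\dots,d\}$, the ring $R/(x_{i_1},\dots,x_{i_s})$ is a regular domain. For an ideal $I$ of $R$ the adjoint of $I$ is $$\operatorname{adj}(I)=\bigcap_v\{r\in R \mid v(r)\ge v(I)-v(J_{R_v/R})\},$$ where $v$ runs over all normalized (integer-valued) valuations of $K$ that are non-negative on $R$ and whose valuation ring $R_v$ is a localization of a finitely generated $R$-algebra, and where $J_{R_v/R}$ is the Jacobian ideal of $R_v$ over $R$, that is, the zeroth Fitting ideal of the $R_v$-module of Kähler differentials $\Omega_{R_v/R}$. Corollary 4.2. Let $x_1,\dots,x_d$ be a generalized regular system of parameters of a regular domain $R$, and let $I,J\subseteq R$ be ideals generated by monomials in $x_1,\dots,x_d$. Then $$\operatorname{adj}(IJ)\subseteq\operatorname{adj}(I)\cdot\operatorname{adj}(J).$$ -/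

import Mathlib

open scoped KaehlerDifferential

noncomputable section

namespace MonomialAdjoint

universe u w

/-- The zeroth Fitting ideal of a finitely generated `A`-module `M`: the ideal generated by the
determinants of all square matrices `C` whose rows are relations among a finite generating family
`g` of `M`, as many relations as there are generators. For a fixed generating family these are the
maximal minors of its (possibly infinite) matrix of relations; by Fitting's lemma the ideal they
generate does not depend on the family, so it is harmless to let the family vary as well. -/
def fittingIdealZero (A : Type*) [CommRing A] (M : Type*) [AddCommGroup M] [Module A M] :
    Ideal A :=
  Ideal.span {c : A | ∃ (n : ℕ) (g : Fin n → M) (C : Matrix (Fin n) (Fin n) A),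
    Submodule.span A (Set.range g) = ⊤ ∧ (∀ i, ∑ j, C i j • g j = 0) ∧ C.det = c}

/-- The Jacobian ideal `J_{B/A}` of an essentially finite type extension of domains `A ⊆ B` with
the same field of fractions (relative dimension zero): the zeroth Fitting ideal of the module of
Kähler differentials of `B` over `A`. -/
def jacobianIdeal (A B : Type*) [CommRing A] [CommRing B] [Algebra A B] : Ideal B :=
  fittingIdealZero B (Ω[B⁄A])

section Valuations

variable {R : Type u} [CommRing R] {K : Type w} [Field K] [Algebra R K]

/-- The valuation ring `R_v = {x ∈ K | 0 ≤ v x}` of a valuation `v` that is non-negative on `R`,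
as an `R`-subalgebra of `K`. -/
def valuationSubalgebra (v : AddValuation K (WithTop ℤ))
    (hv : ∀ r : R, 0 ≤ v (algebraMap R K r)) : Subalgebra R K where
  carrier := {x | 0 ≤ v x}
  mul_mem' {a b} ha hb := by
    simp only [Set.mem_ofPred_eq] at ha hb ⊢
    rw [v.map_mul]
    exact add_nonneg ha hb
  add_mem' {a b} ha hb := (le_min ha hb).trans (v.map_add a b)
  algebraMap_mem' := hv

/-- An integer-valued valuation of `K` is normalized if it takes the value `1` (equivalently its
value group is `ℤ`), or if it is the trivial valuation. -/
def IsNormalized (v : AddValuation K (WithTop ℤ)) : Prop :=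
  (∃ x, v x = 1) ∨ ∀ x, x ≠ 0 → v x = 0

/-- The value `v(𝔞) = inf {v(a) | a ∈ 𝔞}` of an ideal `𝔞` of a ring `A` mapping to `K`
(here `A` is `R` or `R_v`, so that `v` is non-negative on `A`). -/
def idealValue {A : Type*} [CommRing A] [Algebra A K] (v : AddValuation K (WithTop ℤ))
    (𝔞 : Ideal A) : WithTop ℤ :=
  sInf ((fun a : A => v (algebraMap A K a)) '' (𝔞 : Set A))

theorem isGLB_idealValue {A : Type*} [CommRing A] [Algebra A K] (v : AddValuation K (WithTop ℤ))
    (hv : ∀ a : A, 0 ≤ v (algebraMap A K a)) (𝔞 : Ideal A) :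
    IsGLB ((fun a : A => v (algebraMap A K a)) '' (𝔞 : Set A)) (idealValue v 𝔞) :=
  WithTop.isGLB_sInf' ⟨0, by rintro _ ⟨a, _, rfl⟩; exact hv a⟩

variable (K) in
/-- The adjoint of an ideal `I` of a domain `R` with field of fractions `K`: the intersection of
the ideals `{r ∈ R | v(r) ≥ v(I) - v(J_{R_v/R})}`, where `v` runs through the normalized valuations
of `K` that are non-negative on `R` and whose valuation ring `R_v` is a localization of a finitely
generated `R`-algebra. (Such an `R_v` is Noetherian, so every valuation of this kind is equivalent
to exactly one normalized integer-valued one; and `v(J_{R_v/R})` is finite, so the inequality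
may be written without subtraction.) -/
def adjoint (I : Ideal R) : Ideal R where
  carrier := {r | ∀ (v : AddValuation K (WithTop ℤ)) (hv : ∀ s : R, 0 ≤ v (algebraMap R K s)),
    IsNormalized v → Algebra.EssFiniteType R (valuationSubalgebra v hv) →
      idealValue v I ≤
        v (algebraMap R K r) + idealValue v (jacobianIdeal R (valuationSubalgebra v hv))}
  zero_mem' v hv _ _ := by simp
  add_mem' {a b} ha hb v hv hn hf := by
    have h : min (v (algebraMap R K a)) (v (algebraMap R K b)) ≤ v (algebraMap R K (a + b)) := by
      rw [map_add]
      exact v.map_add _ _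
    refine le_trans ?_ (add_le_add_left h _)
    rcases min_choice (v (algebraMap R K a)) (v (algebraMap R K b)) with h' | h' <;> rw [h']
    exacts [ha v hv hn hf, hb v hv hn hf]
  smul_mem' c a ha v hv hn hf := by
    refine (ha v hv hn hf).trans (add_le_add_left ?_ _)
    rw [smul_eq_mul, map_mul, v.map_mul]
    exact le_add_of_nonneg_left (hv c)

end Valuations

section Monomials

variable {R : Type u} [CommRing R] {d : ℕ}

/-- Elements `x₁, …, x_d` of a regular domain `R` form a generalized regular system of parameters
if they are a permutable regular sequence and, for every subset of them, the quotient of `R` by the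
ideal which that subset generates is a regular domain. -/
structure IsGenRegularSystem (x : Fin d → R) : Prop where
  regular : ∀ σ : Equiv.Perm (Fin d),
    RingTheory.Sequence.IsRegular R (List.ofFn fun i => x (σ i))
  isDomain_quotient : ∀ s : Set (Fin d), IsDomain (R ⧸ Ideal.span (x '' s))
  isRegularRing_quotient : ∀ s : Set (Fin d), IsRegularRing (R ⧸ Ideal.span (x '' s))

/-- A monomial ideal in `x₁, …, x_d`: an ideal generated by a set of monomials in the `x_i`. -/
def IsMonomialIdeal (x : Fin d → R) (I : Ideal R) : Prop :=
  ∃ E : Set (Fin d → ℕ), I = Ideal.span ((fun e => ∏ i, x i ^ e i) '' E)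

end Monomials

end MonomialAdjoint

end

set_option linter.unusedSectionVars false

noncomputable section

namespace MonomialAdjoint

/-! ### Ideals generated by monomials in a system of primes -/

/-! Let `I` be generated by the monomials with exponents in a nonempty finite set `A`. The core is a
Howald-type description: `adj I` is generated by the monomials `x^e` such that `e + (1,…,1)` is
interior to the Newton polyhedron of `A`, that is, `min_{a ∈ A} w·a < w·(e + 1)` for every nonzero
weight `w` (`IsInterior`). One inclusion is needed for `IJ`, the other for `I` and `J`.

Interior monomials lie in the adjoint (`monom_mem_adjoint`). A normalized nontrivial valuation `v`
gives the weight `w_i = v(x_i)`, and the claim reduces to `v(J_{R_v/R}) ≥ ∑ w_i - 1`, the sum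
running over the positive `w_i`. For this, present `R_v` by a polynomial ring over `R` with
variables for a uniformizer `π` and for the `u_i` in `x_i = u_i π^{w_i}`. The equations `x_i - U_i
T^{w_i}`, together with `T`, are part of a regular system of parameters at the relevant prime, so
they extend to a system of at most as many local equations of `R_v` as there are variables
(`exists_local_generators_extending`). The Jacobian ideal is then contained in the ideal of one
determinant, whose rows for these equations carry the required powers of `π`.

Conversely (`mem_halfspace_of_mem_adjoint`), each primitive weight `w` defines a monomial valuation,
because the filtration by weight has a domain as its associated graded ring (`mul_notMem`). An
explicit relation matrix among differentials shows that its Jacobian ideal has value at most `∑ w_i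
- 1`. Hence an element of the adjoint lies in the monomial ideal of a half-space, for every `w`.
Finitely many `w` suffice (`exists_finite_weights`) and monomial ideals intersect like their
exponent sets (`mem_monomIdeal_sup`), so the element is a combination of interior monomials.

What remains is convexity (`exists_isInterior_add_le`). If `e + 1` is interior for `A + B`, Farkas'
lemma produces averages `α` of points of `A` and `β` of points of `B` with `α + β < e + 1` in every
coordinate. The integer parts of `α` and `β` are interior exponents for `A` and `B`, and their sum
is at most `e`. -/

instance wellFoundedLT_upperSet {α : Type*} [Preorder α] [WellQuasiOrderedLE α] :
    WellFoundedLT (UpperSet α) := by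
  refine ⟨RelEmbedding.wellFounded_iff_isEmpty.2 ⟨fun f => ?_⟩⟩
  -- Upper sets are ordered by reverse inclusion, so a descending sequence is a growing chain of
  -- sets. Elements that are new at each stage would form a bad sequence for the well-quasi-order.
  have hf : StrictAnti f := strictAnti_nat_of_succ_lt fun n => f.map_rel_iff.2 (Nat.lt_succ_self n)
  have h : ∀ n, ∃ e, e ∈ f (n + 1) ∧ e ∉ f n := fun n => by
    have := (hf (Nat.lt_succ_self n)).not_ge
    rw [← UpperSet.coe_subset_coe, Set.not_subset] at this
    exact this
  choose e he he' using h
  obtain ⟨m, n, hmn, hle⟩ := wellQuasiOrdered_le e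
  exact he' n (hf.antitone (Nat.succ_le_of_lt hmn) ((f (m + 1)).upper hle (he m)))

variable {R : Type*} [CommRing R] {ι : Type*} [Fintype ι]

/-- Every subfamily of `x` generates a prime ideal, which contains no further member of `x`. -/
structure IsPrimeSystem {R : Type*} [CommRing R] {ι : Type*} (x : ι → R) : Prop where
  isPrime : ∀ t : Set ι, (Ideal.span (x '' t)).IsPrime
  notMem : ∀ (t : Set ι) (i : ι), i ∉ t → x i ∉ Ideal.span (x '' t)

theorem IsPrimeSystem.comp {R : Type*} [CommRing R] {ι κ : Type*} {x : ι → R}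
    (hx : IsPrimeSystem x) {f : κ → ι} (hf : Function.Injective f) : IsPrimeSystem (x ∘ f) where
  isPrime t := by
    rw [Set.image_comp]
    exact hx.isPrime _
  notMem t i hi := by
    rw [Set.image_comp]
    exact hx.notMem _ _ fun ⟨j, hj, h⟩ => hi (hf h ▸ hj)

/-- The monomial with exponent vector `e`. -/
def monom (x : ι → R) (e : ι → ℕ) : R := ∏ i, x i ^ e i

@[simp]
theorem monom_zero (x : ι → R) : monom x 0 = 1 := by simp [monom]

theorem monom_add (x : ι → R) (e f : ι → ℕ) : monom x (e + f) = monom x e * monom x f := by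
  simp [monom, pow_add, Finset.prod_mul_distrib]

@[simp]
theorem monom_single [DecidableEq ι] (x : ι → R) (i : ι) : monom x (Pi.single i 1) = x i := by
  rw [monom, Finset.prod_eq_single i] <;> simp +contextual

/-- The ideal generated by the monomials with exponent vector in `E`. -/
def monomIdeal (x : ι → R) (E : UpperSet (ι → ℕ)) : Ideal R := Ideal.span (monom x '' E)

theorem monom_mem {x : ι → R} {E : UpperSet (ι → ℕ)} {e : ι → ℕ} (he : e ∈ E) :
    monom x e ∈ monomIdeal x E :=
  Ideal.subset_span ⟨e, he, rfl⟩

theorem monomIdeal_le_iff {x : ι → R} {E : UpperSet (ι → ℕ)} {I : Ideal R} :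
    monomIdeal x E ≤ I ↔ ∀ e ∈ E, monom x e ∈ I := by
  rw [monomIdeal, Ideal.span_le, Set.image_subset_iff]
  rfl

theorem monomIdeal_mono {x : ι → R} {E F : UpperSet (ι → ℕ)} (h : ∀ e ∈ E, e ∈ F) :
    monomIdeal x E ≤ monomIdeal x F :=
  monomIdeal_le_iff.2 fun e he => monom_mem (h e he)

/-- The exponent vectors which `f` translates into `E`. -/
def colonSet (E : UpperSet (ι → ℕ)) (f : ι → ℕ) : UpperSet (ι → ℕ) where
  carrier := {e | e + f ∈ E}
  upper' _ _ h he := E.upper (add_le_add_left h f) he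

@[simp]
theorem mem_colonSet {E : UpperSet (ι → ℕ)} {e f : ι → ℕ} : e ∈ colonSet E f ↔ e + f ∈ E := Iff.rfl

theorem mul_monom_mem {x : ι → R} {E : UpperSet (ι → ℕ)} {f : ι → ℕ} {r : R}
    (h : r ∈ monomIdeal x (colonSet E f)) : r * monom x f ∈ monomIdeal x E := by
  have : monomIdeal x (colonSet E f) ≤
      Submodule.comap (LinearMap.mulRight R (monom x f)) (monomIdeal x E) :=
    monomIdeal_le_iff.2 fun e he => by
      simpa [← monom_add] using monom_mem (mem_colonSet.1 he)
  exact this h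

variable [DecidableEq ι]

theorem mul_mem_of_mem_colonSet_single {x : ι → R} {E : UpperSet (ι → ℕ)} {j : ι} {r : R}
    (h : r ∈ monomIdeal x (colonSet E (Pi.single j 1))) : r * x j ∈ monomIdeal x E := by
  simpa using mul_monom_mem h

/-- The exponent vectors that lie in `E` after their `j`-th entry is set to zero. -/
def faceSet (E : UpperSet (ι → ℕ)) (j : ι) : UpperSet (ι → ℕ) where
  carrier := {e | Function.update e j 0 ∈ E}
  upper' _ _ h he := E.upper (by
    intro i
    by_cases hi : i = j
    · subst hi; simp
    · simpa [hi] using h i) he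

@[simp]
theorem mem_faceSet {E : UpperSet (ι → ℕ)} {e : ι → ℕ} {j : ι} :
    e ∈ faceSet E j ↔ Function.update e j 0 ∈ E := Iff.rfl

theorem update_zero_le (e : ι → ℕ) (j : ι) : Function.update e j 0 ≤ e :=
  update_le_self_iff.2 (Nat.zero_le _)

theorem sub_single_add_single {e : ι → ℕ} {j : ι} (h : 0 < e j) :
    e - Pi.single j 1 + Pi.single j 1 = e := by
  refine tsub_add_cancel_of_le fun i => ?_
  by_cases hi : i = j
  · subst hi; simpa [Nat.one_le_iff_ne_zero, Nat.pos_iff_ne_zero] using h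
  · simp [hi]

/-- Generators are sorted by divisibility by `x j`. The colon by `x j` can be read off from this
splitting as soon as `x j` is a non-zerodivisor modulo the face ideal, whose generators may be taken
free of `x j`. -/
theorem exists_add_of_mem {x : ι → R} {E : UpperSet (ι → ℕ)} (j : ι) {r : R}
    (h : r ∈ monomIdeal x E) :
    ∃ a ∈ monomIdeal x (colonSet E (Pi.single j 1)), ∃ b ∈ monomIdeal x (faceSet E j),
      r = a * x j + b := by
  have : monomIdeal x E ≤ Submodule.map (LinearMap.mulRight R (x j))
      (monomIdeal x (colonSet E (Pi.single j 1))) ⊔ monomIdeal x (faceSet E j) :=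
    monomIdeal_le_iff.2 fun e he => by
      by_cases hj : e j = 0
      · refine Submodule.mem_sup_right (monom_mem ?_)
        rwa [mem_faceSet, ← hj, Function.update_eq_self]
      · refine Submodule.mem_sup_left ⟨monom x (e - Pi.single j 1), monom_mem ?_, ?_⟩
        · rwa [mem_colonSet, sub_single_add_single (Nat.pos_of_ne_zero hj)]
        · rw [LinearMap.mulRight_apply, ← monom_single x j, ← monom_add,
            sub_single_add_single (Nat.pos_of_ne_zero hj)]
  obtain ⟨_, ⟨a, ha, rfl⟩, b, hb, h⟩ := Submodule.mem_sup.1 (this h)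
  exact ⟨a, ha, b, hb, h.symm⟩

/-- `E` together with all exponent vectors with non-zero `j`-th entry. -/
def adjoinVar (E : UpperSet (ι → ℕ)) (j : ι) : UpperSet (ι → ℕ) := E ⊓ UpperSet.Ici (Pi.single j 1)

theorem mem_adjoinVar {E : UpperSet (ι → ℕ)} {e : ι → ℕ} {j : ι} :
    e ∈ adjoinVar E j ↔ e ∈ E ∨ 0 < e j := by
  rw [adjoinVar, UpperSet.mem_inf_iff, UpperSet.mem_Ici_iff]
  refine or_congr_right ⟨fun h => by simpa [Nat.one_le_iff_ne_zero, Nat.pos_iff_ne_zero] using h j, fun h i => ?_⟩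
  by_cases hi : i = j
  · subst hi; simpa [Nat.one_le_iff_ne_zero, Nat.pos_iff_ne_zero] using h
  · simp [hi]

theorem exists_add_of_mem_adjoinVar {x : ι → R} {E : UpperSet (ι → ℕ)} {j : ι} {r : R}
    (h : r ∈ monomIdeal x (adjoinVar E j)) : ∃ a ∈ monomIdeal x E, ∃ c, r = a + c * x j := by
  have : monomIdeal x (adjoinVar E j) ≤ monomIdeal x E ⊔ Ideal.span {x j} :=
    monomIdeal_le_iff.2 fun e he => by
      rcases mem_adjoinVar.1 he with he | he
      · exact Submodule.mem_sup_left (monom_mem he)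
      · refine Submodule.mem_sup_right (Ideal.mem_span_singleton'.2
          ⟨monom x (e - Pi.single j 1), ?_⟩)
        rw [← monom_single x j, ← monom_add, sub_single_add_single he]
  obtain ⟨a, ha, b, hb, h⟩ := Submodule.mem_sup.1 (this h)
  obtain ⟨c, rfl⟩ := Ideal.mem_span_singleton'.1 hb
  exact ⟨a, ha, c, h.symm⟩

theorem exists_pos_of_mem {E : UpperSet (ι → ℕ)} (h0 : 0 ∉ E)
    (hE : ∀ j, Pi.single j 1 ∈ E ∨ ∀ e, e + Pi.single j 1 ∈ E → e ∈ E) {e : ι → ℕ} (he : e ∈ E) :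
    ∃ j, 0 < e j ∧ Pi.single j 1 ∈ E := by
  induction e using WellFoundedLT.induction with
  | ind e ih =>
    obtain ⟨j, hj⟩ : ∃ j, 0 < e j := by
      by_contra! h
      have : e = 0 := funext fun j => by simpa using h j
      exact h0 (this ▸ he)
    rcases hE j with h | h
    · exact ⟨j, hj, h⟩
    · have hlt : e - Pi.single j 1 < e := by
        refine lt_of_le_of_ne tsub_le_self fun h' => ?_
        have := congrFun h' j
        simp at this
        omega
      obtain ⟨i, hi, hi'⟩ := ih _ hlt (h _ (by rwa [sub_single_add_single hj]))
      exact ⟨i, hi.trans_le (tsub_le_self (a := e) (b := Pi.single j 1) i), hi'⟩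

/-- Cancelling the variables that can be cancelled leads from any exponent in `E` to a variable in
`E`. This is the terminal case of the Noetherian inductions on exponent sets, where primality of the
ideals generated by variables enters. -/
theorem monomIdeal_eq_span_vars {x : ι → R} {E : UpperSet (ι → ℕ)} (h0 : 0 ∉ E)
    (hE : ∀ j, Pi.single j 1 ∈ E ∨ ∀ e, e + Pi.single j 1 ∈ E → e ∈ E) :
    monomIdeal x E = Ideal.span (x '' {j | Pi.single j 1 ∈ E}) := by
  apply le_antisymm
  · refine monomIdeal_le_iff.2 fun e he => ?_
    obtain ⟨j, hj, hj'⟩ := exists_pos_of_mem h0 hE he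
    rw [← sub_single_add_single hj, monom_add, monom_single]
    exact Ideal.mul_mem_left _ _ (Ideal.subset_span ⟨j, hj', rfl⟩)
  · rw [Ideal.span_le]
    rintro _ ⟨j, hj, rfl⟩
    rw [← monom_single x j]
    exact monom_mem hj

theorem lt_of_mem_of_notMem {E F : UpperSet (ι → ℕ)} (h : ∀ e ∈ E, e ∈ F) {e : ι → ℕ} (he : e ∈ F)
    (he' : e ∉ E) : F < E :=
  lt_of_le_not_ge (fun _ ha => h _ ha) fun h' => he' (h' he)

theorem mem_colonSet_of_mem {E : UpperSet (ι → ℕ)} {e f : ι → ℕ} (he : e ∈ E) :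
    e ∈ colonSet E f := E.upper (le_add_of_nonneg_right zero_le) he

/-- If the exponents of the generators do not involve the `i`-th variable, then `x i` is a
non-zerodivisor modulo a monomial ideal. -/
theorem IsPrimeSystem.mem_of_mul_mem {x : ι → R} (hx : IsPrimeSystem x) (t : Finset ι) :
    ∀ E : UpperSet (ι → ℕ), (∀ i ∉ t, ∀ e ∈ E, Function.update e i 0 ∈ E) →
      ∀ i ∉ t, ∀ r, r * x i ∈ monomIdeal x E → r ∈ monomIdeal x E := by
  induction t using Finset.strongInduction with
  | H t iht =>
    -- The face ideal involves only the variables in `t.erase j`, so the outer induction makes `x j`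
    -- a non-zerodivisor modulo it.
    have hcolon : ∀ E : UpperSet (ι → ℕ), (∀ i ∉ t, ∀ e ∈ E, Function.update e i 0 ∈ E) →
        ∀ j ∈ t, ∀ r, r * x j ∈ monomIdeal x E →
          r ∈ monomIdeal x (colonSet E (Pi.single j 1)) := by
      intro E hE j hj r hr
      obtain ⟨a, ha, b, hb, hab⟩ := exists_add_of_mem j hr
      have h1 : (r - a) * x j ∈ monomIdeal x (faceSet E j) := by
        rwa [sub_mul, hab, add_sub_cancel_left]
      have h2 := iht (t.erase j) (Finset.erase_ssubset hj) (faceSet E j) (by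
        intro i hi e he
        rw [mem_faceSet] at he ⊢
        by_cases hij : i = j
        · subst hij; simpa using he
        · rw [Function.update_comm hij]
          exact hE i (fun h => hi (Finset.mem_erase.2 ⟨hij, h⟩)) _ he) j (by simp) _ h1
      have h3 : r - a ∈ monomIdeal x (colonSet E (Pi.single j 1)) :=
        monomIdeal_mono (fun e he => mem_colonSet_of_mem (E.upper (update_zero_le e j) he)) h2
      simpa using add_mem h3 ha
    intro E
    induction E using WellFoundedLT.induction with
    | ind E ihE =>
      intro hE i hi r hr
      by_cases h0 : (0 : ι → ℕ) ∈ E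
      · have : monomIdeal x E = ⊤ := by
          rw [Ideal.eq_top_iff_one, ← monom_zero x]
          exact monom_mem h0
        simp [this]
      by_cases h : ∀ j, Pi.single j 1 ∈ E ∨ ∀ e, e + Pi.single j 1 ∈ E → e ∈ E
      · rw [monomIdeal_eq_span_vars h0 h] at hr ⊢
        refine ((hx.isPrime _).mem_or_mem hr).resolve_right (hx.notMem _ _ fun h' => h0 ?_)
        have := hE i hi _ h'
        rwa [Pi.single, Function.update_idem, show Function.update (0 : ι → ℕ) i 0 = 0 from by
          ext
          simp [Function.update_apply]] at this
      -- Here `x j` is neither in the ideal `I` nor cancellable on exponents, so both `I + (x j)`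
      -- and `I : x j` have strictly larger exponent sets. The inner induction for these two gives
      -- the claim for `I`.
      · push Not at h
        obtain ⟨j, hj, e, he, he'⟩ := h
        have hjt : j ∈ t := by
          by_contra hjt
          refine he' (E.upper (update_zero_le e j) ?_)
          have h1 := hE j hjt _ he
          have h2 : Function.update (e + Pi.single j 1) j 0 = Function.update e j 0 := by
            ext k
            by_cases hk : k = j
            · subst hk; simp
            · simp [hk]
          rwa [h2] at h1
        have hne : ∀ k ∉ t, k ≠ j := fun k hk h => hk (h ▸ hjt)
        have h1 := ihE (adjoinVar E j) (lt_of_mem_of_notMem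
          (fun e he => mem_adjoinVar.2 (Or.inl he)) (mem_adjoinVar.2 (Or.inr (by simp))) hj) (by
            intro k hk e he
            rw [mem_adjoinVar] at he ⊢
            refine he.imp (hE k hk e) fun h => ?_
            rwa [Function.update_of_ne (hne k hk).symm]) i hi r
              (monomIdeal_mono (fun e he => mem_adjoinVar.2 (Or.inl he)) hr)
        obtain ⟨a, ha, c, rfl⟩ := exists_add_of_mem_adjoinVar h1
        have h2 : c * x i * x j ∈ monomIdeal x E := by
          have := sub_mem hr (Ideal.mul_mem_right (x i) _ ha)
          convert this using 1
          ring
        have h3 := ihE (colonSet E (Pi.single j 1)) (lt_of_mem_of_notMem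
          (fun e he => mem_colonSet_of_mem he) he he') (by
            intro k hk e he
            rw [mem_colonSet] at he ⊢
            have h1 := hE k hk _ he
            have h2 : Function.update (e + Pi.single j 1) k 0 =
                Function.update e k 0 + Pi.single j 1 := by
              ext l
              by_cases hl : l = k
              · subst hl; simp [hne l hk]
              · simp [hl]
            rwa [h2] at h1) i hi c (hcolon E hE j hjt _ h2)
        exact add_mem ha (mul_mem_of_mem_colonSet_single h3)

theorem IsPrimeSystem.mem_colonSet_single {x : ι → R} (hx : IsPrimeSystem x)
    {E : UpperSet (ι → ℕ)} {j : ι} {r : R} (hr : r * x j ∈ monomIdeal x E) :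
    r ∈ monomIdeal x (colonSet E (Pi.single j 1)) := by
  obtain ⟨a, ha, b, hb, hab⟩ := exists_add_of_mem j hr
  have h1 : (r - a) * x j ∈ monomIdeal x (faceSet E j) := by
    rwa [sub_mul, hab, add_sub_cancel_left]
  have h2 := hx.mem_of_mul_mem (Finset.univ.erase j) (faceSet E j) (by
    intro i hi e he
    obtain rfl : i = j := by simpa using hi
    simpa using he) j (by simp) _ h1
  have h3 : r - a ∈ monomIdeal x (colonSet E (Pi.single j 1)) :=
    monomIdeal_mono (fun e he => mem_colonSet_of_mem (E.upper (update_zero_le e j) he)) h2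
  simpa using add_mem h3 ha

theorem IsPrimeSystem.mem_colonSet {x : ι → R} (hx : IsPrimeSystem x) (f : ι → ℕ) :
    ∀ {E : UpperSet (ι → ℕ)} {r : R}, r * monom x f ∈ monomIdeal x E →
      r ∈ monomIdeal x (colonSet E f) := by
  induction f using WellFoundedLT.induction with
  | ind f ih =>
    intro E r hr
    by_cases hf : ∃ j, 0 < f j
    · obtain ⟨j, hj⟩ := hf
      have hlt : f - Pi.single j 1 < f := by
        refine lt_of_le_of_ne tsub_le_self fun h' => ?_
        have := congrFun h' j
        simp at this
        omega
      rw [← sub_single_add_single hj, monom_add, monom_single, ← mul_assoc] at hr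
      refine monomIdeal_mono (fun e he => ?_) (ih _ hlt (hx.mem_colonSet_single hr))
      simpa only [MonomialAdjoint.mem_colonSet, add_assoc, sub_single_add_single hj] using he
    · obtain rfl : f = 0 := funext fun j => by
        push Not at hf
        simpa using hf j
      refine monomIdeal_mono (fun e he => ?_) (by simpa using hr)
      simpa using he

/-- Monomial ideals in a system of primes intersect like sets of exponents. -/
theorem IsPrimeSystem.mem_monomIdeal_sup {x : ι → R} (hx : IsPrimeSystem x)
    (P : UpperSet (ι → ℕ) × UpperSet (ι → ℕ)) :
    ∀ r, r ∈ monomIdeal x P.1 → r ∈ monomIdeal x P.2 → r ∈ monomIdeal x (P.1 ⊔ P.2) := by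
  induction P using WellFoundedLT.induction with
  | ind P ih =>
    obtain ⟨E, F⟩ := P
    intro r hE hF
    dsimp only at hE hF ⊢
    by_cases h0 : 0 ∈ E
    · exact monomIdeal_mono (fun e he => UpperSet.mem_sup_iff.2 ⟨E.upper zero_le h0, he⟩) hF
    by_cases h0' : 0 ∈ F
    · exact monomIdeal_mono (fun e he => UpperSet.mem_sup_iff.2 ⟨he, F.upper zero_le h0'⟩) hE
    -- The same variable is adjoined to, or divided out of, both ideals at once. A step is useful if
    -- it enlarges at least one of the two exponent sets.
    by_cases h : ∃ j, ¬ (Pi.single j 1 ∈ E ∧ Pi.single j 1 ∈ F) ∧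
        ¬ ((∀ e, e + Pi.single j 1 ∈ E → e ∈ E) ∧ (∀ e, e + Pi.single j 1 ∈ F → e ∈ F))
    · obtain ⟨j, h1, h2⟩ := h
      have hlt1 : (adjoinVar E j, adjoinVar F j) < (E, F) := by
        refine lt_of_le_not_ge ⟨inf_le_left, inf_le_left⟩ fun h => h1 ⟨h.1 ?_, h.2 ?_⟩ <;>
        exact mem_adjoinVar.2 (Or.inr (by simp))
      have hlt2 : (colonSet E (Pi.single j 1), colonSet F (Pi.single j 1)) < (E, F) :=
        lt_of_le_not_ge ⟨fun e he => mem_colonSet_of_mem he, fun e he => mem_colonSet_of_mem he⟩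
          fun h => h2 ⟨fun e he => h.1 he, fun e he => h.2 he⟩
      have h3 := ih _ hlt1 r (monomIdeal_mono (fun e he => mem_adjoinVar.2 (Or.inl he)) hE)
        (monomIdeal_mono (fun e he => mem_adjoinVar.2 (Or.inl he)) hF)
      obtain ⟨a, ha, c, rfl⟩ := exists_add_of_mem_adjoinVar (E := E ⊔ F) (j := j)
        (monomIdeal_mono (fun e he => by
          have h1 := mem_adjoinVar.1 (UpperSet.mem_sup_iff.1 he).1
          have h2 := mem_adjoinVar.1 (UpperSet.mem_sup_iff.1 he).2
          rw [mem_adjoinVar, UpperSet.mem_sup_iff]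
          tauto) h3)
      refine add_mem ha (mul_mem_of_mem_colonSet_single ?_)
      have haE := monomIdeal_mono (E := E ⊔ F) (F := E) (fun e he => (UpperSet.mem_sup_iff.1 he).1) ha
      have haF := monomIdeal_mono (E := E ⊔ F) (F := F) (fun e he => (UpperSet.mem_sup_iff.1 he).2) ha
      exact monomIdeal_mono (fun e he => he) (ih _ hlt2 c
        (hx.mem_colonSet_single (by simpa using sub_mem hE haE))
        (hx.mem_colonSet_single (by simpa using sub_mem hF haF)))
    -- Now each variable lies in both sets or is cancellable in both. A variable in `E` cannot be
    -- cancellable, as `0 ∉ E`, so it lies in `F` too, and `E` is contained in `F`.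
    · push Not at h
      have hEj : ∀ j, Pi.single j 1 ∈ E ∨ ∀ e, e + Pi.single j 1 ∈ E → e ∈ E := fun j => by
        by_cases hj : Pi.single j 1 ∈ E ∧ Pi.single j 1 ∈ F
        · exact Or.inl hj.1
        · exact Or.inr (h j fun h => not_and.1 hj h).1
      refine monomIdeal_mono (fun e he => UpperSet.mem_sup_iff.2 ⟨he, ?_⟩) hE
      obtain ⟨j, hj, hj'⟩ := exists_pos_of_mem h0 hEj he
      by_cases hjF : Pi.single j 1 ∈ F
      · refine F.upper (fun i => ?_) hjF
        by_cases hi : i = j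
        · subst hi; simpa [Nat.one_le_iff_ne_zero, Nat.pos_iff_ne_zero] using hj
        · simp [hi]
      · exact absurd ((h j fun _ => hjF).1 0 (by simpa using hj')) h0

theorem IsPrimeSystem.mem_monomIdeal_iSup {x : ι → R} (hx : IsPrimeSystem x) {κ : Type*}
    (s : Finset κ) (E : κ → UpperSet (ι → ℕ)) {r : R} (h : ∀ k ∈ s, r ∈ monomIdeal x (E k)) :
    r ∈ monomIdeal x (s.sup E) := by
  classical
  induction s using Finset.induction_on with
  | empty =>
    have : monomIdeal x (⊥ : UpperSet (ι → ℕ)) = ⊤ := by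
      rw [Ideal.eq_top_iff_one, ← monom_zero x]
      exact monom_mem (UpperSet.mem_bot)
    simp [this]
  | insert k s hk ih =>
    rw [Finset.sup_insert]
    exact hx.mem_monomIdeal_sup (E k, s.sup E) r (h k (by simp)) (ih fun k hk => h k (by simp [hk]))

/-! ### The monomial valuation attached to positive weights -/

section MonomialValuation

variable {R : Type*} [CommRing R] {ι : Type*} [Fintype ι]

/-- The weight of an exponent vector. -/
def wt (w e : ι → ℕ) : ℕ := ∑ i, e i * w i

theorem wt_add (w e f : ι → ℕ) : wt w (e + f) = wt w e + wt w f := by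
  simp [wt, add_mul, Finset.sum_add_distrib]

@[simp]
theorem wt_zero (w : ι → ℕ) : wt w 0 = 0 := by simp [wt]

@[simp]
theorem wt_single [DecidableEq ι] (w : ι → ℕ) (i : ι) : wt w (Pi.single i 1) = w i := by
  simp [wt, Pi.single_apply]

theorem wt_mono (w : ι → ℕ) {e f : ι → ℕ} (h : e ≤ f) : wt w e ≤ wt w f :=
  Finset.sum_le_sum fun i _ => Nat.mul_le_mul_right _ (h i)

theorem eq_of_le_of_wt_le {w : ι → ℕ} (hw : ∀ i, 0 < w i) {e f : ι → ℕ} (h : e ≤ f)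
    (h' : wt w f ≤ wt w e) : e = f := by
  by_contra hne
  obtain ⟨i, hi⟩ : ∃ i, e i < f i := by
    by_contra! h''
    exact hne (le_antisymm h h'')
  refine h'.not_gt (Finset.sum_lt_sum (fun i _ => Nat.mul_le_mul_right _ (h i))
    ⟨i, Finset.mem_univ i, Nat.mul_lt_mul_of_pos_right hi (hw i)⟩)

theorem weight_eq_wt (w : ι → ℕ) (d : ι →₀ ℕ) : Finsupp.weight w d = wt w d := by
  rw [Finsupp.weight_apply, Finsupp.sum_fintype _ _ (by simp)]
  rfl

/-- The exponent vectors of weight at least `n`. -/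
def weightSet (w : ι → ℕ) (n : ℕ) : UpperSet (ι → ℕ) where
  carrier := {e | n ≤ wt w e}
  upper' _ _ h he := le_trans he (wt_mono w h)

@[simp]
theorem mem_weightSet {w e : ι → ℕ} {n : ℕ} : e ∈ weightSet w n ↔ n ≤ wt w e := Iff.rfl

theorem monomIdeal_weightSet_anti (x : ι → R) (w : ι → ℕ) {m n : ℕ} (h : m ≤ n) :
    monomIdeal x (weightSet w n) ≤ monomIdeal x (weightSet w m) :=
  monomIdeal_mono fun _ he => h.trans he

theorem monomIdeal_weightSet_mul {x : ι → R} {w : ι → ℕ} {m n : ℕ} {a b : R}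
    (ha : a ∈ monomIdeal x (weightSet w m)) (hb : b ∈ monomIdeal x (weightSet w n)) :
    a * b ∈ monomIdeal x (weightSet w (m + n)) := by
  have h : monomIdeal x (weightSet w m) * monomIdeal x (weightSet w n) ≤
      monomIdeal x (weightSet w (m + n)) := by
    rw [monomIdeal, monomIdeal, Ideal.span_mul_span', Ideal.span_le]
    rintro _ ⟨_, ⟨e, he, rfl⟩, _, ⟨f, hf, rfl⟩, rfl⟩
    dsimp only
    rw [← monom_add]
    exact monom_mem (by rw [mem_weightSet, wt_add]; exact add_le_add he hf)
  exact h (Ideal.mul_mem_mul ha hb)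

theorem monomIdeal_weightSet_zero (x : ι → R) (w : ι → ℕ) :
    monomIdeal x (weightSet w 0) = ⊤ := by
  rw [Ideal.eq_top_iff_one, ← monom_zero x]
  exact monom_mem (Nat.zero_le _)

theorem monomIdeal_le_span_range {x : ι → R} {E : UpperSet (ι → ℕ)} (h0 : 0 ∉ E) :
    monomIdeal x E ≤ Ideal.span (Set.range x) := by
  classical
  refine monomIdeal_le_iff.2 fun e he => ?_
  obtain ⟨j, hj⟩ : ∃ j, 0 < e j := by
    by_contra! h
    have : e = 0 := funext fun j => by simpa using h j
    exact h0 (this ▸ he)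
  rw [← sub_single_add_single hj, monom_add, monom_single]
  exact Ideal.mul_mem_left _ _ (Ideal.subset_span ⟨j, rfl⟩)

theorem span_range_le_weightSet_one {x : ι → R} {w : ι → ℕ} (hw : ∀ i, 0 < w i) :
    Ideal.span (Set.range x) ≤ monomIdeal x (weightSet w 1) := by
  classical
  rw [Ideal.span_le]
  rintro _ ⟨i, rfl⟩
  rw [← monom_single x i]
  exact monom_mem (by simpa [Nat.one_le_iff_ne_zero, Nat.pos_iff_ne_zero] using hw i)

theorem monom_mem_span_pow (x : ι → R) (e : ι → ℕ) :
    monom x e ∈ Ideal.span (Set.range x) ^ ∑ i, e i := by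
  rw [← Finset.prod_pow_eq_pow_sum]
  exact Ideal.prod_mem_prod fun i _ => Ideal.pow_mem_pow (Ideal.subset_span (Set.mem_range_self i)) _

theorem eval_monomial_one (x : ι → R) (d : ι →₀ ℕ) (c : R) :
    MvPolynomial.eval x (MvPolynomial.monomial d c) = c * monom x d := by
  rw [MvPolynomial.eval_monomial, Finsupp.prod_fintype _ _ (by simp)]
  rfl

/-- Provides an initial form for an element of the weight filtration: monomials of weight exactly
`n` enter `f`, heavier ones go to the remainder. -/
theorem exists_weightedHomogeneous {x : ι → R} {w : ι → ℕ} {n : ℕ} {r : R}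
    (hr : r ∈ monomIdeal x (weightSet w n)) :
    ∃ f : MvPolynomial ι R, f.IsWeightedHomogeneous w n ∧
      r - MvPolynomial.eval x f ∈ monomIdeal x (weightSet w (n + 1)) := by
  induction hr using Submodule.span_induction with
  | mem r hr =>
    obtain ⟨e, he, rfl⟩ := hr
    rcases (show n ≤ wt w e from he).eq_or_lt with h | h
    · refine ⟨MvPolynomial.monomial (Finsupp.equivFunOnFinite.symm e) 1,
        MvPolynomial.isWeightedHomogeneous_monomial _ _ _ ?_, ?_⟩
      · rw [weight_eq_wt, h]
        rfl
      · simp [eval_monomial_one]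
    · exact ⟨0, MvPolynomial.isWeightedHomogeneous_zero _ _ _, by simpa using monom_mem h⟩
  | zero => exact ⟨0, MvPolynomial.isWeightedHomogeneous_zero _ _ _, by simp⟩
  | add a b _ _ ha hb =>
    obtain ⟨f, hf, hf'⟩ := ha
    obtain ⟨g, hg, hg'⟩ := hb
    refine ⟨f + g, hf.add hg, ?_⟩
    rw [map_add, add_sub_add_comm]
    exact add_mem hf' hg'
  | smul c a _ ha =>
    obtain ⟨f, hf, hf'⟩ := ha
    refine ⟨MvPolynomial.C c * f, hf.C_mul c, ?_⟩
    rw [map_mul, MvPolynomial.eval_C, smul_eq_mul, ← mul_sub]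
    exact Ideal.mul_mem_left _ _ hf'

/-- A system of primes is quasi-regular with respect to every positive weight. -/
theorem IsPrimeSystem.coeff_mem {x : ι → R} (hx : IsPrimeSystem x) {w : ι → ℕ}
    (hw : ∀ i, 0 < w i) {n : ℕ} {f : MvPolynomial ι R} (hf : f.IsWeightedHomogeneous w n)
    (h : MvPolynomial.eval x f ∈ monomIdeal x (weightSet w (n + 1))) (d : ι →₀ ℕ) :
    f.coeff d ∈ Ideal.span (Set.range x) := by
  classical
  by_cases hd : d ∈ f.support
  swap
  · rw [MvPolynomial.notMem_support_iff.1 hd]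
    exact zero_mem _
  have hn : ∀ d ∈ f.support, wt w d = n := fun d hd => by
    rw [← weight_eq_wt]
    exact hf (MvPolynomial.mem_support_iff.1 hd)
  -- Modulo the monomials not dividing `x^d`, only the term at `d` of `f` survives: distinct
  -- exponents of equal positive weight are never comparable. Its coefficient thus lies in the colon
  -- by `x^d`, whose exponent set omits `0`.
  let E : UpperSet (ι → ℕ) :=
    { carrier := {e | ¬ e ≤ d}
      upper' := fun a b hab ha hb => ha (hab.trans hb) }
  have hE : ∀ e, e ∈ E ↔ ¬ e ≤ d := fun e => Iff.rfl
  have h1 : MvPolynomial.eval x f ∈ monomIdeal x E := by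
    refine monomIdeal_mono (fun e he => (hE e).2 fun hle => ?_) h
    have h1 := wt_mono w hle
    rw [hn d hd] at h1
    exact absurd (he.trans h1) (by omega)
  have h2 : f.coeff d * monom x d ∈ monomIdeal x E := by
    rw [MvPolynomial.eval_eq', ← Finset.add_sum_erase _ _ hd] at h1
    refine (Submodule.add_mem_iff_left _ (sum_mem fun b hb => ?_)).1 h1
    obtain ⟨hbd, hb⟩ := Finset.mem_erase.1 hb
    refine Ideal.mul_mem_left _ _ (monom_mem ((hE b).2 fun hle => hbd ?_))
    exact DFunLike.coe_injective (eq_of_le_of_wt_le hw hle (by rw [hn d hd, hn b hb]))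
  refine monomIdeal_le_span_range ?_ (hx.mem_colonSet d h2)
  simp [hE]

theorem IsPrimeSystem.isPrime_span_range {x : ι → R} (hx : IsPrimeSystem x) :
    (Ideal.span (Set.range x)).IsPrime := by
  simpa using hx.isPrime Set.univ

/-- Initial forms reduced modulo `(x)` live in a polynomial ring over a domain. They are nonzero
there, hence so is their product, and `coeff_mem` would kill this product if `a * b` lay one step
further in the filtration. -/
theorem IsPrimeSystem.mul_notMem {x : ι → R} (hx : IsPrimeSystem x) {w : ι → ℕ}
    (hw : ∀ i, 0 < w i) {m n : ℕ} {a b : R}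
    (ha : a ∈ monomIdeal x (weightSet w m)) (ha' : a ∉ monomIdeal x (weightSet w (m + 1)))
    (hb : b ∈ monomIdeal x (weightSet w n)) (hb' : b ∉ monomIdeal x (weightSet w (n + 1))) :
    a * b ∉ monomIdeal x (weightSet w (m + n + 1)) := by
  obtain ⟨f, hf, hfa⟩ := exists_weightedHomogeneous ha
  obtain ⟨g, hg, hgb⟩ := exists_weightedHomogeneous hb
  have := hx.isPrime_span_range
  have key : ∀ {k : ℕ} {c : R} {p : MvPolynomial ι R}, p.IsWeightedHomogeneous w k →
      c - MvPolynomial.eval x p ∈ monomIdeal x (weightSet w (k + 1)) →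
      c ∉ monomIdeal x (weightSet w (k + 1)) →
      MvPolynomial.map (Ideal.Quotient.mk (Ideal.span (Set.range x))) p ≠ 0 := by
    intro k c p hp hpc hc h0
    refine hc ?_
    rw [← sub_add_cancel c (MvPolynomial.eval x p)]
    refine add_mem hpc ?_
    rw [MvPolynomial.eval_eq']
    refine sum_mem fun d hd => ?_
    have h1 : p.coeff d ∈ Ideal.span (Set.range x) := by
      rw [← Ideal.Quotient.eq_zero_iff_mem, ← MvPolynomial.coeff_map, h0, MvPolynomial.coeff_zero]
    rw [add_comm k 1]
    refine monomIdeal_weightSet_mul (span_range_le_weightSet_one hw h1) (monom_mem ?_)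
    rw [mem_weightSet, ← weight_eq_wt, hp (MvPolynomial.mem_support_iff.1 hd)]
  intro h
  refine mul_ne_zero (key hf hfa ha') (key hg hgb hb') ?_
  have h1 : MvPolynomial.eval x (f * g) ∈ monomIdeal x (weightSet w (m + n + 1)) := by
    have h2 := monomIdeal_weightSet_mul hfa hb
    have h3 := monomIdeal_weightSet_mul ha hgb
    have h4 := monomIdeal_weightSet_mul hfa hgb
    rw [show m + 1 + n = m + n + 1 by ring] at h2
    rw [show m + (n + 1) = m + n + 1 by ring] at h3
    have h5 := monomIdeal_weightSet_anti x w (show m + n + 1 ≤ m + 1 + (n + 1) by omega) h4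
    have h6 := add_mem (sub_mem (sub_mem h h2) h3) h5
    rw [map_mul]
    convert h6 using 1
    ring
  ext d
  rw [← map_mul, MvPolynomial.coeff_map, MvPolynomial.coeff_zero, Ideal.Quotient.eq_zero_iff_mem]
  exact hx.coeff_mem hw (hf.mul hg) h1 d

theorem IsPrimeSystem.monom_mem_weightSet_iff {x : ι → R} (hx : IsPrimeSystem x) {w : ι → ℕ}
    (hw : ∀ i, 0 < w i) {n : ℕ} {e : ι → ℕ} :
    monom x e ∈ monomIdeal x (weightSet w n) ↔ n ≤ wt w e := by
  classical
  refine ⟨fun h => ?_, fun h => monom_mem h⟩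
  by_contra! hlt
  have h1 := monomIdeal_weightSet_anti x w hlt h
  have h2 := hx.coeff_mem hw (n := wt w e)
    (f := MvPolynomial.monomial (Finsupp.equivFunOnFinite.symm e) 1)
    (MvPolynomial.isWeightedHomogeneous_monomial _ _ _ (weight_eq_wt _ _))
    (by simpa [eval_monomial_one] using h1) (Finsupp.equivFunOnFinite.symm e)
  rw [MvPolynomial.coeff_monomial, if_pos rfl] at h2
  exact hx.isPrime_span_range.ne_top ((Ideal.eq_top_iff_one _).2 h2)

theorem IsPrimeSystem.exists_notMem_weightSet [IsDomain R] [IsNoetherianRing R] {x : ι → R}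
    (hx : IsPrimeSystem x) (w : ι → ℕ) {r : R} (hr : r ≠ 0) :
    ∃ n, r ∉ monomIdeal x (weightSet w n) := by
  by_contra! h
  have h1 : r ∈ ⨅ k : ℕ, Ideal.span (Set.range x) ^ k := by
    refine Ideal.mem_iInf.2 fun k => ?_
    -- A monomial of degree below `k` has weight at most `k * ∑ w`. This filtration step therefore
    -- lies in the `k`-th power of `(x)`, and Krull's intersection theorem applies.
    refine monomIdeal_le_iff.2 (fun e he => ?_) (h (k * (∑ i, w i) + 1))
    refine Ideal.pow_le_pow_right ?_ (monom_mem_span_pow x e)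
    have h2 : wt w e ≤ (∑ i, e i) * ∑ i, w i := by
      rw [wt, Finset.sum_mul]
      exact Finset.sum_le_sum fun i _ => Nat.mul_le_mul_left _
        (Finset.single_le_sum (f := w) (fun _ _ => Nat.zero_le _) (Finset.mem_univ i))
    by_contra! h3
    have h4 := Nat.mul_le_mul_right (∑ i, w i) h3.le
    rw [mem_weightSet] at he
    omega
  rw [Ideal.iInf_pow_eq_bot_of_isDomain _ hx.isPrime_span_range.ne_top] at h1
  exact hr h1

/-- The value of `r ≠ 0` is the last index at which the weight filtration still contains `r`;
`mul_notMem` turns submultiplicativity into equality. -/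
theorem IsPrimeSystem.exists_addValuation_ring [IsDomain R] [IsNoetherianRing R] {x : ι → R}
    (hx : IsPrimeSystem x) {w : ι → ℕ} (hw : ∀ i, 0 < w i) :
    ∃ v : AddValuation R (WithTop ℤ), (∀ r, v r = ⊤ → r = 0) ∧
      ∀ r (n : ℕ), ((n : ℤ) : WithTop ℤ) ≤ v r ↔ r ∈ monomIdeal x (weightSet w n) := by
  classical
  have hex : ∀ r : R, r ≠ 0 → ∃ n, r ∈ monomIdeal x (weightSet w n) ∧
      r ∉ monomIdeal x (weightSet w (n + 1)) := by
    intro r hr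
    have h := hx.exists_notMem_weightSet w hr
    have h0 : Nat.find h ≠ 0 := fun h0 => Nat.find_spec h (by
      rw [h0, monomIdeal_weightSet_zero]
      trivial)
    obtain ⟨n, hn⟩ := Nat.exists_eq_succ_of_ne_zero h0
    refine ⟨n, ?_, ?_⟩
    · have := Nat.find_min h (m := n) (by omega)
      simpa using this
    · have := Nat.find_spec h
      rwa [hn] at this
  choose! o ho ho' using hex
  let f : R → WithTop ℤ := fun r => if r = 0 then ⊤ else ((o r : ℤ) : WithTop ℤ)
  have hf : ∀ r (n : ℕ), ((n : ℤ) : WithTop ℤ) ≤ f r ↔ r ∈ monomIdeal x (weightSet w n) := by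
    intro r n
    by_cases hr : r = 0
    · simp [f, hr]
    · simp only [f, hr, if_false, WithTop.coe_le_coe, Nat.cast_le]
      refine ⟨fun h => monomIdeal_weightSet_anti x w h (ho r hr), fun h => ?_⟩
      by_contra! hlt
      exact ho' r hr (monomIdeal_weightSet_anti x w hlt h)
  have hval : ∀ r, r ≠ 0 → f r = ((o r : ℤ) : WithTop ℤ) := fun r hr => if_neg hr
  have htop : f 0 = ⊤ := if_pos rfl
  have hmul : ∀ a b, f (a * b) = f a + f b := by
    intro a b
    by_cases ha : a = 0
    · simp [ha, htop]
    by_cases hb : b = 0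
    · simp [hb, htop]
    rw [hval a ha, hval b hb, hval _ (mul_ne_zero ha hb), ← WithTop.coe_add, ← Nat.cast_add]
    congr 2
    refine le_antisymm ?_ ?_
    · by_contra! hlt
      exact hx.mul_notMem hw (ho a ha) (ho' a ha) (ho b hb) (ho' b hb)
        (monomIdeal_weightSet_anti x w hlt (ho _ (mul_ne_zero ha hb)))
    · have h1 := (hf (a * b) (o a + o b)).2 (monomIdeal_weightSet_mul (ho a ha) (ho b hb))
      rw [hval _ (mul_ne_zero ha hb)] at h1
      exact_mod_cast h1
  have hadd : ∀ a b, min (f a) (f b) ≤ f (a + b) := by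
    intro a b
    by_cases ha : a = 0
    · simp [ha, htop]
    by_cases hb : b = 0
    · simp [hb, htop]
    have h1 : min (f a) (f b) = (((min (o a) (o b) : ℕ) : ℤ) : WithTop ℤ) := by
      rw [hval a ha, hval b hb, ← WithTop.coe_min, ← Nat.cast_min]
    rw [h1, hf]
    exact add_mem (monomIdeal_weightSet_anti x w (min_le_left _ _) (ho a ha))
      (monomIdeal_weightSet_anti x w (min_le_right _ _) (ho b hb))
  have hone : f 1 = 0 := by
    have h1 := hmul 1 1
    rw [mul_one, hval 1 one_ne_zero, ← WithTop.coe_add, WithTop.coe_inj] at h1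
    rw [hval 1 one_ne_zero, show ((o 1 : ℕ) : ℤ) = 0 by omega]
    rfl
  refine ⟨AddValuation.of f htop hone hadd hmul, fun r hr => ?_, fun r n => hf r n⟩
  by_contra h
  rw [AddValuation.of_apply, hval r h] at hr
  exact WithTop.coe_ne_top hr

/-- The monomial valuation of the fraction field with weights `w`. -/
theorem IsPrimeSystem.exists_addValuation [IsDomain R] [IsNoetherianRing R] (K : Type*) [Field K]
    [Algebra R K] [IsFractionRing R K] {x : ι → R} (hx : IsPrimeSystem x) {w : ι → ℕ}
    (hw : ∀ i, 0 < w i) :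
    ∃ v : AddValuation K (WithTop ℤ), ∀ r (n : ℕ),
      ((n : ℤ) : WithTop ℤ) ≤ v (algebraMap R K r) ↔ r ∈ monomIdeal x (weightSet w n) := by
  obtain ⟨v, hv, hv'⟩ := hx.exists_addValuation_ring hw
  have hS : nonZeroDivisors R ≤ (AddValuation.toValuation v).supp.primeCompl := by
    intro r hr hr'
    exact nonZeroDivisors.ne_zero hr (hv r hr')
  refine ⟨AddValuation.ofValuation ((AddValuation.toValuation v).extendToLocalization hS K),
    fun r n => ?_⟩
  rw [← hv', AddValuation.ofValuation_apply]
  have := Valuation.extendToLocalization_apply_map_apply (AddValuation.toValuation v) hS K r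
  rw [this]
  rfl

end MonomialValuation

/-! ### Units of valuation rings, Fitting ideals and generators of differentials -/

section Valuations

variable {R : Type*} [CommRing R] {K : Type*} [Field K] [Algebra R K]

theorem mem_valuationSubalgebra {v : AddValuation K (WithTop ℤ)}
    {hv : ∀ r : R, 0 ≤ v (algebraMap R K r)} {z : K} :
    z ∈ valuationSubalgebra v hv ↔ 0 ≤ v z := Iff.rfl

theorem isUnit_valuationSubalgebra_iff {v : AddValuation K (WithTop ℤ)}
    {hv : ∀ r : R, 0 ≤ v (algebraMap R K r)} {z : valuationSubalgebra v hv} :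
    IsUnit z ↔ v (z : K) = 0 := by
  constructor
  · intro h
    obtain ⟨y, hy⟩ := h.exists_right_inv
    have h1 : v (z : K) + v (y : K) = 0 := by
      rw [← v.map_mul, ← v.map_one]
      exact congrArg v (congrArg Subtype.val hy)
    have h2 : 0 ≤ v (z : K) := z.2
    have h3 : 0 ≤ v (y : K) := y.2
    exact le_antisymm (h1 ▸ le_add_of_nonneg_right h3) h2
  · intro h
    have hz : (z : K) ≠ 0 := fun h0 => by simp [h0] at h
    have h1 : v (z : K)⁻¹ = 0 := by
      have h2 : v (z : K) + v (z : K)⁻¹ = 0 := by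
        rw [← v.map_mul, mul_inv_cancel₀ hz, v.map_one]
      rwa [h, zero_add] at h2
    exact IsUnit.of_mul_eq_one ⟨(z : K)⁻¹, mem_valuationSubalgebra.2 h1.ge⟩
      (Subtype.ext (mul_inv_cancel₀ hz))

theorem exists_coe_of_ne_zero (v : AddValuation K (WithTop ℤ)) {z : K} (hz : z ≠ 0) :
    ∃ n : ℤ, v z = n := by
  obtain ⟨n, hn⟩ := WithTop.ne_top_iff_exists.1 ((v.ne_top_iff).2 hz)
  exact ⟨n, hn.symm⟩

theorem exists_nat_of_ne_zero (v : AddValuation K (WithTop ℤ)) {z : K} (hz : z ≠ 0)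
    (h : 0 ≤ v z) : ∃ n : ℕ, v z = (n : ℤ) := by
  obtain ⟨n, hn⟩ := exists_coe_of_ne_zero v hz
  rw [hn, ← WithTop.coe_zero, WithTop.coe_le_coe] at h
  exact ⟨n.toNat, by rw [hn, Int.toNat_of_nonneg h]⟩

theorem map_prod_addValuation (v : AddValuation K (WithTop ℤ)) {ι : Type*} (s : Finset ι)
    (f : ι → K) : v (∏ i ∈ s, f i) = ∑ i ∈ s, v (f i) := by
  classical
  induction s using Finset.induction_on with
  | empty => simp
  | insert i s hi ih => rw [Finset.prod_insert hi, Finset.sum_insert hi, v.map_mul, ih]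

/-- The zeroth Fitting ideal contains the determinants of relation matrices with rows and columns
indexed by any finite type. -/
theorem det_mem_fittingIdealZero {A M κ : Type*} [CommRing A] [AddCommGroup M] [Module A M]
    [Fintype κ] [DecidableEq κ] {g : κ → M} {C : Matrix κ κ A}
    (hg : Submodule.span A (Set.range g) = ⊤) (hC : ∀ i, ∑ j, C i j • g j = 0) :
    C.det ∈ fittingIdealZero A M := by
  let e := Fintype.equivFin κ
  refine Ideal.subset_span ⟨Fintype.card κ, g ∘ e.symm, Matrix.reindex e e C, ?_, fun i => ?_,
    Matrix.det_reindex_self e C⟩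
  · rwa [Set.range_comp, e.symm.surjective.range_eq, Set.image_univ]
  · rw [← hC (e.symm i), ← e.symm.sum_comp]
    rfl

/-- A subalgebra whose elements have differentials in a given submodule. -/
def derivationPreimage {A B M : Type*} [CommRing A] [CommRing B] [Algebra A B] [AddCommGroup M]
    [Module A M] [Module B M] (D : Derivation A B M) (N : Submodule B M) : Subalgebra A B where
  carrier := {b | D b ∈ N}
  mul_mem' {a b} ha hb := by
    rw [Set.mem_ofPred_eq, D.leibniz]
    exact add_mem (N.smul_mem _ hb) (N.smul_mem _ ha)
  add_mem' {a b} ha hb := by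
    rw [Set.mem_ofPred_eq, map_add]
    exact add_mem ha hb
  algebraMap_mem' r := by
    rw [Set.mem_ofPred_eq, D.map_algebraMap]
    exact N.zero_mem

/-- If `B` is a localization of the subalgebra generated by `σ`, then differentials of `σ`
generate the Kähler differentials. -/
theorem span_D_eq_top {A B : Type*} [CommRing A] [CommRing B] [Algebra A B] {σ : Set B}
    (hσ : ∀ s : B, ∃ t ∈ Algebra.adjoin A σ, IsUnit t ∧ s * t ∈ Algebra.adjoin A σ)
    {N : Submodule B Ω[B⁄A]} (hN : ∀ s ∈ σ, KaehlerDifferential.D A B s ∈ N) : N = ⊤ := by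
  have h : Algebra.adjoin A σ ≤ derivationPreimage (KaehlerDifferential.D A B) N :=
    Algebra.adjoin_le hN
  rw [eq_top_iff, ← KaehlerDifferential.span_range_derivation, Submodule.span_le]
  rintro _ ⟨s, rfl⟩
  obtain ⟨t, ht, ⟨t, rfl⟩, hst⟩ := hσ s
  -- Quotient rule: `t • D s = D (s * t) - s • D t`, and `t` is a unit.
  have h1 : KaehlerDifferential.D A B (s * t) ∈ N := h hst
  rw [Derivation.leibniz] at h1
  have h2 := (Submodule.add_mem_iff_right _ (N.smul_mem s (h ht))).1 h1
  have h3 := N.smul_mem (↑t⁻¹ : B) h2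
  rwa [smul_smul, Units.inv_mul, one_smul] at h3

end Valuations

/-! ### The valuation ring of a monomial valuation and an upper bound for its Jacobian ideal -/

section MonomialJacobian

variable {R : Type*} [CommRing R] {K : Type*} [Field K] [Algebra R K] [IsFractionRing R K]
  {ι : Type*} [Fintype ι] {x : ι → R} {w : ι → ℕ} {v : AddValuation K (WithTop ℤ)}

theorem nonneg_of_weightSet (hv : ∀ r (n : ℕ), ((n : ℤ) : WithTop ℤ) ≤ v (algebraMap R K r) ↔
    r ∈ monomIdeal x (weightSet w n)) (r : R) : 0 ≤ v (algebraMap R K r) := by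
  have h := (hv r 0).2 (by rw [monomIdeal_weightSet_zero]; trivial)
  simpa using h

theorem IsPrimeSystem.addValuation_monom (hx : IsPrimeSystem x) (hw : ∀ i, 0 < w i)
    (hv : ∀ r (n : ℕ), ((n : ℤ) : WithTop ℤ) ≤ v (algebraMap R K r) ↔
      r ∈ monomIdeal x (weightSet w n)) (e : ι → ℕ) :
    v (algebraMap R K (monom x e)) = (wt w e : ℤ) := by
  apply le_antisymm
  · have h := (hv (monom x e) (wt w e + 1)).not.2 (by
      rw [hx.monom_mem_weightSet_iff hw]
      omega)
    obtain h' | ⟨n, hn⟩ : v (algebraMap R K (monom x e)) = ⊤ ∨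
        ∃ n : ℤ, v (algebraMap R K (monom x e)) = n := by
      cases h : v (algebraMap R K (monom x e)) with
      | top => exact Or.inl rfl
      | coe n => exact Or.inr ⟨n, rfl⟩
    · simp [h'] at h
    · rw [hn, WithTop.coe_le_coe] at h ⊢
      push_cast at h
      omega
  · exact (hv _ _).2 ((hx.monom_mem_weightSet_iff hw).2 le_rfl)

theorem IsPrimeSystem.addValuation_var (hx : IsPrimeSystem x) (hw : ∀ i, 0 < w i)
    (hv : ∀ r (n : ℕ), ((n : ℤ) : WithTop ℤ) ≤ v (algebraMap R K r) ↔
      r ∈ monomIdeal x (weightSet w n)) (i : ι) :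
    v (algebraMap R K (x i)) = (w i : ℤ) := by
  classical
  have := hx.addValuation_monom hw hv (Pi.single i 1)
  rwa [monom_single, wt_single] at this

/-- The determinant of the matrix of weights bordered by an identity matrix. -/
theorem det_fromBlocks_weights {A ι : Type*} [CommRing A] [Fintype ι] [DecidableEq ι]
    (b w : ι → A) :
    (Matrix.fromBlocks (0 : Matrix Unit Unit A) (Matrix.of fun _ j => b j)
      (Matrix.of fun i _ => w i) 1).det = - ∑ i, b i * w i := by
  rw [Matrix.det_fromBlocks_one₂₂, Matrix.det_unique]
  simp [Matrix.mul_apply]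

/-- An element of the Jacobian ideal, obtained from the monomial relations between a uniformizing
parameter and units. -/
theorem exists_mem_jacobianIdeal {R V ι : Type*} [CommRing R] [CommRing V] [Algebra R V] [Fintype ι]
    {x : ι → R} {w : ι → ℕ} (hw : ∀ i, 0 < w i) {σ : Set V}
    (hess : ∀ s : V, ∃ t ∈ Algebra.adjoin R σ, IsUnit t ∧ s * t ∈ Algebra.adjoin R σ)
    {π : V} {u : ι → V} (hσ : σ ⊆ insert π (Set.range u)) (hu : ∀ i, IsUnit (u i))
    (huπ : ∀ i, u i * π ^ w i = algebraMap R V (x i)) {p q : ι → ℕ} (hpq : wt w p = wt w q + 1)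
    (hupq : monom u p = monom u q) :
    ∃ c ∈ jacobianIdeal R V, c * π = - π ^ ∑ i, w i := by
  classical
  have hmu : IsUnit (monom u q) := by
    rw [monom, IsUnit.prod_univ_iff]
    exact fun i => (hu i).pow _
  choose u' hu' using hu
  let D := KaehlerDifferential.D R V
  -- With logarithmic differentials of the units, multiplicative relations become linear relations
  -- with integer coefficients.
  let y : ι → Ω[V⁄R] := fun i => (↑(u' i)⁻¹ : V) • D (u i)
  have hy : ∀ i, D (u i) = u i • y i := fun i => by
    rw [smul_smul, ← hu', Units.mul_inv, one_smul]
  let g : Unit ⊕ ι → Ω[V⁄R] := Sum.elim (fun _ => D π) y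
  have hg : Submodule.span V (Set.range g) = ⊤ := by
    refine span_D_eq_top hess fun s hs => ?_
    rcases hσ hs with rfl | ⟨i, rfl⟩
    · exact Submodule.subset_span ⟨Sum.inl (), rfl⟩
    · change D (u i) ∈ _
      rw [hy]
      exact Submodule.smul_mem _ _ (Submodule.subset_span ⟨Sum.inr i, rfl⟩)
  have hDmonom : ∀ e : ι → ℕ, D (monom u e) = monom u e • ∑ i, (e i : V) • y i := by
    have hpow : ∀ i (n : ℕ), D (u i ^ n) = (u i ^ n) • (n : V) • y i := by
      intro i n
      induction n with
      | zero => simp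
      | succ n ih =>
        rw [pow_succ, D.leibniz, ih, hy]
        simp only [smul_smul, ← add_smul]
        congr 1
        push_cast
        ring
    intro e
    suffices ∀ s : Finset ι, D (∏ i ∈ s, u i ^ e i) =
        (∏ i ∈ s, u i ^ e i) • ∑ i ∈ s, (e i : V) • y i from this _
    intro s
    induction s using Finset.induction_on with
    | empty => simp
    | insert i s hi ih =>
      rw [Finset.prod_insert hi, Finset.sum_insert hi, D.leibniz, ih, hpow, smul_add, add_comm,
        smul_smul, smul_smul _ (∏ i ∈ s, u i ^ e i), mul_comm (∏ i ∈ s, u i ^ e i)]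
  have hb : ∑ i, ((p i : V) - q i) • y i = 0 := by
    have h1 := hDmonom p
    rw [hupq, hDmonom q] at h1
    have h2 := hmu.smul_left_cancel.1 h1
    simp only [sub_smul, Finset.sum_sub_distrib, ← h2, sub_self]
  have hrow : ∀ i, ((w i : V) * π ^ (w i - 1)) • D π + π ^ w i • y i = 0 := by
    intro i
    have h1 : D (u i * π ^ w i) = 0 := by rw [huπ, D.map_algebraMap]
    rw [D.leibniz, D.leibniz_pow, hy] at h1
    refine (show IsUnit (u i) from ⟨u' i, hu' i⟩).smul_eq_zero.1 ?_
    rw [← h1, ← Nat.cast_smul_eq_nsmul V]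
    simp only [smul_add, smul_smul]
    rw [mul_comm (π ^ w i) (u i)]
  -- The first row is the differential of `u^p = u^q`; the other rows are the differentials of `u_i
  -- π^{w_i} = x_i`, divided by the unit `u_i`.
  let C : Matrix (Unit ⊕ ι) (Unit ⊕ ι) V := Matrix.fromBlocks 0 (Matrix.of fun _ j => (p j : V) - q j)
    (Matrix.of fun i _ => (w i : V) * π ^ (w i - 1)) (Matrix.diagonal fun i => π ^ w i)
  have hC : ∀ i, ∑ j, C i j • g j = 0 := by
    rintro (⟨⟩ | i)
    · simpa [C, g] using hb
    · simpa [C, g, Matrix.diagonal_apply, ite_smul] using hrow i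
  have hmem : C.det ∈ jacobianIdeal R V := det_mem_fittingIdealZero hg hC
  have hdet : C.det * π = - π ^ ∑ i, w i := by
    -- Scaling the column of `D π` by `π` lets `π ^ w i` be taken out of each lower row. What is
    -- left is the bordered weight matrix, with determinant `-∑ (p_i - q_i) w_i = -1`.
    have h1 : C * Matrix.fromBlocks (Matrix.of fun _ _ => π) 0 0 1 =
        Matrix.fromBlocks 1 0 0 (Matrix.diagonal fun i => π ^ w i) *
          Matrix.fromBlocks 0 (Matrix.of fun _ j => (p j : V) - q j)
            (Matrix.of fun i _ => (w i : V)) 1 := by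
      rw [Matrix.fromBlocks_multiply, Matrix.fromBlocks_multiply]
      congr 1
      · ext i j
        simp
      · simp
      · ext i j
        have h2 : π ^ w i = π ^ (w i - 1) * π := by
          rw [← pow_succ, Nat.sub_add_cancel (hw i)]
        simp [Matrix.mul_apply, Matrix.diagonal_apply, h2]
        ring
      · simp
    have h4 : (Matrix.of fun _ _ : Unit => π).det = π := by simp
    have h2 := congrArg Matrix.det h1
    rw [Matrix.det_mul, Matrix.det_mul, det_fromBlocks_weights, Matrix.det_fromBlocks_zero₂₁,
      Matrix.det_fromBlocks_zero₂₁, Matrix.det_one, Matrix.det_one, h4,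
      Matrix.det_diagonal, Finset.prod_pow_eq_pow_sum, one_mul, mul_one] at h2
    have h3 : ∑ i, ((p i : V) - q i) * w i = 1 := by
      have h4 : (wt w p : V) = wt w q + 1 := by exact_mod_cast congrArg (Nat.cast (R := V)) hpq
      simp only [wt, Nat.cast_sum, Nat.cast_mul] at h4
      simp only [sub_mul, Finset.sum_sub_distrib, h4, add_sub_cancel_left]
    rw [h3] at h2
    simpa using h2
  exact ⟨C.det, hmem, hdet⟩

/-- For primitive weights `w`, the valuation ring of the monomial valuation is essentially of
finite type, and its Jacobian ideal has value at most `∑ w i - 1`. -/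
theorem IsPrimeSystem.essFiniteType_and_idealValue_le [IsDomain R]
    (hx : IsPrimeSystem x) (hw : ∀ i, 0 < w i)
    (hv : ∀ r (n : ℕ), ((n : ℤ) : WithTop ℤ) ≤ v (algebraMap R K r) ↔
      r ∈ monomIdeal x (weightSet w n))
    (hv0 : ∀ r : R, 0 ≤ v (algebraMap R K r)) (p q : ι → ℕ) (hpq : wt w p = wt w q + 1) :
    (∃ z, v z = 1) ∧ Algebra.EssFiniteType R (valuationSubalgebra v hv0) ∧
      idealValue v (jacobianIdeal R (valuationSubalgebra v hv0)) ≤ (∑ i, (w i : ℤ) - 1 : ℤ) := by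
  classical
  set V := valuationSubalgebra v hv0
  have hm0 : ∀ e, algebraMap R K (monom x e) ≠ 0 := fun e h0 => by
    have := hx.addValuation_monom hw hv e
    rw [h0, v.map_zero] at this
    exact WithTop.coe_ne_top this.symm
  have hx0 : ∀ i, algebraMap R K (x i) ≠ 0 := fun i => by
    simpa using hm0 (Pi.single i 1)
  -- A uniformizer that is a Laurent monomial; it exists because the two weights differ by one.
  set ϖ : K := algebraMap R K (monom x p) / algebraMap R K (monom x q) with hϖ
  have hϖ0 : ϖ ≠ 0 := div_ne_zero (hm0 p) (hm0 q)
  have hϖq : ϖ * algebraMap R K (monom x q) = algebraMap R K (monom x p) :=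
    div_mul_cancel₀ _ (hm0 q)
  have hvϖ : v ϖ = ((1 : ℤ) : WithTop ℤ) := by
    have h1 : v ϖ + v (algebraMap R K (monom x q)) = v (algebraMap R K (monom x p)) := by
      rw [← v.map_mul, hϖq]
    obtain ⟨n, hn⟩ := exists_coe_of_ne_zero v hϖ0
    rw [hx.addValuation_monom hw hv, hx.addValuation_monom hw hv, hn, ← WithTop.coe_add,
      WithTop.coe_inj, hpq] at h1
    push_cast at h1
    rw [hn, show n = 1 by omega]
  have hvϖn : ∀ n : ℕ, v (ϖ ^ n) = ((n : ℤ) : WithTop ℤ) := fun n => by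
    rw [v.map_pow, hvϖ, ← WithTop.coe_nsmul]
    simp
  have hvu : ∀ i, v (algebraMap R K (x i) / ϖ ^ w i) = 0 := fun i => by
    have h1 : v (algebraMap R K (x i) / ϖ ^ w i) + v (ϖ ^ w i) = v (algebraMap R K (x i)) := by
      rw [← v.map_mul, div_mul_cancel₀ _ (pow_ne_zero _ hϖ0)]
    obtain ⟨n, hn⟩ := exists_coe_of_ne_zero v (div_ne_zero (hx0 i) (pow_ne_zero (w i) hϖ0))
    rw [hx.addValuation_var hw hv, hn, hvϖn, ← WithTop.coe_add, WithTop.coe_inj] at h1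
    rw [hn, show n = 0 by omega]
    rfl
  let π : V := ⟨ϖ, mem_valuationSubalgebra.2 (by rw [hvϖ]; exact_mod_cast zero_le_one)⟩
  have hπ : (π : K) = ϖ := rfl
  let u : ι → V := fun i => ⟨algebraMap R K (x i) / ϖ ^ w i, mem_valuationSubalgebra.2 (hvu i).ge⟩
  have hu : ∀ i, IsUnit (u i) := fun i => isUnit_valuationSubalgebra_iff.2 (hvu i)
  have huπ : ∀ i, u i * π ^ w i = algebraMap R V (x i) := fun i =>
    Subtype.ext (div_mul_cancel₀ _ (pow_ne_zero _ hϖ0))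
  have huπ' : ∀ e : ι → ℕ, monom u e * π ^ wt w e = algebraMap R V (monom x e) := fun e => by
    simp only [monom, map_prod, map_pow, ← huπ, wt, ← Finset.prod_pow_eq_pow_sum,
      ← Finset.prod_mul_distrib, mul_pow, ← pow_mul]
    exact Finset.prod_congr rfl fun i _ => by rw [mul_comm (w i)]
  set σ : Finset V := insert π (Finset.univ.image u) with hσ
  have hπσ : π ∈ Algebra.adjoin R (σ : Set V) := Algebra.subset_adjoin (by simp [hσ])
  have huσ : ∀ i, u i ∈ Algebra.adjoin R (σ : Set V) := fun i => Algebra.subset_adjoin (by simp [hσ])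
  -- An element of value at least `m` can be divided by `π ^ m` inside `R[π, u]`. Doing so with
  -- numerator and denominator of `s`, for `m` the value of the denominator, exhibits the valuation
  -- ring as a localization of this algebra.
  have hdiv : ∀ (m : ℕ) (a : R), a ∈ monomIdeal x (weightSet w m) →
      ∃ c ∈ Algebra.adjoin R (σ : Set V), c * π ^ m = algebraMap R V a := by
    intro m a ha
    induction ha using Submodule.span_induction with
    | mem a ha =>
      obtain ⟨e, he, rfl⟩ := ha
      refine ⟨monom u e * π ^ (wt w e - m), mul_mem (prod_mem fun i _ => pow_mem (huσ i) _)
        (pow_mem hπσ _), ?_⟩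
      rw [mul_assoc, ← pow_add, Nat.sub_add_cancel he, huπ']
    | zero => exact ⟨0, zero_mem _, by simp⟩
    | add a b _ _ ha hb =>
      obtain ⟨c, hc, hca⟩ := ha
      obtain ⟨d, hd, hdb⟩ := hb
      exact ⟨c + d, add_mem hc hd, by rw [add_mul, hca, hdb, map_add]⟩
    | smul r a _ ha =>
      obtain ⟨c, hc, hca⟩ := ha
      exact ⟨algebraMap R V r * c, mul_mem (Subalgebra.algebraMap_mem _ r) hc, by
        rw [mul_assoc, hca, smul_eq_mul, map_mul]⟩
  have hess : ∀ s : V, ∃ t ∈ Algebra.adjoin R (σ : Set V),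
      IsUnit t ∧ s * t ∈ Algebra.adjoin R (σ : Set V) := by
    intro s
    obtain ⟨a, b, hb, hab⟩ := IsFractionRing.div_surjective (A := R) (s : K)
    have hb0 : algebraMap R K b ≠ 0 := IsFractionRing.to_map_ne_zero_of_mem_nonZeroDivisors hb
    obtain ⟨m, hm⟩ := exists_nat_of_ne_zero v hb0 (hv0 b)
    have hsb : (s : K) * algebraMap R K b = algebraMap R K a := by
      rw [← hab, div_mul_cancel₀ _ hb0]
    have ha : ((m : ℤ) : WithTop ℤ) ≤ v (algebraMap R K a) := by
      rw [← hsb, v.map_mul, hm]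
      exact le_add_of_nonneg_left s.2
    obtain ⟨c, hc, hca⟩ := hdiv m a ((hv _ _).1 ha)
    obtain ⟨t, ht, htb⟩ := hdiv m b ((hv _ _).1 hm.ge)
    have hca' : (c : K) * ϖ ^ m = algebraMap R K a := congrArg Subtype.val hca
    have htb' : (t : K) * ϖ ^ m = algebraMap R K b := congrArg Subtype.val htb
    have hst : s * t = c := by
      refine Subtype.ext (mul_right_cancel₀ (pow_ne_zero m hϖ0) ?_)
      rw [hca', ← hsb, ← htb', Subalgebra.coe_mul, mul_assoc]
    refine ⟨t, ht, isUnit_valuationSubalgebra_iff.2 ?_, hst ▸ hc⟩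
    have h1 : v (t : K) + v (ϖ ^ m) = v (algebraMap R K b) := by rw [← v.map_mul, htb']
    have ht0 : (t : K) ≠ 0 := fun h0 => hb0 (by rw [← htb', h0, zero_mul])
    obtain ⟨n, hn⟩ := exists_coe_of_ne_zero v ht0
    rw [hn, hvϖn, hm, ← WithTop.coe_add, WithTop.coe_inj] at h1
    rw [hn, show n = 0 by omega]
    rfl
  refine ⟨⟨ϖ, hvϖ⟩, Algebra.essFiniteType_iff R V |>.2 ⟨σ, hess⟩, ?_⟩
  have hupq : monom u p = monom u q := by
    have h1 : algebraMap R V (monom x p) = π * algebraMap R V (monom x q) :=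
      Subtype.ext (by
        rw [Subalgebra.coe_mul, hπ]
        exact hϖq.symm)
    rw [← huπ', ← huπ', hpq] at h1
    refine mul_right_cancel₀ (b := π ^ (wt w q + 1)) (pow_ne_zero _ fun h0 => hϖ0 ?_) ?_
    · exact congrArg Subtype.val h0
    · rw [h1]; ring
  obtain ⟨c, hmem, hdet⟩ := exists_mem_jacobianIdeal hw hess
    (fun s hs => by simpa [hσ] using hs) hu huπ hpq hupq
  have hval : v (c : K) + v ϖ = v (ϖ ^ ∑ i, w i) := by
    rw [← v.map_mul, ← v.map_neg (ϖ ^ ∑ i, w i)]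
    exact congrArg (fun z : V => v (z : K)) hdet
  refine ((isGLB_idealValue v (fun a : V => a.2) _).1 ⟨c, hmem, rfl⟩).trans ?_
  change v (c : K) ≤ _
  have h0 : (c : K) ≠ 0 := fun h0 => by
    rw [h0, v.map_zero, hvϖn] at hval
    exact WithTop.coe_ne_top (hval.symm.trans (WithTop.top_add _))
  obtain ⟨n, hn⟩ := exists_coe_of_ne_zero v h0
  rw [hn, hvϖ, hvϖn, ← WithTop.coe_add, WithTop.coe_inj] at hval
  push_cast at hval
  rw [hn, WithTop.coe_le_coe]
  omega

end MonomialJacobian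

/-! ### Convexity -/

section Convexity

/-- Farkas' lemma over the rational numbers. -/
theorem farkas {κ W : Type*} [AddCommGroup W] [Module ℚ W] (s : Finset κ) :
    ∀ (A : κ → W →ₗ[ℚ] ℚ) (b : W →ₗ[ℚ] ℚ), (∀ x, (∀ i ∈ s, A i x ≤ 0) → b x ≤ 0) →
      ∃ u : κ → ℚ, (∀ i, 0 ≤ u i) ∧ b = ∑ i ∈ s, u i • A i := by
  classical
  induction s using Finset.induction_on with
  | empty =>
    intro A b h
    refine ⟨0, fun _ => le_rfl, LinearMap.ext fun x => le_antisymm (h x (by simp)) ?_⟩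
    have := h (-x) (by simp)
    rw [map_neg] at this
    simpa using this
  | insert k s hk ih =>
    intro A b h
    by_cases h' : ∀ x, (∀ i ∈ s, A i x ≤ 0) → b x ≤ 0
    · obtain ⟨u, hu, hb⟩ := ih A b h'
      refine ⟨Function.update u k 0, fun i => ?_, ?_⟩
      · by_cases hi : i = k
        · subst hi; simp
        · simpa [hi] using hu i
      · rw [Finset.sum_insert hk, hb, Function.update_self, zero_smul, zero_add]
        refine Finset.sum_congr rfl fun i hi => ?_
        rw [Function.update_of_ne (ne_of_mem_of_not_mem hi hk)]
    · push Not at h'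
      obtain ⟨y, hy, hby⟩ := h'
      have hky : 0 < A k y := by
        by_contra! hle
        exact hby.not_ge (h y fun i hi => by
          rcases Finset.mem_insert.1 hi with rfl | hi
          exacts [hle, hy i hi])
      set z := (A k y)⁻¹ • y with hz
      have hkz : A k z = 1 := by rw [hz, map_smul, smul_eq_mul, inv_mul_cancel₀ hky.ne']
      have hsz : ∀ i ∈ s, A i z ≤ 0 := fun i hi => by
        rw [hz, map_smul, smul_eq_mul]
        exact mul_nonpos_of_nonneg_of_nonpos (inv_nonneg.2 hky.le) (hy i hi)
      have hbz : 0 ≤ b z := by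
        rw [hz, map_smul, smul_eq_mul]
        exact mul_nonneg (inv_nonneg.2 hky.le) hby.le
      -- Projection onto the kernel of `A k` along `z`. On that kernel the `k`-th constraint is
      -- void, so the induction hypothesis applies to the composed functionals; the coefficient of
      -- `A k` is then forced by evaluation at `z`.
      let p : W →ₗ[ℚ] W := LinearMap.id - (A k).smulRight z
      have hp : ∀ x, p x = x - A k x • z := fun x => rfl
      obtain ⟨u, hu, hb⟩ := ih (fun i => A i ∘ₗ p) (b ∘ₗ p) fun x hx => h (p x) fun i hi => by
        rcases Finset.mem_insert.1 hi with rfl | hi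
        · rw [hp, map_sub, map_smul, hkz]
          simp
        · exact hx i hi
      refine ⟨Function.update u k (b z - ∑ i ∈ s, u i * A i z), fun i => ?_, ?_⟩
      · by_cases hi : i = k
        · subst hi
          rw [Function.update_self, sub_nonneg]
          exact (Finset.sum_nonpos fun j hj =>
            mul_nonpos_of_nonneg_of_nonpos (hu j) (hsz j hj)).trans hbz
        · simpa [hi] using hu i
      · rw [Finset.sum_insert hk, Function.update_self]
        have h1 : ∑ i ∈ s, Function.update u k (b z - ∑ i ∈ s, u i * A i z) i • A i =
            ∑ i ∈ s, u i • A i := Finset.sum_congr rfl fun i hi => by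
          rw [Function.update_of_ne (ne_of_mem_of_not_mem hi hk)]
        rw [h1]
        ext x
        have h2 := LinearMap.congr_fun hb x
        simp only [LinearMap.comp_apply, hp, map_sub, map_smul, LinearMap.sum_apply,
          LinearMap.smul_apply, smul_eq_mul, mul_sub, Finset.sum_sub_distrib] at h2
        simp only [LinearMap.add_apply, LinearMap.smul_apply, LinearMap.sum_apply, smul_eq_mul]
        have h3 : ∑ i ∈ s, u i * (A k x * A i z) = A k x * ∑ i ∈ s, u i * A i z := by
          rw [Finset.mul_sum]
          exact Finset.sum_congr rfl fun i _ => by ring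
        rw [h3] at h2
        linear_combination h2

variable {ι : Type*} [Fintype ι]

theorem wt_comm (w e : ι → ℕ) : wt w e = wt e w :=
  Finset.sum_congr rfl fun _ _ => mul_comm _ _

theorem wt_add_left (v w e : ι → ℕ) : wt (v + w) e = wt v e + wt w e := by
  rw [wt_comm, wt_add, wt_comm e, wt_comm e]

/-- The exponent vectors `e` for which `e + (1, …, 1)` is an interior point of the Newton
polyhedron of `A`. -/
def IsInterior (A : Finset (ι → ℕ)) (e : ι → ℕ) : Prop :=
  ∀ w : ι → ℕ, w ≠ 0 → ∃ a ∈ A, wt w a < wt w (e + 1)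

/-- Finitely many weights suffice to test for interior points. -/
theorem exists_finite_weights {A : Finset (ι → ℕ)} (hA : A.Nonempty) :
    ∃ W : Finset (ι → ℕ), (∀ w ∈ W, w ≠ 0) ∧
      ∀ e, (∀ w ∈ W, ∃ a ∈ A, wt w a < wt w (e + 1)) → IsInterior A e := by
  classical
  -- The nonzero weights minimized over `A` at `a`, that is, the lattice points of a normal cone.
  -- The slack variables make minimality an equation, so subtracting a minimal element stays in `S
  -- a` unless the weight becomes zero. By Dickson's lemma there are finitely many minimal elements,
  -- and strict inequalities add up.
  let S : (ι → ℕ) → Set ((ι → ℕ) × (A → ℕ)) := fun a =>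
    {z | z.1 ≠ 0 ∧ ∀ a' : A, wt z.1 a + z.2 a' = wt z.1 a'}
  have hfin : ∀ a, {z | Minimal (· ∈ S a) z}.Finite := fun a =>
    WellQuasiOrderedLE.finite_of_isAntichain (setOfPred_minimal_antichain _)
  refine ⟨A.biUnion fun a => (hfin a).toFinset.image Prod.fst, ?_, ?_⟩
  · intro w hw
    obtain ⟨a, _, hw⟩ := Finset.mem_biUnion.1 hw
    obtain ⟨z, hz, rfl⟩ := Finset.mem_image.1 hw
    exact ((hfin a).mem_toFinset.1 hz).prop.1
  · intro e he
    have key : ∀ a ∈ A, ∀ z : (ι → ℕ) × (A → ℕ), z ∈ S a → wt z.1 a < wt z.1 (e + 1) := by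
      intro a ha z
      induction z using WellFoundedLT.induction with
      | ind z ih =>
        intro hz
        obtain ⟨m, hmz, hm⟩ := exists_minimal_le_of_wellFoundedLT (· ∈ S a) z hz
        have hlt : wt m.1 a < wt m.1 (e + 1) := by
          obtain ⟨a', ha', hlt⟩ := he m.1 (Finset.mem_biUnion.2 ⟨a, ha,
            Finset.mem_image.2 ⟨m, (hfin a).mem_toFinset.2 hm, rfl⟩⟩)
          have := hm.prop.2 ⟨a', ha'⟩
          dsimp only at this
          omega
        have hsub : z.1 - m.1 + m.1 = z.1 := tsub_add_cancel_of_le hmz.1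
        by_cases h0 : z.1 - m.1 = 0
        · rw [h0, zero_add] at hsub
          rwa [← hsub]
        · have hlt' : z - m < z := by
            refine lt_of_le_of_ne tsub_le_self fun h => hm.prop.1 ?_
            have h1 : z.1 - m.1 = z.1 := congrArg Prod.fst h
            rw [h1] at hsub
            simpa using hsub
          have hS : z - m ∈ S a := by
            refine ⟨h0, fun a' => ?_⟩
            have h1 := hz.2 a'
            have h2 := hm.prop.2 a'
            have h3 : m.2 a' ≤ z.2 a' := hmz.2 a'
            rw [← hsub, wt_add_left, wt_add_left] at h1
            change wt (z.1 - m.1) a + (z.2 a' - m.2 a') = wt (z.1 - m.1) a'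
            omega
          have h1 : wt (z.1 - m.1) a < wt (z.1 - m.1) (e + 1) := ih _ hlt' hS
          rw [← hsub, wt_add_left, wt_add_left]
          omega
    intro w hw
    obtain ⟨a, ha, hmin⟩ := A.exists_min_image (wt w) hA
    refine ⟨a, ha, key a ha (w, fun a' => wt w a' - wt w a) ⟨hw, fun a' => ?_⟩⟩
    have := hmin a' a'.2
    dsimp only
    omega

/-- A weighted average lies strictly below `e + 1` in every coordinate, hence has smaller weight for
every `w ≠ 0`; some averaged point must then have smaller weight as well. -/
theorem exists_wt_lt_of_average {κ : Type*} (s : Finset κ) {c : κ → ℚ} (hc : ∀ k, 0 ≤ c k)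
    (f : κ → ι → ℕ) {e : ι → ℕ}
    (he : ∀ i, (∑ k ∈ s, c k * f k i) < (∑ k ∈ s, c k) * (e i + 1)) {w : ι → ℕ} (hw : w ≠ 0) :
    ∃ k ∈ s, wt w (f k) < wt w (e + 1) := by
  by_contra! h
  obtain ⟨i₀, hi₀⟩ : ∃ i, w i ≠ 0 := Function.ne_iff.1 hw
  have h1 : ∑ k ∈ s, c k * (wt w (f k) : ℚ) < (∑ k ∈ s, c k) * wt w (e + 1) := by
    have h2 : ∑ k ∈ s, c k * (wt w (f k) : ℚ) = ∑ i, (∑ k ∈ s, c k * f k i) * w i := by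
      simp only [wt, Nat.cast_sum, Nat.cast_mul, Finset.mul_sum, Finset.sum_mul]
      rw [Finset.sum_comm]
      simp only [mul_assoc]
    have h3 : (∑ k ∈ s, c k) * (wt w (e + 1) : ℚ) =
        ∑ i, ((∑ k ∈ s, c k) * (e i + 1)) * w i := by
      simp [wt, Finset.mul_sum, mul_assoc]
    rw [h2, h3]
    refine Finset.sum_lt_sum (fun i _ => mul_le_mul_of_nonneg_right (he i).le (Nat.cast_nonneg _))
      ⟨i₀, Finset.mem_univ _, mul_lt_mul_of_pos_right (he i₀) ?_⟩
    exact_mod_cast Nat.pos_of_ne_zero hi₀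
  refine h1.not_ge ?_
  rw [Finset.sum_mul]
  exact Finset.sum_le_sum fun k hk => mul_le_mul_of_nonneg_left (by exact_mod_cast h k hk) (hc k)

/-- An interior point of a sum of Newton polyhedra dominates a sum of interior points. -/
theorem exists_isInterior_add_le {A B : Finset (ι → ℕ)} {e : ι → ℕ}
    (he : ∀ w : ι → ℕ, w ≠ 0 → ∃ a ∈ A, ∃ b ∈ B, wt w a + wt w b < wt w (e + 1)) :
    ∃ e₁ e₂, IsInterior A e₁ ∧ IsInterior B e₂ ∧ e₁ + e₂ ≤ e := by
  classical
  cases isEmpty_or_nonempty ι with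
  | inl hι =>
    exact ⟨0, 0, fun w hw => absurd (Subsingleton.elim _ _) hw,
      fun w hw => absurd (Subsingleton.elim _ _) hw, fun i => hι.elim i⟩
  | inr hι =>
  let L : (ι → ℚ) → (ι → ℚ) →ₗ[ℚ] ℚ := fun c => ∑ i, c i • LinearMap.proj i
  have hL : ∀ c z, L c z = ∑ i, c i * z i := fun c z => by simp [L, LinearMap.sum_apply]
  let F : ι ⊕ ((ι → ℕ) × (ι → ℕ)) → (ι → ℚ) := Sum.elim (fun i => -Pi.single i 1)
    (fun p i => (e i + 1 : ℚ) - p.1 i - p.2 i)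
  -- The constraints say `z ≥ 0` and `(e + 1 - a - b)·z ≤ 0` for all pairs. A solution with `∑ z_i >
  -- 0` would, after clearing denominators, be a weight contradicting `he`. The target functional `∑
  -- z_i` has coefficient `1` in each coordinate, which makes `hkey` strict.
  obtain ⟨u, hu, hb⟩ := farkas (Finset.univ.disjSum (A ×ˢ B)) (fun k => L (F k)) (L 1) (by
    intro z hz
    have hz0 : ∀ i, 0 ≤ z i := fun i => by
      have := hz (Sum.inl i) (Finset.inl_mem_disjSum.2 (Finset.mem_univ i))
      simpa [hL, F, Pi.single_apply] using this
    by_contra! hpos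
    obtain ⟨N, hN, w, hw⟩ : ∃ N : ℕ, 0 < N ∧ ∃ w : ι → ℕ, ∀ i, (w i : ℚ) = N * z i := by
      refine ⟨∏ i, (z i).den, Finset.prod_pos fun i _ => (z i).den_pos,
        fun i => (∏ j ∈ Finset.univ.erase i, (z j).den) * (z i).num.toNat, fun i => ?_⟩
      rw [← Finset.mul_prod_erase _ _ (Finset.mem_univ i)]
      have h1 : ((z i).num.toNat : ℚ) = (z i).den * z i := by
        rw [mul_comm, Rat.mul_den_eq_num]
        exact_mod_cast Int.toNat_of_nonneg (Rat.num_nonneg.2 (hz0 i))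
      rw [Nat.cast_mul, h1]
      push_cast
      ring
    have hw0 : w ≠ 0 := by
      rintro rfl
      refine hpos.ne' ?_
      rw [hL]
      refine Finset.sum_eq_zero fun i _ => ?_
      have := hw i
      rw [Pi.zero_apply, Nat.cast_zero, eq_comm, mul_eq_zero, Nat.cast_eq_zero] at this
      rw [this.resolve_left hN.ne', mul_zero]
    obtain ⟨a, ha, b, hb, hlt⟩ := he w hw0
    have h1 := hz (Sum.inr (a, b)) (Finset.inr_mem_disjSum.2 (Finset.mk_mem_product ha hb))
    simp only [hL, F, Sum.elim_inr] at h1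
    have h2 : ((wt w a + wt w b : ℕ) : ℚ) < (wt w (e + 1) : ℕ) := by exact_mod_cast hlt
    have h3 : (N : ℚ) * ∑ i, ((e i + 1 : ℚ) - a i - b i) * z i =
        (wt w (e + 1) : ℕ) - ((wt w a + wt w b : ℕ) : ℚ) := by
      simp only [wt, Nat.cast_add, Nat.cast_sum, Nat.cast_mul, hw, Finset.mul_sum, Pi.add_apply,
        Pi.one_apply, Nat.cast_one]
      rw [← Finset.sum_add_distrib, ← Finset.sum_sub_distrib]
      exact Finset.sum_congr rfl fun i _ => by ring
    have h4 := mul_nonpos_of_nonneg_of_nonpos (Nat.cast_nonneg N) h1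
    rw [h3] at h4
    linarith)
  set s := A ×ˢ B
  set c : (ι → ℕ) × (ι → ℕ) → ℚ := fun p => u (Sum.inr p) with hc
  have hkey : ∀ i, ∑ p ∈ s, c p * (p.1 i + p.2 i : ℚ) < (∑ p ∈ s, c p) * (e i + 1) := by
    intro i
    have h1 := LinearMap.congr_fun hb (Pi.single i 1)
    rw [Finset.sum_disjSum] at h1
    simp only [LinearMap.add_apply, LinearMap.sum_apply, LinearMap.smul_apply, hL, F, Sum.elim_inl,
      Sum.elim_inr, Pi.one_apply, Pi.single_apply, mul_ite, mul_one, mul_zero,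
      Finset.sum_ite_eq', Finset.mem_univ, if_true, Pi.neg_apply, smul_eq_mul] at h1
    have h2 : ∑ j, u (Sum.inl j) * -(if i = j then (1 : ℚ) else 0) = - u (Sum.inl i) := by
      simp
    rw [h2] at h1
    have h3 : ∑ p ∈ s, c p * (p.1 i + p.2 i : ℚ) = (∑ p ∈ s, c p) * (e i + 1) -
        ∑ p ∈ s, u (Sum.inr p) * ((e i + 1 : ℚ) - p.1 i - p.2 i) := by
      rw [Finset.sum_mul, ← Finset.sum_sub_distrib]
      exact Finset.sum_congr rfl fun p _ => by simp only [hc]; ring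
    have := hu (Sum.inl i)
    linarith
  have hpos : 0 < ∑ p ∈ s, c p := by
    obtain ⟨i⟩ := hι
    have h1 := hkey i
    have h2 : 0 ≤ ∑ p ∈ s, c p * (p.1 i + p.2 i : ℚ) :=
      Finset.sum_nonneg fun p _ => mul_nonneg (hu _) (by positivity)
    by_contra! hle
    have h3 : (∑ p ∈ s, c p) * (e i + 1 : ℚ) ≤ 0 :=
      mul_nonpos_of_nonpos_of_nonneg hle (by positivity)
    linarith
  set Λ := ∑ p ∈ s, c p
  have hfl : ∀ f : (ι → ℕ) × (ι → ℕ) → ι → ℕ, ∀ i, ∑ p ∈ s, c p * (f p i : ℚ) <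
      Λ * ((⌊(∑ p ∈ s, c p * (f p i : ℚ)) / Λ⌋₊ : ℕ) + 1) := fun f i => by
    rw [mul_comm, ← div_lt_iff₀ hpos]
    exact Nat.lt_floor_add_one _
  -- Each average is strictly below its integer part plus one, which gives interiority. The integer
  -- parts add up to less than `e i + 1`, hence to at most `e i`.
  refine ⟨fun i => ⌊(∑ p ∈ s, c p * (p.1 i : ℚ)) / Λ⌋₊,
    fun i => ⌊(∑ p ∈ s, c p * (p.2 i : ℚ)) / Λ⌋₊, fun w hw => ?_, fun w hw => ?_, fun i => ?_⟩
  · obtain ⟨k, hk, h⟩ := exists_wt_lt_of_average s (fun p => hu _) Prod.fst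
      (hfl Prod.fst) hw
    exact ⟨k.1, (Finset.mem_product.1 hk).1, h⟩
  · obtain ⟨k, hk, h⟩ := exists_wt_lt_of_average s (fun p => hu _) Prod.snd
      (hfl Prod.snd) hw
    exact ⟨k.2, (Finset.mem_product.1 hk).2, h⟩
  · have h0 : ∀ f : (ι → ℕ) × (ι → ℕ) → ι → ℕ, 0 ≤ (∑ p ∈ s, c p * (f p i : ℚ)) / Λ := fun f =>
      div_nonneg (Finset.sum_nonneg fun p _ => mul_nonneg (hu _) (Nat.cast_nonneg _)) hpos.le
    have h1 := Nat.floor_le (h0 Prod.fst)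
    have h2 := Nat.floor_le (h0 Prod.snd)
    have h3 : (∑ p ∈ s, c p * (p.1 i : ℚ)) / Λ + (∑ p ∈ s, c p * (p.2 i : ℚ)) / Λ < e i + 1 := by
      rw [← add_div, div_lt_iff₀ hpos, ← Finset.sum_add_distrib, mul_comm]
      simpa only [mul_add] using hkey i
    have h4 : ((⌊(∑ p ∈ s, c p * (p.1 i : ℚ)) / Λ⌋₊ + ⌊(∑ p ∈ s, c p * (p.2 i : ℚ)) / Λ⌋₊ : ℕ) : ℚ) <
        ((e i + 1 : ℕ) : ℚ) := by
      push_cast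
      linarith
    exact Nat.lt_succ_iff.1 (by exact_mod_cast h4)

end Convexity

/-! ### Regular local rings -/

section RegularLocal

open IsLocalRing

theorem le_of_add_natCast_le {n m : ℕ} {d : WithBot ℕ∞} (h : (n : WithBot ℕ∞) + m ≤ d + m) :
    (n : WithBot ℕ∞) ≤ d := by
  cases d with
  | bot =>
    rw [WithBot.bot_add, le_bot_iff] at h
    exact absurd h (by exact_mod_cast WithBot.coe_ne_bot (a := ((n + m : ℕ) : ℕ∞)))
  | coe d =>
    have h1 : (n : ℕ∞) + m ≤ d + m := by exact_mod_cast h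
    exact_mod_cast (ENat.add_le_add_iff_right (ENat.natCast_ne_top m)).1 h1

/-- Exchange: as `z` is not in the square of the maximal ideal, some coefficient of `z` in the
generators is a unit, and that generator can be traded for `z`. -/
theorem exists_mem_span_insert_erase {A κ : Type*} [CommRing A] [IsLocalRing A] [Fintype κ]
    [DecidableEq κ] {y : κ → A} (hy : Ideal.span (Set.range y) = maximalIdeal A) {z : A}
    (hz : z ∈ maximalIdeal A) (hz2 : z ∉ maximalIdeal A ^ 2) :
    ∃ k, maximalIdeal A = Ideal.span {z} ⊔ Ideal.span (y '' {k}ᶜ) := by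
  have hmem : ∀ k, y k ∈ maximalIdeal A := fun k => hy ▸ Ideal.subset_span ⟨k, rfl⟩
  rw [← hy] at hz
  obtain ⟨c, hc⟩ := (Ideal.mem_span_range_iff_exists_fun).1 hz
  obtain ⟨k, hk⟩ : ∃ k, IsUnit (c k) := by
    by_contra! h
    refine hz2 ?_
    rw [← hc, pow_two]
    exact sum_mem fun k _ => Ideal.mul_mem_mul ((mem_maximalIdeal _).2 (h k)) (hmem k)
  refine ⟨k, le_antisymm ?_ ?_⟩
  · rw [← hy, Ideal.span_le]
    rintro _ ⟨j, rfl⟩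
    by_cases hj : j = k
    · subst hj
      rw [SetLike.mem_coe, ← Ideal.unit_mul_mem_iff_mem _ hk,
        show c j * y j = z - ∑ i ∈ Finset.univ.erase j, c i * y i by
          rw [← hc, ← Finset.add_sum_erase _ _ (Finset.mem_univ j), add_sub_cancel_right]]
      refine sub_mem (Submodule.mem_sup_left (Ideal.mem_span_singleton_self z))
        (Submodule.mem_sup_right (sum_mem fun i hi => Ideal.mul_mem_left _ _
          (Ideal.subset_span ⟨i, Finset.ne_of_mem_erase hi, rfl⟩)))
    · exact Submodule.mem_sup_right (Ideal.subset_span ⟨j, hj, rfl⟩)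
  · rw [sup_le_iff, Ideal.span_le, Ideal.span_le, Set.singleton_subset_iff]
    refine ⟨hy ▸ hz, ?_⟩
    rintro _ ⟨j, _, rfl⟩
    exact hmem j

/-- A Noetherian local ring whose maximal ideal has `n ≤ dim A` generators is a domain. -/
theorem isDomain_of_span_eq_maximalIdeal (n : ℕ) : ∀ (A : Type*) [CommRing A] [IsLocalRing A]
    [IsNoetherianRing A] (κ : Type) [Fintype κ] (y : κ → A), Fintype.card κ = n →
      Ideal.span (Set.range y) = maximalIdeal A → (n : WithBot ℕ∞) ≤ ringKrullDim A →
        IsDomain A := by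
  classical
  induction n with
  | zero =>
    intro A _ _ _ κ _ y hκ hy _
    have : IsEmpty κ := Fintype.card_eq_zero_iff.1 hκ
    rw [Set.range_eq_empty, Ideal.span_empty] at hy
    exact ((isField_iff_maximalIdeal_eq).2 hy.symm).isDomain
  | succ n ih =>
    intro A _ _ _ κ _ y hκ hy hdim
    have hht : (n + 1 : ℕ∞) ≤ (maximalIdeal A).height := by
      rw [← IsLocalRing.maximalIdeal_height_eq_ringKrullDim] at hdim
      exact_mod_cast hdim
    have hbot : maximalIdeal A ≠ ⊥ := fun h => by
      have : (maximalIdeal A).height = 0 := by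
        rw [Ideal.height_eq_zero_iff, h]
        have : IsDomain A := ((isField_iff_maximalIdeal_eq).2 h).isDomain
        rw [IsDomain.minimalPrimes_eq_singleton_bot]
        rfl
      rw [this] at hht
      simp at hht
    -- Prime avoidance, which tolerates the one ideal `maximalIdeal A ^ 2` that need not be prime.
    -- Containment in it is excluded by Nakayama, containment in a minimal prime by the positive
    -- height.
    obtain ⟨z, hz, hz2, hzmin⟩ : ∃ z ∈ maximalIdeal A, z ∉ maximalIdeal A ^ 2 ∧
        ∀ q ∈ minimalPrimes A, z ∉ q := by
      by_contra! h
      have hsub : (maximalIdeal A : Set A) ⊆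
          ⋃ q ∈ insert (maximalIdeal A ^ 2) (minimalPrimes A), ((q : Ideal A) : Set A) := by
        intro z hz
        by_cases hz2 : z ∈ maximalIdeal A ^ 2
        · exact Set.mem_biUnion (Set.mem_insert _ _) hz2
        · obtain ⟨q, hq, hzq⟩ := h z hz hz2
          exact Set.mem_biUnion (Set.mem_insert_of_mem _ hq) hzq
      obtain ⟨q, hq, hle⟩ := (Ideal.subset_union_prime_finite
        ((minimalPrimes.finite_of_isNoetherianRing A).insert _) (f := id) (maximalIdeal A ^ 2)
        (maximalIdeal A ^ 2) fun q hq h1 _ =>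
          ((Set.mem_insert_iff.1 hq).resolve_left h1).1.1).1 hsub
      rcases Set.mem_insert_iff.1 hq with rfl | hq
      · refine hbot (Submodule.eq_bot_of_le_smul_of_le_jacobson_bot (maximalIdeal A) _
          (IsNoetherian.noetherian _) ?_ (maximalIdeal_le_jacobson _))
        rw [smul_eq_mul, ← pow_two]
        exact hle
      · have : (maximalIdeal A).height = 0 := by
          rw [Ideal.height_eq_zero_iff]
          have := hq.1.1
          rwa [← (le_antisymm hle (le_maximalIdeal this.ne_top) : maximalIdeal A = q)] at hq
        rw [this] at hht
        simp at hht
    obtain ⟨k, hk⟩ := exists_mem_span_insert_erase hy hz hz2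
    set I := Ideal.span {z} with hI
    have hIle : I ≤ maximalIdeal A := by
      rw [hI, Ideal.span_le, Set.singleton_subset_iff]
      exact hz
    have : Nontrivial (A ⧸ I) := Ideal.Quotient.nontrivial_iff.2 fun h =>
      (Ideal.IsPrime.ne_top' (I := maximalIdeal A)) (top_le_iff.1 (h ▸ hIle))
    have hloc : IsLocalRing (A ⧸ I) :=
      IsLocalRing.of_surjective' (Ideal.Quotient.mk I) Ideal.Quotient.mk_surjective
    have hmax : maximalIdeal (A ⧸ I) = (maximalIdeal A).map (Ideal.Quotient.mk I) :=
      (IsLocalRing.map_maximalIdeal_of_surjective _ Ideal.Quotient.mk_surjective).symm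
    have hdom : IsDomain (A ⧸ I) := by
      refine ih (A ⧸ I) {j // j ≠ k} (fun j => Ideal.Quotient.mk I (y j)) ?_ ?_ ?_
      · rw [Fintype.card_subtype_compl, hκ, Fintype.card_subtype_eq]
        rfl
      · rw [hmax, hk, Ideal.map_sup, hI, Ideal.map_span, Set.image_singleton,
          Ideal.Quotient.eq_zero_iff_mem.2 (Ideal.mem_span_singleton_self z), Ideal.span_singleton_zero,
          bot_sup_eq, Ideal.map_span, Set.image_image]
        congr 1
        ext a
        simp
      · have h1 := Ideal.height_le_ringKrullDim_quotient_add_one hz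
        have h2 : ((n + 1 : ℕ∞) : WithBot ℕ∞) ≤ ringKrullDim (A ⧸ I) + 1 :=
          le_trans (by exact_mod_cast hht) h1
        have h3 : ((n : WithBot ℕ∞)) + 1 ≤ ringKrullDim (A ⧸ I) + 1 := by exact_mod_cast h2
        exact le_of_add_natCast_le (m := 1) (by exact_mod_cast h3)
    have hprime : I.IsPrime := (Ideal.Quotient.isDomain_iff_prime I).1 hdom
    -- A minimal prime `q` inside `(z)` does not contain `z`, so `q = z q`, and Nakayama gives `q =
    -- 0`.
    obtain ⟨q, hq, hqI⟩ := Ideal.exists_minimalPrimes_le (bot_le : (⊥ : Ideal A) ≤ I)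
    have hqp : q.IsPrime := hq.1.1
    have hq0 : q = ⊥ := by
      refine Submodule.eq_bot_of_le_smul_of_le_jacobson_bot (maximalIdeal A) _
          (IsNoetherian.noetherian _) (fun a ha => ?_) (maximalIdeal_le_jacobson _)
      obtain ⟨b, rfl⟩ := Ideal.mem_span_singleton'.1 (hqI ha)
      rw [mul_comm]
      exact Ideal.mul_mem_mul hz ((hqp.mem_or_mem ha).resolve_right (hzmin q hq))
    rw [hq0] at hqp
    exact IsDomain.of_bot_isPrime A

/-- A subset of a regular system of parameters generates a prime ideal of the expected height. -/
theorem isPrime_span_and_le_height {A : Type*} [CommRing A] [IsLocalRing A] [IsNoetherianRing A]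
    {κ : Type} [Fintype κ] {y : κ → A} (hy : Ideal.span (Set.range y) = maximalIdeal A)
    (hdim : (Fintype.card κ : ℕ∞) ≤ (maximalIdeal A).height) (s : Finset κ) :
    (Ideal.span (y '' s)).IsPrime ∧ (s.card : ℕ∞) ≤ (Ideal.span (y '' s)).height := by
  classical
  have hmem : ∀ k, y k ∈ maximalIdeal A := fun k => hy ▸ Ideal.subset_span ⟨k, rfl⟩
  have hprime : ∀ s : Finset κ, (Ideal.span (y '' s)).IsPrime := by
    intro s
    set I := Ideal.span (y '' s) with hI
    have hIle : I ≤ maximalIdeal A := by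
      rw [hI, Ideal.span_le]
      rintro _ ⟨j, _, rfl⟩
      exact hmem j
    have : Nontrivial (A ⧸ I) := Ideal.Quotient.nontrivial_iff.2 fun h =>
      (Ideal.IsPrime.ne_top' (I := maximalIdeal A)) (top_le_iff.1 (h ▸ hIle))
    have hloc : IsLocalRing (A ⧸ I) :=
      IsLocalRing.of_surjective' (Ideal.Quotient.mk I) Ideal.Quotient.mk_surjective
    have hmax : maximalIdeal (A ⧸ I) = (maximalIdeal A).map (Ideal.Quotient.mk I) :=
      (IsLocalRing.map_maximalIdeal_of_surjective _ Ideal.Quotient.mk_surjective).symm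
    rw [← Ideal.Quotient.isDomain_iff_prime]
    refine isDomain_of_span_eq_maximalIdeal (Fintype.card {j // j ∉ s}) (A ⧸ I) {j // j ∉ s}
      (fun j => Ideal.Quotient.mk I (y j)) rfl ?_ ?_
    · rw [hmax, ← hy, Ideal.map_span]
      refine le_antisymm (Ideal.span_mono ?_) (Ideal.span_le.2 ?_)
      · rintro _ ⟨j, rfl⟩
        exact ⟨y j, ⟨j, rfl⟩, rfl⟩
      · rintro _ ⟨_, ⟨j, rfl⟩, rfl⟩
        by_cases hj : j ∈ s
        · rw [Ideal.Quotient.eq_zero_iff_mem.2 (Ideal.subset_span (Set.mem_image_of_mem y hj))]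
          exact zero_mem _
        · exact Ideal.subset_span ⟨⟨j, hj⟩, rfl⟩
    · have h1 := Ideal.height_le_ringKrullDim_quotient_add_encard (p := maximalIdeal A) (y '' s)
        (by rintro _ ⟨j, _, rfl⟩; exact hmem j)
      have h2 : (y '' s).encard ≤ s.card := by
        simpa using Set.encard_image_le y (s : Set κ)
      have h3 : ((Fintype.card {j // j ∉ s} : ℕ) : WithBot ℕ∞) + (s.card : ℕ) ≤
          ringKrullDim (A ⧸ I) + (s.card : ℕ) := by
        rw [← Nat.cast_add, show Fintype.card {j // j ∉ s} + s.card = Fintype.card κ by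
          rw [Fintype.card_subtype_compl, Fintype.card_coe,
            Nat.sub_add_cancel (Finset.card_le_univ s)]]
        refine le_trans ?_ (h1.trans (add_le_add_right ?_ _))
        · exact_mod_cast hdim
        · exact_mod_cast h2
      exact le_of_add_natCast_le h3
  refine ⟨hprime s, ?_⟩
  induction s using Finset.induction_on with
  | empty => simp
  | insert k s hk ih =>
    have := hprime s
    have := hprime (insert k s)
    have hle : Ideal.span (y '' s) ≤ Ideal.span (y '' (insert k s : Finset κ)) :=
      Ideal.span_mono (Set.image_mono (by simp))
    -- If `y k` were redundant, the maximal ideal would have fewer generators than its height,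
    -- against Krull's height theorem.
    have hlt : Ideal.span (y '' s) < Ideal.span (y '' (insert k s : Finset κ)) := by
      refine lt_of_le_of_ne hle fun heq => ?_
      have hyk : y k ∈ Ideal.span (y '' s) := by
        rw [heq]
        exact Ideal.subset_span ⟨k, by simp, rfl⟩
      have hmax : maximalIdeal A = Ideal.span (y '' (Finset.univ.erase k : Finset κ)) := by
        refine le_antisymm ?_ ?_
        · rw [← hy, Ideal.span_le]
          rintro _ ⟨j, rfl⟩
          by_cases hj : j = k
          · subst hj
            refine Ideal.span_mono (Set.image_mono fun i hi => ?_) hyk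
            have : i ≠ j := fun h => hk (h ▸ hi)
            simpa using this
          · exact Ideal.subset_span ⟨j, by simpa using hj, rfl⟩
        · rw [Ideal.span_le]
          rintro _ ⟨j, _, rfl⟩
          exact hmem j
      have h1 : (maximalIdeal A).height ≤ ((y '' (Finset.univ.erase k : Finset κ)).ncard : ℕ∞) := by
        refine Ideal.height_le_card_of_mem_minimalPrimes_span ((Finset.finite_toSet _).image y) ?_
        rw [← hmax, Ideal.minimalPrimes_eq_subsingleton_self]
        rfl
      have h2 : (y '' (Finset.univ.erase k : Finset κ)).ncard ≤ (Finset.univ.erase k).card := by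
        rw [← Set.ncard_coe_finset]
        exact Set.ncard_image_le (Finset.finite_toSet _)
      have h3 := hdim.trans (h1.trans (Nat.cast_le.2 h2))
      rw [Nat.cast_le, Finset.card_erase_of_mem (Finset.mem_univ k), Finset.card_univ] at h3
      have : 0 < Fintype.card κ := Fintype.card_pos_iff.2 ⟨k⟩
      omega
    rw [Finset.card_insert_of_notMem hk, Nat.cast_add, Nat.cast_one]
    exact (add_le_add_left ih 1).trans (Ideal.height_add_one_le_of_lt_of_isPrime hlt)

/-- A chain of primes below `p` pulls back to a chain above `J`, which can be continued by a chain
below `J`. -/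
theorem height_map_mk_add_le {B : Type*} [CommRing B] {J : Ideal B} [J.IsPrime]
    (p : Ideal (B ⧸ J)) [p.IsPrime] :
    p.height + J.height ≤ (p.comap (Ideal.Quotient.mk J)).height := by
  have key : ∀ n : ℕ, ∀ p : Ideal (B ⧸ J), p.IsPrime → (n : ℕ∞) ≤ p.height →
      n + J.height ≤ (p.comap (Ideal.Quotient.mk J)).height := by
    intro n
    induction n with
    | zero =>
      intro p hp _
      rw [Nat.cast_zero, zero_add]
      refine Ideal.height_mono ?_
      conv_lhs => rw [← Ideal.mk_ker (I := J)]
      exact Ideal.comap_mono bot_le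
    | succ n ih =>
      intro p hp hn
      have h1 : ¬ p.height ≤ n := fun h => by
        have := hn.trans h
        rw [Nat.cast_le] at this
        omega
      rw [Ideal.height_le_iff] at h1
      push Not at h1
      obtain ⟨q, hq, hqp, hqn⟩ := h1
      have h2 := ih q hq hqn
      have h3 : q.comap (Ideal.Quotient.mk J) < p.comap (Ideal.Quotient.mk J) :=
        lt_of_le_not_ge (Ideal.comap_mono hqp.le) fun h => hqp.not_ge
          ((Ideal.comap_le_comap_iff_of_surjective _ Ideal.Quotient.mk_surjective _ _).1 h)
      have h4 := Ideal.height_add_one_le_of_lt_of_isPrime h3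
      refine le_trans ?_ h4
      rw [Nat.cast_add, Nat.cast_one, add_right_comm]
      exact add_le_add_left h2 1
  by_cases h : p.height = ⊤
  · rw [h, top_add, top_le_iff, ENat.eq_top_iff_forall_ge]
    intro n
    exact le_self_add.trans (key n p inferInstance (h ▸ le_top))
  · obtain ⟨n, hn⟩ := ENat.ne_top_iff_exists.1 h
    rw [← hn]
    exact key n p inferInstance hn.le

end RegularLocal

/-! ### Local equations extending part of a regular system of parameters -/

section LocalGenerators

open IsLocalRing

/-- A prime of a regular ring is locally generated by as many elements as its height. -/
theorem exists_local_generators {C : Type*} [CommRing C] [IsRegularRing C] (p : Ideal C)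
    [p.IsPrime] : ∃ k : ℕ, (k : ℕ∞) = p.height ∧ ∃ y : Fin k → C, (∀ i, y i ∈ p) ∧
      ∀ b ∈ p, ∃ σ ∉ p, σ * b ∈ Ideal.span (Set.range y) := by
  let L := Localization.AtPrime p
  have hfg : (maximalIdeal L).FG := IsNoetherian.noetherian _
  obtain ⟨t, ht, hspan⟩ := Submodule.FG.exists_span_finset_card_eq_spanFinrank hfg
  have hcard : (t.card : ℕ∞) = p.height := by
    have : IsRegularLocalRing L := IsRegularRing.isRegularLocalRing_localization p
    have h1 : ((maximalIdeal L).spanFinrank : WithBot ℕ∞) = ringKrullDim L :=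
      IsRegularLocalRing.spanFinrank_maximalIdeal
    rw [← ht, IsLocalization.AtPrime.ringKrullDim_eq_height p L] at h1
    exact_mod_cast h1
  have hmem : ∀ i, ((t.equivFin.symm i : t) : L) ∈ maximalIdeal L := fun i => by
    rw [← hspan]
    exact Submodule.subset_span (t.equivFin.symm i).2
  have hsurj : ∀ i, ∃ c : C × p.primeCompl,
      ((t.equivFin.symm i : t) : L) * algebraMap C L c.2 = algebraMap C L c.1 := fun i =>
    IsLocalization.surj p.primeCompl _
  choose c hc using hsurj
  refine ⟨t.card, hcard, fun i => (c i).1, fun i => ?_, fun b hb => ?_⟩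
  · rw [← IsLocalization.AtPrime.to_map_mem_maximal_iff L p, ← hc i]
    exact Ideal.mul_mem_right _ _ (hmem i)
  · have h1 : algebraMap C L b ∈ (Ideal.span (Set.range fun i => (c i).1)).map
        (algebraMap C L) := by
      have h2 : algebraMap C L b ∈ maximalIdeal L :=
        (IsLocalization.AtPrime.to_map_mem_maximal_iff L p b).2 hb
      rw [← hspan] at h2
      refine (Submodule.span_le.2 fun z hz => ?_) h2
      have h3 := hc (t.equivFin ⟨z, hz⟩)
      rw [Equiv.symm_apply_apply] at h3
      rw [SetLike.mem_coe, ← Ideal.mul_unit_mem_iff_mem _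
        (IsLocalization.map_units L (c (t.equivFin ⟨z, hz⟩)).2), h3]
      exact Ideal.mem_map_of_mem _ (Ideal.subset_span ⟨_, rfl⟩)
    obtain ⟨σ, hσ, h⟩ := (IsLocalization.algebraMap_mem_map_algebraMap_iff p.primeCompl L _ _).1 h1
    exact ⟨σ, hσ, h⟩

/-- Suppose that the prime `P` of `B` is locally generated by a prime `Q` and an element `T`, and
that elements `g i` of `Q` form with `T` part of a regular system of parameters at `P`. Then `Q` is
locally generated by the `g i` and further elements, at most `height Q` in total. -/
theorem exists_local_generators_extending {B : Type*} [CommRing B] [IsNoetherianRing B]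
    {P Q J : Ideal B} [hP : P.IsPrime] [hQ : Q.IsPrime] (hQP : Q ≤ P) {ι : Type} [Fintype ι] {T : B}
    {g : ι → B} (hTP : T ∈ P) (hTQ : T ∉ Q) (hgQ : ∀ i, g i ∈ Q)
    (hJ : Ideal.span (insert T (Set.range g)) = J) [IsRegularRing (B ⧸ J)]
    (hht : (P.map (Ideal.Quotient.mk J)).height + (Fintype.card ι + 1) ≤ P.height)
    (hloc : ∀ f ∈ P, ∃ σ ∉ P, ∃ h, σ * f - T * h ∈ Q) {m : ℕ} (hm : Q.height ≤ m) :
    ∃ (k : ℕ) (f : Fin k → B), (∀ i, f i ∈ Q) ∧ Fintype.card ι + k ≤ m ∧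
      ∀ q ∈ Q, ∃ σ ∉ P, σ * q ∈ Ideal.span (Set.range (Sum.elim g f)) := by
  classical
  have hJP : J ≤ P := by
    rw [← hJ, Ideal.span_le, Set.insert_subset_iff]
    refine ⟨hTP, ?_⟩
    rintro _ ⟨i, rfl⟩
    exact hQP (hgQ i)
  have hP' : (P.map (Ideal.Quotient.mk J)).IsPrime := Ideal.isPrime_map_quotientMk_of_isPrime hJP
  have hPcomap : ∀ b, Ideal.Quotient.mk J b ∈ P.map (Ideal.Quotient.mk J) ↔ b ∈ P := fun b => by
    rw [Ideal.mem_quotient_iff_mem hJP]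
  obtain ⟨k, hk, y, hy, hygen⟩ := exists_local_generators (P.map (Ideal.Quotient.mk J))
  choose y' hy' using fun i => Ideal.Quotient.mk_surjective (y i)
  have hy'P : ∀ i, y' i ∈ P := fun i => (hPcomap _).1 (by rw [hy']; exact hy i)
  choose σ hσ h hf using fun i => hloc (y' i) (hy'P i)
  -- Lifts of local generators of `P / J`, moved into `Q` by a multiple of `T` after scaling by an
  -- element outside `P`. With `T` and the `g i` they still generate the maximal ideal at `P`.
  set f : Fin k → B := fun i => σ i * y' i - T * h i with hfdef
  let A := Localization.AtPrime P
  let α := algebraMap B A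
  have hunit : ∀ s, s ∉ P → IsUnit (α s) := fun s hs =>
    IsLocalization.map_units A (⟨s, hs⟩ : P.primeCompl)
  let z : Option (ι ⊕ Fin k) → A := fun o => α (o.elim T (Sum.elim g f))
  have hzmem : ∀ o, z o ∈ Ideal.span (Set.range z) := fun o => Ideal.subset_span ⟨o, rfl⟩
  have hspan : Ideal.span (Set.range z) = maximalIdeal A := by
    apply le_antisymm
    · rw [Ideal.span_le]
      rintro _ ⟨o, rfl⟩
      refine (IsLocalization.AtPrime.to_map_mem_maximal_iff A P _).2 ?_
      rcases o with _ | i | i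
      exacts [hTP, hQP (hgQ i), hQP (hf i)]
    · rw [← Localization.AtPrime.map_eq_maximalIdeal, Ideal.map_le_iff_le_comap]
      intro b hb
      rw [Ideal.mem_comap]
      have hJz : J ≤ Ideal.comap α (Ideal.span (Set.range z)) := by
        rw [← hJ, Ideal.span_le, Set.insert_subset_iff]
        refine ⟨hzmem none, ?_⟩
        rintro _ ⟨i, rfl⟩
        exact hzmem (some (Sum.inl i))
      obtain ⟨s, hs, hsb⟩ := hygen _ ((hPcomap b).2 hb)
      obtain ⟨s, rfl⟩ := Ideal.Quotient.mk_surjective s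
      rw [hPcomap] at hs
      obtain ⟨c, hc⟩ := Ideal.mem_span_range_iff_exists_fun.1 hsb
      choose c' hc' using fun i => Ideal.Quotient.mk_surjective (c i)
      have h1 : s * b - ∑ i, c' i * y' i ∈ J := by
        rw [← Ideal.Quotient.eq_zero_iff_mem, map_sub, map_mul, ← hc, map_sum, sub_eq_zero]
        simp only [map_mul, hc', hy']
      have h2 : ∀ i, α (y' i) ∈ Ideal.span (Set.range z) := fun i => by
        rw [← Ideal.unit_mul_mem_iff_mem _ (hunit _ (hσ i)), ← map_mul,
          show σ i * y' i = f i + T * h i by simp [hfdef], map_add, map_mul]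
        exact add_mem (hzmem (some (Sum.inr i))) (Ideal.mul_mem_right _ _ (hzmem none))
      rw [← Ideal.unit_mul_mem_iff_mem _ (hunit _ hs)]
      change α s * α b ∈ _
      rw [← map_mul, show s * b = (s * b - ∑ i, c' i * y' i) + ∑ i, c' i * y' i by ring, map_add,
        map_sum]
      refine add_mem (hJz h1) (sum_mem fun i _ => ?_)
      rw [map_mul]
      exact Ideal.mul_mem_left _ _ (h2 i)
  have hPht : P.height = (maximalIdeal A).height := by
    rw [← IsLocalization.height_under P.primeCompl (maximalIdeal A),
      IsLocalization.AtPrime.under_maximalIdeal A P]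
  -- By `hht` these generators number at most the height of `P`. Dropping `T` leaves `card ι + k`
  -- generators of an ideal `Q'` of at least that height; since `Q'` lies in the extension of `Q`,
  -- this bounds their number by `m`.
  obtain ⟨hprime, hle⟩ := isPrime_span_and_le_height hspan (by
    rw [← hPht]
    refine le_trans ?_ hht
    rw [← hk]
    simp only [Fintype.card_option, Fintype.card_sum, Fintype.card_fin]
    push_cast
    rw [add_comm (Fintype.card ι : ℕ∞), add_assoc]) (Finset.univ.erase none)
  set Q' := Ideal.span (z '' ((Finset.univ.erase none : Finset (Option (ι ⊕ Fin k))) : Set _))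
    with hQ'
  have hrange : z '' ((Finset.univ.erase none : Finset (Option (ι ⊕ Fin k))) : Set _) =
      α '' Set.range (Sum.elim g f) := by
    ext a
    constructor
    · rintro ⟨o | o, ho, rfl⟩
      · simp at ho
      · exact ⟨_, ⟨o, rfl⟩, rfl⟩
    · rintro ⟨_, ⟨o, rfl⟩, rfl⟩
      exact ⟨some o, by simp, rfl⟩
  have hQ'map : Q' = (Ideal.span (Set.range (Sum.elim g f))).map α := by
    rw [Ideal.map_span, hQ', hrange]
  have hdisj : Disjoint (P.primeCompl : Set B) (Q : Set B) :=
    Set.disjoint_left.2 fun a ha hq => ha (hQP hq)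
  have hQA : (Q.map α).IsPrime := IsLocalization.isPrime_of_isPrime_disjoint P.primeCompl A Q hQ hdisj
  have hQAht : (Q.map α).height = Q.height :=
    IsLocalization.height_map_of_disjoint P.primeCompl Q hdisj
  have hTA : α T ∉ Q.map α := fun hT => hTQ (by
    have h1 : T ∈ (Q.map α).under B := hT
    rwa [IsLocalization.under_map_of_isPrime_disjoint P.primeCompl A hQ hdisj] at h1)
  have hQ'le : Q' ≤ Q.map α := by
    rw [hQ'map]
    refine Ideal.map_mono (Ideal.span_le.2 ?_)
    rintro _ ⟨i | i, rfl⟩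
    exacts [hgQ i, hf i]
  -- Nakayama: an element of `Q` is `c T` plus an element of `Q'`; then `c T` lies in `Q`, and so
  -- does `c`, because `T` is not in `Q`.
  have hQAle : Q.map α ≤ Q' := by
    refine Submodule.le_of_le_smul_of_le_jacobson_bot (I := maximalIdeal A)
      (IsNoetherian.noetherian _) (maximalIdeal_le_jacobson _) fun q hq => ?_
    have h1 : q ∈ maximalIdeal A := le_maximalIdeal hQA.ne_top hq
    rw [← hspan] at h1
    obtain ⟨c, hc⟩ := Ideal.mem_span_range_iff_exists_fun.1 h1
    rw [Fintype.sum_option] at hc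
    have h2 : ∑ i, c (some i) * z (some i) ∈ Q' := sum_mem fun i _ =>
      Ideal.mul_mem_left _ _ (Ideal.subset_span ⟨some i, by simp, rfl⟩)
    have h3 : c none * α T ∈ Q.map α := by
      have := sub_mem hq (hQ'le h2)
      rwa [← hc, add_sub_cancel_right] at this
    rw [← hc, add_comm]
    refine add_mem (Submodule.mem_sup_left h2) (Submodule.mem_sup_right ?_)
    change c none * α T ∈ _
    rw [mul_comm, smul_eq_mul]
    exact Ideal.mul_mem_mul ((IsLocalization.AtPrime.to_map_mem_maximal_iff A P T).2 hTP)
      ((hQA.mem_or_mem h3).resolve_right hTA)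
  refine ⟨k, f, hf, ?_, fun q hq => ?_⟩
  · have h1 := hle.trans ((Ideal.height_mono hQ'le).trans (hQAht.le.trans hm))
    rw [Nat.cast_le, Finset.card_erase_of_mem (Finset.mem_univ _), Finset.card_univ,
      Fintype.card_option, Fintype.card_sum, Fintype.card_fin] at h1
    exact h1
  · have h1 : α q ∈ (Ideal.span (Set.range (Sum.elim g f))).map α :=
      hQ'map ▸ hQAle (Ideal.mem_map_of_mem α hq)
    obtain ⟨s, hs, h⟩ := (IsLocalization.algebraMap_mem_map_algebraMap_iff P.primeCompl A _ _).1 h1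
    exact ⟨s, hs, h⟩

end LocalGenerators

/-! ### Heights of ideals in polynomial rings over the base -/

section PolynomialRing

open MvPolynomial

variable {R : Type*} [CommRing R] {ι τ : Type*}

/-- Reduction modulo the ideal `I` of the coefficients, followed by setting a variable to zero. -/
def evalNoneZero (τ : Type*) (I : Ideal R) : MvPolynomial (Option τ) R →+* MvPolynomial τ (R ⧸ I) :=
  eval₂Hom (C.comp (Ideal.Quotient.mk I)) fun o => o.elim 0 X

theorem evalNoneZero_surjective (I : Ideal R) : Function.Surjective (evalNoneZero τ I) := by
  intro p
  induction p using MvPolynomial.induction_on with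
  | C a =>
    obtain ⟨a, rfl⟩ := Ideal.Quotient.mk_surjective a
    exact ⟨C a, by simp [evalNoneZero]⟩
  | add p q hp hq =>
    obtain ⟨p, rfl⟩ := hp
    obtain ⟨q, rfl⟩ := hq
    exact ⟨p + q, map_add _ _ _⟩
  | mul_X p i hp =>
    obtain ⟨p, rfl⟩ := hp
    exact ⟨p * X (some i), by simp [evalNoneZero]⟩

theorem ker_evalNoneZero (x : ι → R) :
    RingHom.ker (evalNoneZero τ (Ideal.span (Set.range x))) =
      Ideal.span (insert (X none) (Set.range fun i => C (x i))) := by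
  set I := Ideal.span (Set.range x) with hI
  set J : Ideal (MvPolynomial (Option τ) R) :=
    Ideal.span (insert (X none) (Set.range fun i => C (x i))) with hJ
  apply le_antisymm
  · let ψ : MvPolynomial τ (R ⧸ I) →+* MvPolynomial (Option τ) R ⧸ J :=
      eval₂Hom (Ideal.Quotient.lift I ((Ideal.Quotient.mk J).comp C) fun a ha => by
        rw [RingHom.comp_apply, Ideal.Quotient.eq_zero_iff_mem]
        have h1 : I ≤ J.comap C := by
          rw [hI, Ideal.span_le]
          rintro _ ⟨i, rfl⟩
          exact Ideal.subset_span (Set.mem_insert_of_mem _ ⟨i, rfl⟩)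
        exact h1 ha) fun i => Ideal.Quotient.mk J (X (some i))
    have hψ : ψ.comp (evalNoneZero τ I) = Ideal.Quotient.mk J := by
      refine MvPolynomial.ringHom_ext (fun a => by simp [ψ, evalNoneZero]) fun o => ?_
      rcases o with _ | i
      · simp only [RingHom.comp_apply, evalNoneZero, eval₂Hom_X', Option.elim, map_zero]
        exact (Ideal.Quotient.eq_zero_iff_mem.2 (Ideal.subset_span (Set.mem_insert _ _))).symm
      · simp [ψ, evalNoneZero]
    intro f hf
    rw [← Ideal.Quotient.eq_zero_iff_mem, ← hψ, RingHom.comp_apply, RingHom.mem_ker.1 hf, map_zero]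
  · rw [hJ, Ideal.span_le, Set.insert_subset_iff]
    refine ⟨by simp [RingHom.mem_ker, evalNoneZero], ?_⟩
    rintro _ ⟨i, rfl⟩
    have : Ideal.Quotient.mk I (x i) = 0 :=
      Ideal.Quotient.eq_zero_iff_mem.2 (Ideal.subset_span ⟨i, rfl⟩)
    simp [RingHom.mem_ker, evalNoneZero, this]

theorem isRegularRing_quotient_ker_evalNoneZero [Finite τ] (I : Ideal R) [IsRegularRing (R ⧸ I)] :
    IsRegularRing (MvPolynomial (Option τ) R ⧸ RingHom.ker (evalNoneZero τ I)) :=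
  IsRegularRing.of_ringEquiv
    (RingHom.quotientKerEquivOfSurjective (evalNoneZero_surjective I)).symm

/-- The parameters are adjoined one at a time, then the distinguished variable; this is a strictly
increasing chain of primes. -/
theorem IsPrimeSystem.card_lt_height_ker [IsDomain R] [Fintype ι] {x : ι → R}
    (hx : IsPrimeSystem x) :
    (Fintype.card ι + 1 : ℕ∞) ≤ (RingHom.ker (evalNoneZero τ (Ideal.span (Set.range x)))).height := by
  classical
  let J : Finset ι → Ideal (MvPolynomial (Option τ) R) := fun s =>
    RingHom.ker (MvPolynomial.map (Ideal.Quotient.mk (Ideal.span (x '' s))))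
  have hmem : ∀ s (f : MvPolynomial (Option τ) R), f ∈ J s ↔ ∀ d, f.coeff d ∈ Ideal.span (x '' s) := by
    intro s f
    simp only [J, RingHom.mem_ker, MvPolynomial.ext_iff, coeff_map, coeff_zero,
      Ideal.Quotient.eq_zero_iff_mem]
  have hprime : ∀ s, (J s).IsPrime := fun s => by
    have := hx.isPrime s
    exact RingHom.ker_isPrime _
  have hJ : ∀ s : Finset ι, (s.card : ℕ∞) ≤ (J s).height := by
    intro s
    induction s using Finset.induction_on with
    | empty => simp
    | insert i s hi ih =>
      have := hprime s
      have := hprime (insert i s)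
      have hlt : J s < J (insert i s) := by
        refine lt_of_le_not_ge (fun f hf => (hmem _ _).2 fun d =>
          Ideal.span_mono (Set.image_mono (by simp)) ((hmem _ _).1 hf d)) fun h => ?_
        have h1 : (C (x i) : MvPolynomial (Option τ) R) ∈ J (insert i s) := by
          have : Ideal.Quotient.mk (Ideal.span (x '' (insert i s : Finset ι))) (x i) = 0 :=
            Ideal.Quotient.eq_zero_iff_mem.2 (Ideal.subset_span ⟨i, by simp, rfl⟩)
          simp [J, RingHom.mem_ker, this]
        have h2 := (hmem _ _).1 (h h1) 0
        rw [coeff_C, if_pos rfl] at h2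
        exact hx.notMem s i hi h2
      rw [Finset.card_insert_of_notMem hi, Nat.cast_add, Nat.cast_one]
      exact (add_le_add_left ih 1).trans (Ideal.height_add_one_le_of_lt_of_isPrime hlt)
  have := hprime Finset.univ
  have := hx.isPrime_span_range
  have hker : (RingHom.ker (evalNoneZero τ (Ideal.span (Set.range x)))).IsPrime :=
    RingHom.ker_isPrime _
  have hlt : J Finset.univ < RingHom.ker (evalNoneZero τ (Ideal.span (Set.range x))) := by
    refine lt_of_le_not_ge (fun f hf => ?_) fun h => ?_
    · have h1 : evalNoneZero τ (Ideal.span (Set.range x)) = (eval₂Hom C fun o => o.elim 0 X).comp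
          (MvPolynomial.map (Ideal.Quotient.mk (Ideal.span (Set.range x)))) :=
        MvPolynomial.ringHom_ext (fun a => by simp [evalNoneZero]) fun o => by simp [evalNoneZero]
      have h2 : MvPolynomial.map (Ideal.Quotient.mk (Ideal.span (Set.range x))) f = 0 := by
        ext d
        have := (hmem _ _).1 hf d
        rw [Finset.coe_univ, Set.image_univ] at this
        rw [coeff_map, coeff_zero, Ideal.Quotient.eq_zero_iff_mem]
        exact this
      rw [RingHom.mem_ker, h1, RingHom.comp_apply, h2, map_zero]
    · have h1 : (X none : MvPolynomial (Option τ) R) ∈ J Finset.univ :=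
        h (by simp [RingHom.mem_ker, evalNoneZero])
      have h2 := (hmem _ _).1 h1 (Finsupp.single none 1)
      rw [coeff_X, if_pos rfl] at h2
      exact (hx.isPrime (Finset.univ : Finset ι)).ne_top ((Ideal.eq_top_iff_one _).2 h2)
  have h := (add_le_add_left (hJ Finset.univ) 1).trans (Ideal.height_add_one_le_of_lt_of_isPrime hlt)
  rwa [Finset.card_univ] at h

/-- The ideal of a point with coordinates in the fraction field has height at most the number of
variables. -/
theorem height_ker_aeval_le [IsDomain R] [IsNoetherianRing R] {K : Type*} [Field K] [Algebra R K]
    [IsFractionRing R K] [Fintype τ] (t : τ → K) :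
    (RingHom.ker (aeval (R := R) t)).height ≤ Fintype.card τ := by
  classical
  choose a b hb hab using fun j => IsFractionRing.div_surjective (A := R) (t j)
  have hb0 : ∀ j, algebraMap R K (b j) ≠ 0 := fun j =>
    IsFractionRing.to_map_ne_zero_of_mem_nonZeroDivisors (hb j)
  let F : τ → MvPolynomial τ R := fun j => C (b j) * X j - C (a j)
  have hker : (RingHom.ker (aeval (R := R) t)).IsPrime := RingHom.ker_isPrime _
  have hF : Ideal.span (Set.range F) ≤ RingHom.ker (aeval (R := R) t) := by
    rw [Ideal.span_le]
    rintro _ ⟨j, rfl⟩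
    simp only [F, SetLike.mem_coe, RingHom.mem_ker, map_sub, map_mul, aeval_C, aeval_X]
    rw [← hab j, mul_div_cancel₀ _ (hb0 j), sub_self]
  -- Up to a nonzero constant factor, every polynomial is constant modulo the equations `b_j X_j -
  -- a_j`. So the ideal of the point is minimal over them, and Krull's height theorem bounds its
  -- height.
  have hred : ∀ f : MvPolynomial τ R, ∃ c ≠ 0, ∃ r, C c * f - C r ∈ Ideal.span (Set.range F) := by
    intro f
    induction f using MvPolynomial.induction_on with
    | C r => exact ⟨1, one_ne_zero, r, by simp⟩
    | add p q hp hq =>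
      obtain ⟨c, hc, r, h⟩ := hp
      obtain ⟨c', hc', r', h'⟩ := hq
      refine ⟨c * c', mul_ne_zero hc hc', c' * r + c * r', ?_⟩
      have := add_mem (Ideal.mul_mem_left _ (C c') h) (Ideal.mul_mem_left _ (C c) h')
      convert this using 1
      simp only [C_mul, C_add]
      ring
    | mul_X p j hp =>
      obtain ⟨c, hc, r, h⟩ := hp
      refine ⟨c * b j, mul_ne_zero hc (nonZeroDivisors.ne_zero (hb j)), r * a j, ?_⟩
      have := add_mem (Ideal.mul_mem_left _ (C (b j) * X j) h)
        (Ideal.mul_mem_left _ (C r) (Ideal.subset_span ⟨j, rfl⟩ : F j ∈ Ideal.span (Set.range F)))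
      convert this using 1
      simp only [C_mul, F]
      ring
  have hmin : RingHom.ker (aeval (R := R) t) ∈ (Ideal.span (Set.range F)).minimalPrimes := by
    refine ⟨⟨hker, hF⟩, fun q hq hqle f hf => ?_⟩
    obtain ⟨c, hc, r, h⟩ := hred f
    have h1 := hF h
    rw [RingHom.mem_ker, map_sub, map_mul, RingHom.mem_ker.1 hf, mul_zero, zero_sub, neg_eq_zero,
      aeval_C, FaithfulSMul.algebraMap_eq_zero_iff] at h1
    rw [h1, C_0, sub_zero] at h
    refine (hq.1.mem_or_mem (hq.2 h)).resolve_left fun h2 => hc ?_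
    have h3 := hqle h2
    rwa [RingHom.mem_ker, aeval_C, FaithfulSMul.algebraMap_eq_zero_iff] at h3
  refine (Ideal.height_le_card_of_mem_minimalPrimes_span (Set.finite_range F) hmin).trans ?_
  rw [← Set.image_univ, ← Finset.coe_univ, Nat.cast_le, ← Finset.card_univ,
    ← Set.ncard_coe_finset Finset.univ]
  exact Set.ncard_image_le (Finset.finite_toSet _)

end PolynomialRing

/-! ### Bounding the Fitting ideal by one determinant -/

section Fitting

/-- The zeroth Fitting ideal of a module is generated by the determinant of a square matrix whose
rows generate the relations among a generating family. -/
theorem fittingIdealZero_le_span_det {V M τ : Type*} [CommRing V] [AddCommGroup M] [Module V M]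
    [Fintype τ] [DecidableEq τ] {h : τ → M} (hspan : Submodule.span V (Set.range h) = ⊤)
    {D : Matrix τ τ V} (hD : ∀ c : τ → V, ∑ j, c j • h j = 0 → ∃ y, c = Matrix.vecMul y D) :
    fittingIdealZero V M ≤ Ideal.span {D.det} := by
  rw [fittingIdealZero, Ideal.span_le]
  rintro _ ⟨n, g, C, hg, hC, rfl⟩
  have hP : ∀ i, ∃ p : τ → V, ∑ j, p j • h j = g i := fun i =>
    (Submodule.mem_span_range_iff_exists_fun V).1 (hspan ▸ Submodule.mem_top)
  have hQ : ∀ i, ∃ q : Fin n → V, ∑ j, q j • g j = h i := fun i =>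
    (Submodule.mem_span_range_iff_exists_fun V).1 (hg ▸ Submodule.mem_top)
  choose P hP using hP
  choose Q hQ using hQ
  let P' : Matrix (Fin n) τ V := Matrix.of P
  let Q' : Matrix τ (Fin n) V := Matrix.of Q
  have hmul : ∀ c : Fin n → V, ∑ j, Matrix.vecMul c P' j • h j = ∑ i, c i • g i := fun c => by
    simp only [Matrix.vecMul, dotProduct, Finset.sum_smul]
    rw [Finset.sum_comm]
    refine Finset.sum_congr rfl fun i _ => ?_
    rw [← hP i, Finset.smul_sum]
    exact Finset.sum_congr rfl fun j _ => mul_smul _ _ _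
  have hX : ∀ i, ∃ y, Matrix.vecMul (C i) P' = Matrix.vecMul y D := fun i =>
    hD _ ((hmul _).trans (hC i))
  have hY : ∀ i, ∃ y, (Pi.single i 1 - Matrix.vecMul (Q i) P' : τ → V) = Matrix.vecMul y D :=
    fun i => hD _ (by
      simp only [Pi.sub_apply, sub_smul, Finset.sum_sub_distrib]
      rw [hmul, hQ, sub_eq_zero, Finset.sum_eq_single i (fun j _ hj => by
        rw [Pi.single_eq_of_ne hj, zero_smul]) (by simp), Pi.single_eq_same, one_smul])
  choose X hX using hX
  choose Y hY using hY
  have hX' : C * P' = Matrix.of X * D := by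
    ext i j
    exact congrFun (hX i) j
  have hY' : 1 - Q' * P' = Matrix.of Y * D := by
    ext i j
    have := congrFun (hY i) j
    rw [Pi.sub_apply, Pi.single_apply] at this
    rw [Matrix.sub_apply, Matrix.one_apply]
    simp only [eq_comm (a := i)]
    exact this
  -- `P'` and `Q'` translate between the two generating families. The rows of `C * P'` and of `1 -
  -- Q' * P'` are relations among the `h j`, so `D` factors out on the right; taking determinants
  -- shows that `D.det` divides `C.det`.
  have h1 : Matrix.fromBlocks C 0 (-Q') 1 * Matrix.fromBlocks 1 P' 0 1 =
      Matrix.fromBlocks C (Matrix.of X) (-Q') (Matrix.of Y) * Matrix.fromBlocks 1 0 0 D := by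
    rw [Matrix.fromBlocks_multiply, Matrix.fromBlocks_multiply]
    simp only [Matrix.mul_one, Matrix.mul_zero, add_zero, zero_add,
      Matrix.neg_mul]
    rw [hX', ← hY', neg_add_eq_sub]
  have h2 := congrArg Matrix.det h1
  rw [Matrix.det_mul, Matrix.det_mul, Matrix.det_fromBlocks_zero₁₂, Matrix.det_fromBlocks_zero₂₁,
    Matrix.det_fromBlocks_zero₂₁, Matrix.det_one, Matrix.det_one, mul_one, mul_one,
    mul_one, one_mul] at h2
  rw [SetLike.mem_coe, h2]
  exact Ideal.mul_mem_left _ _ (Ideal.subset_span rfl)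

end Fitting

/-! ### Relations among differentials come from gradients of equations -/

section Gradient

open MvPolynomial

variable {R V τ : Type*} [CommRing R] [CommRing V] [Algebra R V]

/-- The gradient of a polynomial at a point. -/
def grad (t : τ → V) (f : MvPolynomial τ R) : τ → V := fun j => aeval t (pderiv j f)

theorem grad_add (t : τ → V) (f g : MvPolynomial τ R) :
    grad t (f + g) = grad t f + grad t g := by
  ext j
  simp [grad]

theorem grad_sub (t : τ → V) (f g : MvPolynomial τ R) :
    grad t (f - g) = grad t f - grad t g := by
  ext j
  simp [grad]

theorem grad_zero (t : τ → V) : grad t (0 : MvPolynomial τ R) = 0 := by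
  ext j
  simp [grad]

theorem grad_one (t : τ → V) : grad t (1 : MvPolynomial τ R) = 0 := by
  ext j
  simp [grad]

theorem grad_C (t : τ → V) (r : R) : grad t (C r : MvPolynomial τ R) = 0 := by
  ext j
  simp [grad]

theorem grad_X [DecidableEq τ] (t : τ → V) (i : τ) :
    grad t (X i : MvPolynomial τ R) = Pi.single i 1 := by
  ext j
  rw [grad, pderiv_X, Pi.single_apply, Pi.single_apply]
  split_ifs <;> simp_all

theorem grad_mul (t : τ → V) (f g : MvPolynomial τ R) :
    grad t (f * g) = aeval t f • grad t g + aeval t g • grad t f := by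
  ext j
  simp [grad, Derivation.leibniz]

/-- Relations among differentials of coordinates are generated by the gradients of local equations
of the image. -/
theorem exists_vecMul_grad [Fintype τ] {t : τ → V}
    (hrep : ∀ z : V, ∃ h σ : MvPolynomial τ R, IsUnit (aeval t σ) ∧ z * aeval t σ = aeval t h)
    {κ : Type*} [Fintype κ] {f : κ → MvPolynomial τ R} (hf0 : ∀ i, aeval t (f i) = 0)
    (hf : ∀ q : MvPolynomial τ R, aeval t q = 0 → ∃ σ : MvPolynomial τ R, IsUnit (aeval t σ) ∧
      σ * q ∈ Ideal.span (Set.range f))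
    {c : τ → V} (hc : ∑ j, c j • KaehlerDifferential.D R V (t j) = 0) :
    ∃ y : κ → V, c = Matrix.vecMul y (Matrix.of fun i => grad t (f i)) := by
  classical
  let N : Submodule V (τ → V) := Submodule.span V (Set.range fun i => grad t (f i))
  have hN : ∀ q : MvPolynomial τ R, aeval t q = 0 → grad t q ∈ N := by
    intro q hq
    obtain ⟨σ, hσ, hσq⟩ := hf q hq
    obtain ⟨a, ha⟩ := Ideal.mem_span_range_iff_exists_fun.1 hσq
    have h1 : ∀ s : Finset κ, grad t (∑ i ∈ s, a i * f i) ∈ N := by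
      intro s
      induction s using Finset.induction_on with
      | empty => rw [Finset.sum_empty, grad_zero]; exact N.zero_mem
      | insert i s hi ih =>
        rw [Finset.sum_insert hi, grad_add, grad_mul, hf0, zero_smul, add_zero]
        exact N.add_mem (N.smul_mem _ (Submodule.subset_span ⟨i, rfl⟩)) ih
    have h2 := h1 Finset.univ
    rw [ha, grad_mul, hq, zero_smul, add_zero] at h2
    obtain ⟨u, hu⟩ := hσ
    have h3 := N.smul_mem (↑u⁻¹ : V) h2
    rwa [← hu, smul_smul, Units.inv_mul, one_smul] at h3
  choose h σ hσ hhσ using hrep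
  -- The quotient rule applied to a fraction `h / σ` representing `z`. Modulo gradients of equations
  -- it is independent of the fraction (`key`), so it defines a derivation sending `t j` to the
  -- `j`-th basis vector; applied to `hc`, it puts `c` in `N`.
  let d : V → (τ → V) ⧸ N := fun z =>
    (↑(hσ z).unit⁻¹ : V) • N.mkQ (grad t (h z) - z • grad t (σ z))
  have key : ∀ z (s p : MvPolynomial τ R), z * aeval t s = aeval t p →
      aeval t s • d z = N.mkQ (grad t p - z • grad t s) := by
    intro z s p hsp
    have h1 : grad t (s * h z - p * σ z) ∈ N := hN _ (by
      rw [map_sub, map_mul, map_mul, ← hhσ, ← hsp]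
      ring)
    have h2 : aeval t s • N.mkQ (grad t (h z) - z • grad t (σ z)) =
        aeval t (σ z) • N.mkQ (grad t p - z • grad t s) := by
      rw [← map_smul, ← map_smul, ← sub_eq_zero, ← map_sub, Submodule.mkQ_apply,
        Submodule.Quotient.mk_eq_zero]
      convert h1 using 1
      rw [grad_sub, grad_mul, grad_mul, ← hhσ, ← hsp]
      module
    rw [smul_comm, h2, smul_smul, IsUnit.val_inv_mul, one_smul]
  have hadd : ∀ z z', d (z + z') = d z + d z' := by
    intro z z'
    have hu : IsUnit (aeval t (σ z * σ z')) := by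
      rw [map_mul]
      exact (hσ z).mul (hσ z')
    refine hu.smul_left_cancel.1 ?_
    rw [smul_add, key z _ (h z * σ z') (by rw [map_mul, map_mul, ← hhσ]; ring),
      key z' _ (h z' * σ z) (by rw [map_mul, map_mul, ← hhσ]; ring),
      key (z + z') _ (h z * σ z' + h z' * σ z)
        (by rw [map_mul, map_add, map_mul, map_mul, ← hhσ, ← hhσ]; ring), ← map_add, grad_add]
    congr 1
    module
  have hmul : ∀ z z', d (z * z') = z • d z' + z' • d z := by
    intro z z'
    have hu : IsUnit (aeval t (σ z * σ z')) := by
      rw [map_mul]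
      exact (hσ z).mul (hσ z')
    refine hu.smul_left_cancel.1 ?_
    have h1 := key z _ _ (hhσ z)
    have h2 := key z' _ _ (hhσ z')
    have h3 : aeval t (σ z * σ z') • (z • d z' + z' • d z) =
        (z * aeval t (σ z)) • (aeval t (σ z') • d z') +
          (z' * aeval t (σ z')) • (aeval t (σ z) • d z) := by
      rw [map_mul]
      module
    rw [h3, h1, h2, key (z * z') _ (h z * h z')
      (by rw [map_mul, map_mul, ← hhσ, ← hhσ]; ring), ← map_smul, ← map_smul, ← map_add]
    congr 1
    rw [grad_mul, grad_mul, ← hhσ, ← hhσ]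
    module
  have halg : ∀ r : R, d (algebraMap R V r) = 0 := by
    intro r
    have h1 := key (algebraMap R V r) 1 (C r) (by simp)
    rwa [grad_C, grad_one, map_one, one_smul, smul_zero, sub_zero, map_zero] at h1
  let δ : Derivation R V ((τ → V) ⧸ N) := Derivation.mk'
    { toFun := d
      map_add' := hadd
      map_smul' := fun r z => by
        rw [RingHom.id_apply, Algebra.smul_def, hmul, halg, smul_zero, add_zero, algebraMap_smul] }
    hmul
  have hδ : ∀ j, δ (t j) = N.mkQ (Pi.single j 1) := by
    intro j
    have h1 := key (t j) 1 (X j) (by simp)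
    rwa [grad_X, grad_one, map_one, one_smul, smul_zero, sub_zero] at h1
  have h1 := congrArg δ.liftKaehlerDifferential hc
  rw [map_zero, map_sum] at h1
  simp only [map_smul, Derivation.liftKaehlerDifferential_comp_D, hδ] at h1
  have h2 : N.mkQ c = 0 := by
    rw [← h1]
    simp only [← map_smul]
    rw [← map_sum]
    congr 1
    ext j
    simp [Finset.sum_apply, Pi.single_apply]
  rw [Submodule.mkQ_apply, Submodule.Quotient.mk_eq_zero] at h2
  obtain ⟨y, hy⟩ := (Submodule.mem_span_range_iff_exists_fun V).1 h2
  refine ⟨y, ?_⟩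
  ext j
  rw [← hy]
  simp [Matrix.vecMul, dotProduct]

end Gradient

/-! ### Lower bound for the Jacobian ideal, in terms of divisibility -/

section LowerBound

open MvPolynomial IsLocalRing

/-- A determinant is divisible by the product of common divisors of its rows. -/
theorem prod_dvd_det {A n : Type*} [CommRing A] [Fintype n] [DecidableEq n] {c : n → A}
    {M : Matrix n n A} (h : ∀ i j, c i ∣ M i j) : ∏ i, c i ∣ M.det := by
  choose N hN using h
  have h1 : M = Matrix.of fun i j => c i * N i j := by
    ext i j
    exact hN i j
  rw [h1]
  exact ⟨_, Matrix.det_mul_column c (Matrix.of N)⟩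

/-- The logarithmic differential of the relation `x = u π ^ a` is divisible by `π ^ a`. -/
theorem pow_dvd_grad {R V τ : Type*} [CommRing R] [CommRing V] [Algebra R V] [DecidableEq τ]
    (t : Option τ → V) (r : R) (i : τ) (a : ℕ) (j : Option τ) :
    t none ^ a ∣ (if j = none then t none else 1) *
      grad t (C r - X (some i) * X none ^ a : MvPolynomial (Option τ) R) j := by
  rw [grad_sub, grad_C, zero_sub, grad_mul, Pi.neg_apply, mul_neg, dvd_neg, Pi.add_apply, mul_add,
    Pi.smul_apply, Pi.smul_apply, map_pow, aeval_X, aeval_X, smul_eq_mul, smul_eq_mul]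
  refine dvd_add ?_ ?_
  · rw [grad, Derivation.leibniz_pow, pderiv_X]
    by_cases hj : j = none
    · subst hj
      rcases a with _ | a
      · simp
      · refine Dvd.intro_left (t (some i) * (a + 1)) ?_
        simp
        ring
    · rw [Pi.single_eq_of_ne (Ne.symm hj)]
      simp
  · exact Dvd.dvd.mul_left (Dvd.intro _ rfl) _

variable {R V K : Type*} [CommRing R] [IsDomain R] [IsRegularRing R] [CommRing V] [IsDomain V]
  [IsLocalRing V] [Algebra R V] [Field K] [Algebra R K] [IsFractionRing R K] [Algebra V K]
  [IsScalarTower R V K]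

/-- The elements of the Jacobian ideal of a discrete valuation ring that is essentially of finite
type and birational over a regular domain are at least as divisible as the logarithmic
Jacobian of a system of parameters predicts. -/
theorem IsPrimeSystem.pow_dvd_mul_of_mem_jacobianIdeal
    (hVK : Function.Injective (algebraMap V K)) {ι : Type} [Fintype ι] {x : ι → R}
    (hx : IsPrimeSystem x) [IsRegularRing (R ⧸ Ideal.span (Set.range x))]
    [Algebra.EssFiniteType R V] {π : V} (hπ : maximalIdeal V = Ideal.span {π}) (hπ0 : π ≠ 0)
    {a : ι → ℕ} (ha : ∀ i, 0 < a i) {u : ι → V} (hu : ∀ i, u i * π ^ a i = algebraMap R V (x i))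
    {c : V} (hc : c ∈ jacobianIdeal R V) : π ^ ∑ i, a i ∣ π * c := by
  classical
  obtain ⟨S, hS⟩ := (Algebra.essFiniteType_iff R V).1 inferInstance
  let t : Option (ι ⊕ Fin S.card) → V := fun o =>
    o.elim π (Sum.elim u fun i => (S.equivFin.symm i : V))
  have htS : (S : Set V) ⊆ Set.range t := fun s hs =>
    ⟨some (Sum.inr (S.equivFin ⟨s, hs⟩)), by simp [t]⟩
  have hadj : Algebra.adjoin R (S : Set V) ≤ (aeval (R := R) t).range := by
    rw [← Algebra.adjoin_range_eq_range_aeval]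
    exact Algebra.adjoin_mono htS
  have hrep : ∀ z : V, ∃ h σ : MvPolynomial (Option (ι ⊕ Fin S.card)) R,
      IsUnit (aeval t σ) ∧ z * aeval t σ = aeval t h := by
    intro z
    obtain ⟨s, hs, hsu, hzs⟩ := hS z
    obtain ⟨σ, rfl⟩ := hadj hs
    obtain ⟨h, hh⟩ := hadj hzs
    exact ⟨h, σ, hsu, hh.symm⟩
  let Q : Ideal (MvPolynomial (Option (ι ⊕ Fin S.card)) R) := RingHom.ker (aeval (R := R) t)
  let P : Ideal (MvPolynomial (Option (ι ⊕ Fin S.card)) R) :=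
    (maximalIdeal V).comap (aeval (R := R) t)
  let T : MvPolynomial (Option (ι ⊕ Fin S.card)) R := X none
  let g : ι → MvPolynomial (Option (ι ⊕ Fin S.card)) R := fun i =>
    C (x i) - X (some (Sum.inl i)) * X none ^ a i
  have hQ : Q.IsPrime := RingHom.ker_isPrime _
  have hP : P.IsPrime := Ideal.IsPrime.comap _
  have hmemQ : ∀ f, f ∈ Q ↔ aeval t f = 0 := fun f => RingHom.mem_ker
  have hmemP : ∀ f, f ∉ P ↔ IsUnit (aeval t f) := fun f => by
    rw [Ideal.mem_comap, mem_maximalIdeal, mem_nonunits_iff, not_not]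
  have hπmem : π ∈ maximalIdeal V := hπ ▸ Ideal.mem_span_singleton_self π
  have hQP : Q ≤ P := fun f hf => by
    rw [Ideal.mem_comap]
    have : aeval t f = 0 := hf
    change aeval t f ∈ maximalIdeal V
    rw [this]
    exact zero_mem _
  have hTt : aeval t T = π := by simp [T, t]
  have hTP : T ∈ P := by
    change aeval t T ∈ maximalIdeal V
    rwa [hTt]
  have hTQ : T ∉ Q := fun h => hπ0 (by rw [← hTt]; exact h)
  have hgQ : ∀ i, g i ∈ Q := fun i => by
    rw [hmemQ]
    simp [g, t, hu]
  -- As `a i > 0`, modulo `T` the equation `g i` is just `x i`. The quotient is thus a polynomial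
  -- ring over `R / (x)`, which is regular.
  have hJ : Ideal.span (insert T (Set.range g)) =
      RingHom.ker (evalNoneZero (ι ⊕ Fin S.card) (Ideal.span (Set.range x))) := by
    rw [ker_evalNoneZero]
    have hpow : ∀ (I : Ideal (MvPolynomial (Option (ι ⊕ Fin S.card)) R)) (i : ι), T ∈ I →
        (X (some (Sum.inl i)) * X none ^ a i : MvPolynomial (Option (ι ⊕ Fin S.card)) R) ∈ I :=
      fun I i hI => I.mul_mem_left _ (I.pow_mem_of_mem hI _ (ha i))
    have hTmem : ∀ s : Set (MvPolynomial (Option (ι ⊕ Fin S.card)) R),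
        T ∈ Ideal.span (insert T s) := fun s => Ideal.subset_span (Set.mem_insert _ _)
    apply le_antisymm
    · rw [Ideal.span_le, Set.insert_subset_iff]
      refine ⟨hTmem _, ?_⟩
      rintro _ ⟨i, rfl⟩
      exact sub_mem (Ideal.subset_span (Set.mem_insert_of_mem _ ⟨i, rfl⟩)) (hpow _ i (hTmem _))
    · rw [Ideal.span_le, Set.insert_subset_iff]
      refine ⟨hTmem _, ?_⟩
      rintro _ ⟨i, rfl⟩
      have h1 : g i ∈ Ideal.span (insert T (Set.range g)) :=
        Ideal.subset_span (Set.mem_insert_of_mem _ ⟨i, rfl⟩)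
      have h2 := add_mem h1 (hpow _ i (hTmem _))
      rwa [sub_add_cancel] at h2
  set J := RingHom.ker (evalNoneZero (ι ⊕ Fin S.card) (Ideal.span (Set.range x))) with hJdef
  have hxprime := hx.isPrime_span_range
  have hJprime : J.IsPrime := RingHom.ker_isPrime _
  have hJP : J ≤ P := by
    rw [← hJ, Ideal.span_le, Set.insert_subset_iff]
    refine ⟨hTP, ?_⟩
    rintro _ ⟨i, rfl⟩
    exact hQP (hgQ i)
  have hJreg : IsRegularRing (MvPolynomial (Option (ι ⊕ Fin S.card)) R ⧸ J) :=
    isRegularRing_quotient_ker_evalNoneZero _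
  have hht : (P.map (Ideal.Quotient.mk J)).height + (Fintype.card ι + 1) ≤ P.height := by
    have hP' : (P.map (Ideal.Quotient.mk J)).IsPrime := Ideal.isPrime_map_quotientMk_of_isPrime hJP
    have h1 := height_map_mk_add_le (P.map (Ideal.Quotient.mk J))
    rw [Ideal.comap_map_mk hJP] at h1
    exact (add_le_add_right hx.card_lt_height_ker _).trans h1
  have hloc : ∀ f ∈ P, ∃ σ ∉ P, ∃ h, σ * f - T * h ∈ Q := by
    intro f hf
    have h1 : aeval t f ∈ maximalIdeal V := hf
    rw [hπ, Ideal.mem_span_singleton] at h1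
    obtain ⟨z, hz⟩ := h1
    obtain ⟨h, σ, hσ, hh⟩ := hrep z
    refine ⟨σ, (hmemP σ).2 hσ, h, ?_⟩
    rw [hmemQ, map_sub, map_mul, map_mul, hTt, hz, ← hh]
    ring
  -- Birationality enters here: the generators of `V` are the coordinates of a point over the
  -- fraction field of `R`.
  have hm : Q.height ≤ (Fintype.card (Option (ι ⊕ Fin S.card)) : ℕ) := by
    have h1 : Q = RingHom.ker (aeval (R := R) fun o => algebraMap V K (t o)) := by
      ext f
      rw [hmemQ, RingHom.mem_ker, ← Function.comp_def, aeval_algebraMap_apply,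
        map_eq_zero_iff _ hVK]
    rw [h1]
    exact height_ker_aeval_le _
  obtain ⟨k, f, hfQ, hk, hgen⟩ :=
    exists_local_generators_extending hQP hTP hTQ hgQ hJ hht hloc hm
  obtain ⟨l, hl⟩ := Nat.exists_eq_add_of_le hk
  -- Zero equations pad the system to as many equations as variables, so that the matrix of
  -- gradients is square.
  let e : Option (ι ⊕ Fin S.card) ≃ (ι ⊕ Fin k) ⊕ Fin l :=
    Fintype.equivOfCardEq (by
      rw [hl, Fintype.card_sum, Fintype.card_sum, Fintype.card_fin, Fintype.card_fin])
  let F : Option (ι ⊕ Fin S.card) → MvPolynomial (Option (ι ⊕ Fin S.card)) R :=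
    Sum.elim (Sum.elim g f) (fun _ => 0) ∘ e
  let D : Matrix (Option (ι ⊕ Fin S.card)) (Option (ι ⊕ Fin S.card)) V :=
    Matrix.of fun i => grad t (F i)
  have hF0 : ∀ i, aeval t (F i) = 0 := by
    intro i
    simp only [F, Function.comp_apply]
    rcases e i with (i | i) | i
    exacts [hgQ i, hfQ i, map_zero _]
  have hFgen : ∀ q : MvPolynomial (Option (ι ⊕ Fin S.card)) R, aeval t q = 0 →
      ∃ σ : MvPolynomial (Option (ι ⊕ Fin S.card)) R, IsUnit (aeval t σ) ∧
        σ * q ∈ Ideal.span (Set.range F) := by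
    intro q hq
    obtain ⟨σ, hσ, h⟩ := hgen q hq
    refine ⟨σ, (hmemP σ).1 hσ, Ideal.span_mono ?_ h⟩
    rintro _ ⟨i, rfl⟩
    exact ⟨e.symm (Sum.inl i), by simp [F]⟩
  have hspan : Submodule.span V (Set.range fun j => KaehlerDifferential.D R V (t j)) = ⊤ := by
    refine span_D_eq_top hS fun s hs => ?_
    obtain ⟨j, rfl⟩ := htS hs
    exact Submodule.subset_span ⟨j, rfl⟩
  have hcD : D.det ∣ c := Ideal.mem_span_singleton.1
    (fittingIdealZero_le_span_det hspan (fun c hc => exists_vecMul_grad hrep hF0 hFgen hc) hc)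
  refine dvd_trans ?_ (mul_dvd_mul_left π hcD)
  -- Scaling the column of the uniformizer by `π` costs one factor `π` and makes each row coming
  -- from `g i` divisible by `π ^ a i`. This is the source of the `-1` in the bound.
  have hdet : π * D.det = (D * Matrix.diagonal fun j => if j = none then π else 1).det := by
    rw [Matrix.det_mul, Matrix.det_diagonal, Finset.prod_ite_eq' Finset.univ none fun _ => π,
      if_pos (Finset.mem_univ _), mul_comm]
  have hprod : ∏ i, (Sum.elim (Sum.elim (fun i => π ^ a i) fun _ => 1) (fun _ => 1) ∘ e) i =
      π ^ ∑ i, a i := by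
    rw [← Finset.prod_pow_eq_pow_sum]
    simp only [Function.comp_apply]
    rw [e.prod_comp, Fintype.prod_sum_type, Fintype.prod_sum_type]
    simp
  rw [hdet, ← hprod]
  refine prod_dvd_det fun i j => ?_
  rw [Matrix.mul_diagonal, mul_comm]
  simp only [D, F, Matrix.of_apply, Function.comp_apply]
  rcases e i with (i | i) | i
  · exact pow_dvd_grad t (x i) (Sum.inl i) (a i) j
  · exact one_dvd _
  · exact one_dvd _

end LowerBound

/-! ### Lower bound for the value of the Jacobian ideal -/

section Valuations

open IsLocalRing

variable {R : Type*} [CommRing R] {K : Type*} [Field K] [Algebra R K]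

theorem isLocalRing_valuationSubalgebra (v : AddValuation K (WithTop ℤ))
    (hv : ∀ r : R, 0 ≤ v (algebraMap R K r)) : IsLocalRing (valuationSubalgebra v hv) := by
  refine IsLocalRing.of_nonunits_add fun a b ha hb => ?_
  rw [mem_nonunits_iff, isUnit_valuationSubalgebra_iff] at *
  have h : ∀ z : valuationSubalgebra v hv, v (z : K) ≠ 0 → 0 < v (z : K) := fun z hz =>
    lt_of_le_of_ne z.2 (Ne.symm hz)
  exact (lt_of_lt_of_le (lt_min (h a ha) (h b hb)) (v.map_add _ _)).ne'

theorem dvd_valuationSubalgebra_iff {v : AddValuation K (WithTop ℤ)}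
    {hv : ∀ r : R, 0 ≤ v (algebraMap R K r)} {a b : valuationSubalgebra v hv} (ha : (a : K) ≠ 0) :
    a ∣ b ↔ v (a : K) ≤ v (b : K) := by
  constructor
  · rintro ⟨c, rfl⟩
    rw [Subalgebra.coe_mul, v.map_mul]
    exact le_add_of_nonneg_right c.2
  · intro h
    obtain ⟨n, hn⟩ := exists_coe_of_ne_zero v ha
    have hba : (b : K) / a * a = b := div_mul_cancel₀ _ ha
    have h1 : 0 ≤ v ((b : K) / a) := by
      by_cases h0 : (b : K) / a = 0
      · rw [h0, v.map_zero]
        exact le_top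
      · obtain ⟨m, hm⟩ := exists_coe_of_ne_zero v h0
        rw [← hba, v.map_mul, hn, hm, ← WithTop.coe_add, WithTop.coe_le_coe] at h
        rw [hm, ← WithTop.coe_zero, WithTop.coe_le_coe]
        omega
    exact ⟨⟨_, mem_valuationSubalgebra.2 h1⟩, Subtype.ext ((mul_comm _ _).trans hba).symm⟩

theorem maximalIdeal_valuationSubalgebra {v : AddValuation K (WithTop ℤ)}
    {hv : ∀ r : R, 0 ≤ v (algebraMap R K r)} [IsLocalRing (valuationSubalgebra v hv)]
    {π : valuationSubalgebra v hv} (hπ : v (π : K) = 1) :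
    maximalIdeal (valuationSubalgebra v hv) = Ideal.span {π} := by
  have hπ0 : (π : K) ≠ 0 := fun h => by simp [h] at hπ
  ext z
  rw [mem_maximalIdeal, mem_nonunits_iff, isUnit_valuationSubalgebra_iff,
    Ideal.mem_span_singleton, dvd_valuationSubalgebra_iff hπ0, hπ]
  have hz : 0 ≤ v (z : K) := z.2
  cases h : v (z : K) with
  | top => simp
  | coe n =>
    rw [h, ← WithTop.coe_zero, WithTop.coe_le_coe] at hz
    rw [← WithTop.coe_zero, ← WithTop.coe_one, WithTop.coe_le_coe, WithTop.coe_inj]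
    omega

/-- Lower bound for the value of the Jacobian ideal of a birational discrete valuation ring. -/
theorem IsPrimeSystem.sum_sub_one_le_idealValue [IsDomain R] [IsRegularRing R]
    [IsFractionRing R K] {ι : Type} [Fintype ι] {x : ι → R}
    (hx : IsPrimeSystem x) [IsRegularRing (R ⧸ Ideal.span (Set.range x))]
    {v : AddValuation K (WithTop ℤ)} (hv : ∀ r : R, 0 ≤ v (algebraMap R K r))
    [Algebra.EssFiniteType R (valuationSubalgebra v hv)] {ϖ : K} (hϖ : v ϖ = 1)
    {a : ι → ℕ} (ha : ∀ i, 0 < a i) (hxa : ∀ i, v (algebraMap R K (x i)) = (a i : ℤ)) :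
    ((∑ i, (a i : ℤ) - 1 : ℤ) : WithTop ℤ) ≤
      idealValue v (jacobianIdeal R (valuationSubalgebra v hv)) := by
  have := isLocalRing_valuationSubalgebra v hv
  have hϖ0 : ϖ ≠ 0 := fun h => by simp [h] at hϖ
  let π : valuationSubalgebra v hv := ⟨ϖ, mem_valuationSubalgebra.2 (by rw [hϖ]; exact zero_le_one)⟩
  have hπ0 : ∀ n, ((π ^ n : valuationSubalgebra v hv) : K) ≠ 0 := fun n => by
    simpa [π] using fun h => absurd h hϖ0
  have hpow : ∀ n : ℕ, v ((π ^ n : valuationSubalgebra v hv) : K) = (n : ℤ) := fun n => by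
    rw [Subalgebra.coe_pow, v.map_pow]
    change n • v ϖ = _
    rw [hϖ]
    simp
  have hdvd : ∀ i, π ^ a i ∣ algebraMap R (valuationSubalgebra v hv) (x i) := fun i => by
    rw [dvd_valuationSubalgebra_iff (hπ0 _), hpow, ← hxa]
    exact le_rfl
  choose u hu using hdvd
  refine (isGLB_idealValue v (fun a : valuationSubalgebra v hv => a.2) _).2 ?_
  rintro _ ⟨c, hc, rfl⟩
  have h := hx.pow_dvd_mul_of_mem_jacobianIdeal (K := K) Subtype.val_injective
    (maximalIdeal_valuationSubalgebra (π := π) hϖ) (fun h => hϖ0 (congrArg Subtype.val h)) ha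
    (fun i => (mul_comm _ _).trans (hu i).symm) hc
  rw [dvd_valuationSubalgebra_iff (hπ0 _), hpow, Subalgebra.coe_mul, v.map_mul] at h
  change _ ≤ v ϖ + _ at h
  change _ ≤ v (c : K)
  rw [hϖ] at h
  cases hc : v (c : K) with
  | top => exact le_top
  | coe n =>
    rw [hc, ← WithTop.coe_one, ← WithTop.coe_add, WithTop.coe_le_coe] at h
    rw [WithTop.coe_le_coe]
    push_cast at h
    omega

end Valuations

/-! ### Parameter systems and finite generation of monomial ideals -/

section Systems

variable {R : Type*} [CommRing R] {d : ℕ} {x : Fin d → R}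

/-- Primality is part of the definition. For the other condition, permute `x i` to the end: it is a
non-zerodivisor modulo the remaining parameters, so lying in their span would make that span the
unit ideal. -/
theorem IsGenRegularSystem.isPrimeSystem (hx : IsGenRegularSystem x) : IsPrimeSystem x where
  isPrime t := (Ideal.Quotient.isDomain_iff_prime _).1 (hx.isDomain_quotient t)
  notMem t i hi h := by
    obtain ⟨n, rfl⟩ : ∃ n, d = n + 1 := ⟨d - 1, by have := i.2; omega⟩
    let σ : Equiv.Perm (Fin (n + 1)) := Equiv.swap (Fin.last n) i
    have hreg := hx.regular σ
    have hlast : x (σ (Fin.last n)) = x i := by rw [Equiv.swap_apply_left]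
    set l := List.ofFn fun j : Fin n => x (σ j.castSucc) with hl
    have hlist : (List.ofFn fun j => x (σ j)) = l ++ [x i] := by
      rw [List.ofFn_succ', List.concat_eq_append, hlast]
    have hmem : x i ∈ Ideal.ofList l := by
      refine Ideal.span_mono ?_ h
      rintro _ ⟨j, hj, rfl⟩
      have hji : σ j ≠ Fin.last n := fun h' => hi (by
        have h2 : j = σ (Fin.last n) := by rw [← h']; exact (Equiv.swap_apply_self _ _ _).symm
        rw [Equiv.swap_apply_left] at h2
        rwa [← h2])
      refine List.mem_ofFn.2 ⟨(σ j).castPred hji, ?_⟩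
      rw [Fin.castSucc_castPred, Equiv.swap_apply_self]
    rw [hlist] at hreg
    have h1 := ((RingTheory.Sequence.isWeaklyRegular_append_iff R _ _).1 hreg.toIsWeaklyRegular).2
    rw [RingTheory.Sequence.isWeaklyRegular_singleton_iff] at h1
    have hsm : (Ideal.ofList l • ⊤ : Submodule R R) = Ideal.ofList l := by
      rw [smul_eq_mul, Ideal.mul_top]
    have h2 : Submodule.Quotient.mk (p := (Ideal.ofList l • ⊤ : Submodule R R)) 1 = 0 := by
      refine h1 ?_
      change x i • Submodule.Quotient.mk _ = x i • (0 : R ⧸ (Ideal.ofList l • ⊤ : Submodule R R))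
      rw [smul_zero, ← Submodule.Quotient.mk_smul, Submodule.Quotient.mk_eq_zero, hsm, smul_eq_mul,
        mul_one]
      exact hmem
    rw [Submodule.Quotient.mk_eq_zero, hsm] at h2
    refine hreg.top_ne_smul ?_
    rw [smul_eq_mul, Ideal.mul_top, Ideal.ofList_append, (Ideal.eq_top_iff_one _).2 h2, top_sup_eq]

/-- A monomial ideal is generated by finitely many monomials. -/
theorem IsMonomialIdeal.exists_finset {I : Ideal R} (hI : IsMonomialIdeal x I) :
    ∃ A : Finset (Fin d → ℕ), I = Ideal.span (monom x '' A) := by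
  obtain ⟨E, rfl⟩ := hI
  have hfin : {e | Minimal (· ∈ E) e}.Finite :=
    WellQuasiOrderedLE.finite_of_isAntichain (setOfPred_minimal_antichain _)
  refine ⟨hfin.toFinset, le_antisymm ?_ ?_⟩
  · rw [Ideal.span_le]
    rintro _ ⟨e, he, rfl⟩
    obtain ⟨m, hme, hm⟩ := exists_minimal_le_of_wellFoundedLT (· ∈ E) e he
    change monom x e ∈ _
    rw [← tsub_add_cancel_of_le hme, monom_add]
    exact Ideal.mul_mem_left _ _ (Ideal.subset_span ⟨m, hfin.mem_toFinset.2 hm, rfl⟩)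
  · refine Ideal.span_mono ?_
    rintro _ ⟨e, he, rfl⟩
    exact ⟨e, (hfin.mem_toFinset.1 he).prop, rfl⟩

theorem span_monom_mul_span_monom {ι : Type*} [Fintype ι] [DecidableEq ι] (x : ι → R)
    (A B : Finset (ι → ℕ)) : Ideal.span (monom x '' A) * Ideal.span (monom x '' B) =
      Ideal.span (monom x '' (Finset.image₂ (· + ·) A B)) := by
  rw [Ideal.span_mul_span']
  congr 1
  ext r
  simp only [Set.mem_mul, Set.mem_image, Finset.mem_coe, Finset.mem_image₂]
  constructor
  · rintro ⟨_, ⟨a, ha, rfl⟩, _, ⟨b, hb, rfl⟩, rfl⟩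
    exact ⟨a + b, ⟨a, ha, b, hb, rfl⟩, monom_add x a b⟩
  · rintro ⟨_, ⟨a, ha, b, hb, rfl⟩, rfl⟩
    exact ⟨_, ⟨a, ha, rfl⟩, _, ⟨b, hb, rfl⟩, (monom_add x a b).symm⟩

end Systems

/-! ### Primitive weights and restriction to the support of a weight -/

section Weights

variable {ι : Type*} [Fintype ι]

theorem wt_smul (n : ℕ) (w e : ι → ℕ) : wt (n • w) e = n * wt w e := by
  rw [wt, wt, Finset.mul_sum]
  refine Finset.sum_congr rfl fun i _ => ?_
  rw [Pi.smul_apply, smul_eq_mul]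
  ring

theorem wt_one (w : ι → ℕ) : wt w 1 = ∑ i, w i := by simp [wt]

/-- Every weight is a positive multiple of a weight that takes consecutive values. -/
theorem exists_primitive_weight {w : ι → ℕ} (hw : w ≠ 0) :
    ∃ (n : ℕ) (w' : ι → ℕ), 0 < n ∧ w = n • w' ∧ ∃ p q, wt w' p = wt w' q + 1 := by
  classical
  obtain ⟨i, hi⟩ := Function.ne_iff.1 hw
  obtain ⟨w', hw', hgcd⟩ := Finset.univ.extract_gcd w ⟨i, Finset.mem_univ i⟩
  have hn : Finset.univ.gcd w ≠ 0 := fun h => hi (Finset.gcd_eq_zero_iff.1 h i (Finset.mem_univ i))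
  -- After division by the gcd, the positive and negative parts of Bézout coefficients serve as `p`
  -- and `q`.
  obtain ⟨c, hc⟩ := Finset.gcd_eq_sum_mul Finset.univ fun i => (w' i : ℤ)
  have hgcd' : (Finset.univ.gcd fun i => (w' i : ℤ)) = 1 := by
    rw [← Finset.normalize_gcd, normalize_eq_one, Int.isUnit_iff_natAbs_eq, ← Nat.dvd_one, ← hgcd]
    exact Finset.dvd_gcd fun i hi => Int.natAbs_dvd_natAbs.2 (Finset.gcd_dvd hi)
  refine ⟨_, w', Nat.pos_of_ne_zero hn, funext fun i => hw' i (Finset.mem_univ i),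
    fun i => (c i).toNat, fun i => (-c i).toNat, ?_⟩
  rw [hgcd'] at hc
  zify
  rw [← sub_eq_iff_eq_add', hc, wt, wt]
  push_cast
  rw [← Finset.sum_sub_distrib]
  refine Finset.sum_congr rfl fun i _ => ?_
  rw [← sub_mul, mul_comm]
  congr 1
  omega

theorem wt_comp_subtype_val (w e : ι → ℕ) :
    wt (w ∘ Subtype.val : {i // 0 < w i} → ℕ) (e ∘ Subtype.val) = wt w e := by
  refine Fintype.sum_of_injective Subtype.val Subtype.val_injective _ _ (fun i hi => ?_)
    fun _ => rfl
  have : w i = 0 := by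
    by_contra h
    exact hi ⟨⟨i, Nat.pos_of_ne_zero h⟩, rfl⟩
  rw [this, mul_zero]

theorem monom_comp_subtype_val {R : Type*} [CommRing R] (x : ι → R) {s : ι → Prop}
    [Fintype {i // s i}] {e : ι → ℕ} (he : ∀ i, ¬ s i → e i = 0) :
    monom (x ∘ Subtype.val : {i // s i} → R) (e ∘ Subtype.val) = monom x e := by
  refine Fintype.prod_of_injective Subtype.val Subtype.val_injective _ _ (fun i hi => ?_)
    fun _ => rfl
  rw [he i fun h => hi ⟨⟨i, h⟩, rfl⟩, pow_zero]

/-- The exponent vectors `e` for which `e + (1, …, 1)` has larger weight than some element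
of `A`. -/
def halfspaceSet (A : Finset (ι → ℕ)) (w : ι → ℕ) : UpperSet (ι → ℕ) where
  carrier := {e | ∃ a ∈ A, wt w a < wt w (e + 1)}
  upper' _ _ h := fun ⟨a, ha, h'⟩ => ⟨a, ha, h'.trans_le (wt_mono w (add_le_add_left h 1))⟩

theorem mem_halfspaceSet {A : Finset (ι → ℕ)} {w e : ι → ℕ} :
    e ∈ halfspaceSet A w ↔ ∃ a ∈ A, wt w a < wt w (e + 1) := Iff.rfl

end Weights

/-! ### The adjoint of the zero ideal -/

section TrivialValuation

variable {R K : Type*} [CommRing R] [Field K] [Algebra R K] [IsFractionRing R K]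

/-- The trivial valuation has valuation ring `K`, without differentials over `R`, so its Jacobian
ideal is the unit ideal and the condition forces `r` to have infinite value. -/
theorem adjoint_bot : adjoint K (⊥ : Ideal R) = ⊥ := by
  classical
  rw [eq_bot_iff]
  intro r hr
  let v : AddValuation K (WithTop ℤ) := AddValuation.of (fun z => if z = 0 then ⊤ else 0)
    (by simp) (by simp) (fun a b => by
      by_cases ha : a = 0
      · simp [ha]
      · by_cases hb : b = 0
        · simp [hb]
        · simp only [if_neg ha, if_neg hb, min_self]
          split_ifs <;> simp)
    (fun a b => by
      by_cases ha : a = 0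
      · simp [ha]
      · by_cases hb : b = 0
        · simp [hb]
        · simp [ha, hb])
  have hv1 : ∀ z, z ≠ 0 → v z = 0 := fun z hz => if_neg hz
  have hv0 : ∀ z, 0 ≤ v z := fun z => by
    by_cases hz : z = 0
    · rw [hz, v.map_zero]
      exact le_top
    · rw [hv1 z hz]
  have htop : valuationSubalgebra v (fun s : R => hv0 _) = ⊤ := eq_top_iff.2 fun z _ => hv0 z
  have hloc : IsLocalization (nonZeroDivisors R) (valuationSubalgebra v (fun s : R => hv0 _)) :=
    IsLocalization.isLocalization_of_algEquiv _
      (Subalgebra.topEquiv.symm.trans (Subalgebra.equivOfEq _ _ htop.symm))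
  have hsub : Subsingleton Ω[valuationSubalgebra v (fun s : R => hv0 _)⁄R] :=
    (Algebra.FormallyUnramified.of_isLocalization (nonZeroDivisors R)).subsingleton_kaehlerDifferential
  have h := hr v (fun s => hv0 _) (Or.inr hv1) (Algebra.EssFiniteType.of_isLocalization _
    (nonZeroDivisors R))
  have hbot : idealValue v (⊥ : Ideal R) = ⊤ := by
    refine top_le_iff.1 ((isGLB_idealValue v (fun s : R => hv0 _) _).2 ?_)
    rintro _ ⟨a, ha, rfl⟩
    simp only [show a = 0 from ha, map_zero, v.map_zero, le_refl]
  have hjac : idealValue v (jacobianIdeal R (valuationSubalgebra v (fun s : R => hv0 _))) ≤ 0 := by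
    have h1 : (1 : valuationSubalgebra v (fun s : R => hv0 _)) ∈ jacobianIdeal R _ := by
      have h2 := det_mem_fittingIdealZero (κ := Empty) (A := valuationSubalgebra v (fun s : R => hv0 _))
        (M := Ω[valuationSubalgebra v (fun s : R => hv0 _)⁄R]) (g := fun _ => 0) (C := 1)
        (Subsingleton.elim _ _) fun i => i.elim
      rwa [Matrix.det_one] at h2
    exact (isGLB_idealValue v (fun a => a.2) _).1 ⟨1, h1, v.map_one⟩
  rw [hbot] at h
  have h1 : v (algebraMap R K r) = ⊤ :=
    top_le_iff.1 (h.trans ((add_le_add_right hjac _).trans_eq (add_zero _)))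
  by_contra hr0
  rw [hv1 _ fun h0 => hr0 ((IsFractionRing.injective R K) (h0.trans (map_zero _).symm))] at h1
  exact WithTop.zero_ne_top h1

end TrivialValuation

/-! ### Values of monomials and of ideals given by generators -/

section MonomialValue

variable {R K : Type*} [CommRing R] [Field K] [Algebra R K] {ι : Type*} [Fintype ι]

theorem addValuation_monom_of_var {v : AddValuation K (WithTop ℤ)} {x : ι → R} {w : ι → ℕ}
    (h : ∀ i, v (algebraMap R K (x i)) = (w i : ℤ)) (e : ι → ℕ) :
    v (algebraMap R K (monom x e)) = (wt w e : ℤ) := by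
  rw [monom, map_prod, map_prod_addValuation, wt, Nat.cast_sum, WithTop.coe_sum]
  refine Finset.sum_congr rfl fun i _ => ?_
  rw [map_pow, v.map_pow, h, Nat.cast_mul, ← nsmul_eq_mul]
  exact (WithTop.coe_nsmul _ _).symm

theorem le_idealValue_span {v : AddValuation K (WithTop ℤ)}
    (hv : ∀ r : R, 0 ≤ v (algebraMap R K r)) {s : Set R} {n : WithTop ℤ}
    (h : ∀ a ∈ s, n ≤ v (algebraMap R K a)) : n ≤ idealValue v (Ideal.span s) := by
  refine (isGLB_idealValue v hv _).2 ?_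
  rintro _ ⟨a, ha, rfl⟩
  change n ≤ v (algebraMap R K a)
  induction ha using Submodule.span_induction with
  | mem a ha => exact h a ha
  | zero => rw [map_zero, v.map_zero]; exact le_top
  | add a b _ _ ha hb => rw [map_add]; exact (le_min ha hb).trans (v.map_add _ _)
  | smul r a _ ha =>
    rw [smul_eq_mul, map_mul, v.map_mul]
    exact ha.trans (le_add_of_nonneg_left (hv r))

end MonomialValue

/-! ### The adjoint of a monomial ideal and interior points -/

section Adjoint

variable {R : Type*} [CommRing R] [IsDomain R] [IsRegularRing R] {K : Type*} [Field K]
  [Algebra R K] [IsFractionRing R K] {d : ℕ} {x : Fin d → R}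

/-- For the weight `w i = v (x i)`, interiority gives `w·a ≤ w·e + ∑ w_i - 1` for some `a ∈ A`, and
`∑ w_i - 1` is at most the value of the Jacobian ideal. That bound is applied to the parameters of
positive value only. -/
theorem IsGenRegularSystem.monom_mem_adjoint (hx : IsGenRegularSystem x)
    {A : Finset (Fin d → ℕ)} (hA : A.Nonempty) {e : Fin d → ℕ} (he : IsInterior A e) :
    monom x e ∈ adjoint K (Ideal.span (monom x '' A)) := by
  intro v hv hnorm hess
  have hp := hx.isPrimeSystem
  have hx0 : ∀ i, algebraMap R K (x i) ≠ 0 := fun i h0 =>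
    hp.notMem ∅ i (Set.notMem_empty i) (by
      rw [(IsFractionRing.injective R K) (h0.trans (map_zero _).symm)]
      exact zero_mem _)
  choose w hw using fun i => exists_nat_of_ne_zero v (hx0 i) (hv _)
  have hle : ∀ a ∈ A, idealValue v (Ideal.span (monom x '' A)) ≤ (wt w a : ℤ) := fun a ha =>
    addValuation_monom_of_var hw a ▸
      (isGLB_idealValue v hv _).1 ⟨monom x a, Ideal.subset_span ⟨a, ha, rfl⟩, rfl⟩
  rw [addValuation_monom_of_var hw]
  by_cases hw0 : w = 0
  · obtain ⟨a, ha⟩ := hA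
    refine (hle a ha).trans ?_
    rw [hw0]
    have hjac : 0 ≤ idealValue v (jacobianIdeal R (valuationSubalgebra v hv)) :=
      (isGLB_idealValue v (fun a => a.2) _).2 (by rintro _ ⟨a, _, rfl⟩; exact a.2)
    simpa [wt] using hjac
  · obtain ⟨a, ha, hlt⟩ := he w hw0
    refine (hle a ha).trans ?_
    obtain ⟨i, hi⟩ := Function.ne_iff.1 hw0
    obtain ⟨ϖ, hϖ⟩ : ∃ z, v z = 1 := hnorm.resolve_right fun h => hi (by
      have h1 := h _ (hx0 i)
      rw [hw] at h1
      exact_mod_cast h1)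
    have hreg : IsRegularRing
        (R ⧸ Ideal.span (Set.range (x ∘ Subtype.val : {i // 0 < w i} → R))) := by
      rw [Set.range_comp]
      exact hx.isRegularRing_quotient _
    have h := (hp.comp (Subtype.val_injective (p := fun i => 0 < w i))).sum_sub_one_le_idealValue
      hv hϖ (a := w ∘ Subtype.val) (fun i => i.2) (fun i => hw i)
    have hsum : ∑ i : {i // 0 < w i}, w i = ∑ i, w i := by
      rw [← wt_one w, ← wt_comp_subtype_val, wt]
      simp
    refine le_trans ?_ (add_le_add_right h _)
    rw [wt_add, wt_one, ← hsum] at hlt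
    rw [← WithTop.coe_add, WithTop.coe_le_coe]
    zify at hlt
    simp only [Function.comp_apply]
    omega

/-- Tests `r` against the monomial valuation of the primitive multiple of `w`, built on the
parameters of positive weight. Half-spaces do not change when the weight is rescaled. -/
theorem IsGenRegularSystem.mem_halfspace_of_mem_adjoint (hx : IsGenRegularSystem x)
    {A : Finset (Fin d → ℕ)} (hA : A.Nonempty) {r : R}
    (hr : r ∈ adjoint K (Ideal.span (monom x '' A))) {w : Fin d → ℕ} (hw : w ≠ 0) :
    r ∈ monomIdeal x (halfspaceSet A w) := by
  obtain ⟨n, w, hn, rfl, p, q, hpq⟩ := exists_primitive_weight hw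
  have hset : halfspaceSet A (n • w) = halfspaceSet A w := by
    ext e
    simp only [SetLike.mem_coe, mem_halfspaceSet, wt_smul, Nat.mul_lt_mul_left hn]
  rw [hset]
  have hp := hx.isPrimeSystem
  have hp' := hp.comp (Subtype.val_injective (p := fun i => 0 < w i))
  have hpos : ∀ i : {i // 0 < w i}, 0 < (w ∘ Subtype.val) i := fun i => i.2
  obtain ⟨v, hv⟩ := hp'.exists_addValuation K hpos
  have hv0 := nonneg_of_weightSet hv
  obtain ⟨hone, hess, hjac⟩ := hp'.essFiniteType_and_idealValue_le hpos hv hv0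
    (p ∘ Subtype.val) (q ∘ Subtype.val) (by rwa [wt_comp_subtype_val, wt_comp_subtype_val])
  have hvar : ∀ i, v (algebraMap R K (x i)) = (w i : ℤ) := by
    intro i
    by_cases hi : 0 < w i
    · exact hp'.addValuation_var hpos hv ⟨i, hi⟩
    -- A parameter of weight zero has value zero, since it lies outside the ideal of the parameters
    -- of positive weight.
    · have h1 : ¬ (((1 : ℕ) : ℤ) : WithTop ℤ) ≤ v (algebraMap R K (x i)) := fun h => by
        have h2 := monomIdeal_le_span_range (fun h0 => by
          simp [mem_weightSet] at h0) ((hv _ _).1 h)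
        rw [Set.range_comp, Subtype.range_coe_subtype] at h2
        exact hp.notMem _ i hi h2
      have h2 := hv0 (x i)
      have h3 : algebraMap R K (x i) ≠ 0 := fun h0 => h1 (by rw [h0, v.map_zero]; exact le_top)
      obtain ⟨m, hm⟩ := exists_nat_of_ne_zero v h3 h2
      rw [hm, WithTop.coe_le_coe] at h1
      rw [hm, WithTop.coe_inj]
      omega
  obtain ⟨a, ha, hmin⟩ := A.exists_min_image (wt w) hA
  have hlow : ((wt w a : ℤ) : WithTop ℤ) ≤ idealValue v (Ideal.span (monom x '' A)) := by
    refine le_idealValue_span hv0 ?_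
    rintro _ ⟨b, hb, rfl⟩
    rw [addValuation_monom_of_var hvar, WithTop.coe_le_coe]
    exact_mod_cast hmin b hb
  have hsum : ∑ i : {i // 0 < w i}, w i = ∑ i, w i := by
    rw [← wt_one w, ← wt_comp_subtype_val, wt]
    simp
  have hval := (hlow.trans (hr v hv0 (Or.inl hone) hess)).trans (add_le_add_right hjac _)
  -- The truncated subtraction is harmless, because `v` is nonnegative on `R`.
  have hmem : ((((wt w a + 1 - ∑ i, w i : ℕ) : ℕ) : ℤ) : WithTop ℤ) ≤ v (algebraMap R K r) := by
    have h0 := hv0 r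
    cases h : v (algebraMap R K r) with
    | top => exact le_top
    | coe m =>
      rw [h, ← WithTop.coe_add, WithTop.coe_le_coe] at hval
      rw [h, ← WithTop.coe_zero, WithTop.coe_le_coe] at h0
      rw [WithTop.coe_le_coe]
      simp only [Function.comp_apply] at hval
      rw [← Nat.cast_sum, hsum] at hval
      omega
  refine monomIdeal_le_iff.2 ?_ ((hv _ _).1 hmem)
  intro e' he'
  let e : Fin d → ℕ := fun i => if h : 0 < w i then e' ⟨i, h⟩ else 0
  have hee' : e' = e ∘ Subtype.val := by
    ext i
    simp [e, i.2]
  rw [hee', monom_comp_subtype_val x (e := e) fun i hi => dif_neg hi]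
  refine monom_mem (mem_halfspaceSet.2 ⟨a, ha, ?_⟩)
  rw [mem_weightSet, hee', wt_comp_subtype_val] at he'
  rw [wt_add, wt_one]
  omega

end Adjoint

/-! ### Subadditivity for finitely generated monomial ideals -/

section MainTheorem

theorem adjoint_mul_le {R : Type*} [CommRing R] [IsDomain R] [IsRegularRing R]
    {K : Type*} [Field K] [Algebra R K] [IsFractionRing R K]
    {d : ℕ} {x : Fin d → R} (hx : IsGenRegularSystem x)
    (A B : Finset (Fin d → ℕ)) :
    adjoint K (Ideal.span (monom x '' A) * Ideal.span (monom x '' B)) ≤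
      adjoint K (Ideal.span (monom x '' A)) * adjoint K (Ideal.span (monom x '' B)) := by
  classical
  intro r hr
  -- The description by interior points needs a nonempty set of generators, so the zero ideal is
  -- treated separately.
  rcases A.eq_empty_or_nonempty with rfl | hA
  · simp only [Finset.coe_empty, Set.image_empty, Ideal.span_empty, Ideal.bot_mul, adjoint_bot]
      at hr ⊢
    exact hr
  rcases B.eq_empty_or_nonempty with rfl | hB
  · simp only [Finset.coe_empty, Set.image_empty, Ideal.span_empty, Ideal.mul_bot, adjoint_bot]
      at hr ⊢
    exact hr
  rw [span_monom_mul_span_monom] at hr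
  set C := Finset.image₂ (· + ·) A B
  have hC : C.Nonempty := hA.image₂ hB
  obtain ⟨W, hW0, hW⟩ := exists_finite_weights hC
  have hr' := hx.isPrimeSystem.mem_monomIdeal_iSup W (halfspaceSet C)
    fun w hw => hx.mem_halfspace_of_mem_adjoint hC hr (hW0 w hw)
  refine monomIdeal_le_iff.2 ?_ hr'
  intro e he
  have hint : IsInterior C e := hW e fun w hw => Finset.le_sup (f := halfspaceSet C) hw he
  obtain ⟨e₁, e₂, h₁, h₂, hle⟩ := exists_isInterior_add_le (A := A) (B := B) (e := e) (by
    intro w hw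
    obtain ⟨c, hc, hlt⟩ := hint w hw
    obtain ⟨a, ha, b, hb, rfl⟩ := Finset.mem_image₂.1 hc
    exact ⟨a, ha, b, hb, by rwa [← wt_add]⟩)
  rw [← tsub_add_cancel_of_le hle, monom_add, monom_add]
  exact Ideal.mul_mem_left _ _
    (Ideal.mul_mem_mul (hx.monom_mem_adjoint hA h₁) (hx.monom_mem_adjoint hB h₂))

end MainTheorem

end MonomialAdjoint

end

theorem corollary4p2 {R : Type*} [CommRing R] [IsDomain R] [IsRegularRing R]
    {K : Type*} [Field K] [Algebra R K] [IsFractionRing R K]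
    {d : ℕ} (x : Fin d → R) (hx : MonomialAdjoint.IsGenRegularSystem x)
    (I J : Ideal R) (hI : MonomialAdjoint.IsMonomialIdeal x I)
    (hJ : MonomialAdjoint.IsMonomialIdeal x J) :
    MonomialAdjoint.adjoint K (I * J) ≤
      MonomialAdjoint.adjoint K I * MonomialAdjoint.adjoint K J := by
  obtain ⟨A, rfl⟩ := hI.exists_finset
  obtain ⟨B, rfl⟩ := hJ.exists_finset
  exact MonomialAdjoint.adjoint_mul_le hx A B
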